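/- Let $K\in\mathbb R$, $\lambda\in\{0,1,-1\}$. For radial functions $q(r,t)$ on $\mathbb R^2$ consider $$ (\mathrm{NLS})\qquad i q_t=-\Delta q+\frac1{r^2}q+F(q),\qquad F(q)(r)=\Big(K\int_r^\infty |q(\rho)|^2\frac{d\rho}{\rho}-\frac{\lambda}{2}|q(r)|^2\Big)q(r). $$ $L^p$ denotes the space of radial functions with $\|q\|_{L^p}^p=\int_0^\infty|q(r)|^p\,r\,dr<\infty$. The free flow $e^{it(\Delta-1/r^2)}$ is defined by $e^{i\theta}\,e^{it(\Delta-1/r^2)}q=e^{it\Delta}(e^{i\theta}q)$, where $(r,\theta)$ are polar coordinates and $e^{it\Delta}$ is the free Schrödinger flow on $\mathbb R^2$. For an interval $I$, put $S_I(q)=\int_I\|q(t)\|_{L^4}^4\,dt\in[0,\infty]$. A solution of (NLS) on $I$ with forcing $e$ is a $q\in C(I;L^2)\cap L^4_{loc}(I;L^4)$ with $$ q(t_1)=e^{i(t_1-t_0)(\Delta-1/r^2)}q(t_0)-i\int_{t_0}^{t_1}e^{i(t_1-s)(\Delta-1/r^2)}\big(F(q(s))+e(s)\big)\,ds\qquad\text{for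 all }t_0,t_1\in I, $$ understood, after multiplication by $e^{i\theta}$, as an identity of tempered distributions on $\mathbb R^2$; a solution of (NLS) on $I$ is one with $e=0$. A maximal solution with data $q_0$ is a solution $q$ on an open interval $I=(T_{min},T_{max})\ni 0$, $-\infty\le T_{min}<0<T_{max}\le\infty$, with $q(0)=q_0$, that cannot be extended to a solution on a strictly larger interval. Then: 1. For each $q_0\in L^2$ there is a maximal solution $q$ with data $q_0$, on some $I=(T_{min},T_{max})$. It is unique: every solution $p$ with $p(0)=q_0$ on any interval $J\ni0$ satisfies $J\subseteq I$ and $p=q$ on $J$. Moreover $\|q(t)\|_{L^2}=\|q_0\|_{L^2}$ for all $t\in I$. 2. For a maximal solution: if $T_{max}<\infty$ then $S_{[0,T_{max})}(q)=\infty$, and if $T_{min}>-\infty$ then $S_{(T_{min},0]}(q)=\infty$. 3. For a maximal solution: if $T_{max}=\infty$ and $S_{[0,\infty)}(q)<\infty$, there is $q_+\in L^2$ with $\|q(t)-e^{it(\Delta-1/r^2)}q_+\|_{L^2}\to0$ as $t\to+\infty$; if $T_{min}=-\infty$ and $S_{(-\infty,0]}(q)<\infty$, there is $q_-\in L^2$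 with $\|q(t)-e^{it(\Delta-1/r^2)}q_-\|_{L^2}\to0$ as $t\to-\infty$. 4. (Continuous dependence.) Let $q$ be the maximal solution with data $q_0$ on $I$, let $t\in I$ and $\varepsilon>0$. There is $\delta>0$ such that for every $p_0\in L^2$ with $\|p_0-q_0\|_{L^2}<\delta$ the maximal solution $p$ with data $p_0$ is defined at time $t$ and $\|p(t)-q(t)\|_{L^2}<\varepsilon$. (Stability.) For all $A,\varepsilon>0$ there is $\delta>0$, depending only on $A,\varepsilon,K,\lambda$, such that the following holds for every interval $I$. Let $u\in C(I;L^2)\cap L^4_{loc}(I;L^4)$ be a solution of (NLS) on $I$ with forcing $e$ (that is, $e=iu_t+\Delta u-u/r^2-F(u)$), where $S_I(u)\le A$ and $\|e\|_{L^{4/3}(I;L^{4/3})}\le\delta$. Let $t_0\in I$ and $v_0\in L^2$ satisfy $$\int_I\int_{\mathbb R^2}\big|e^{i(t-t_0)\Delta}\big[e^{i\theta}(u(t_0)-v_0)\big](x)\big|^4\,dx\,dt\le\delta.$$ Then there is a solution $v$ of (NLS) on $I$ with $v(t_0)=v_0$ and $S_I(u-v)\le\varepsilon$. 5. There is $\eta>0$,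 depending only on $K$ and $\lambda$, such that if $\|q_0\|_{L^2}<\eta$ then the maximal solution with data $q_0$ is global, $I=(-\infty,\infty)$, and $S_{\mathbb R}(q)<\infty$. -/

import Mathlib

open MeasureTheory Set Filter Topology
open scoped ENNReal SchwartzMap FourierTransform

noncomputable section

namespace RadialNLS

/-- The measure `r dr` on `(0, ∞)`, i.e. the radial part of Lebesgue measure on `ℝ²`. -/
def radialMeasure : Measure ℝ :=
  (volume.restrict (Ioi (0 : ℝ))).withDensity (fun r => ENNReal.ofReal r)

instance : SFinite radialMeasure := by
  unfold radialMeasure; infer_instance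

/-- Radial `L²` functions on `ℝ²`, represented by their profiles `q(r)`, `r > 0`, with
`‖q‖² = ∫₀^∞ |q(r)|² r dr`. -/
abbrev RadialL2 : Type := Lp ℂ 2 radialMeasure

/-- The function `x = r e^{iθ} ↦ e^{iθ} q(r)` on the plane `ℂ = ℝ²`. -/
def vortex (q : ℝ → ℂ) (x : ℂ) : ℂ := (x / (‖x‖ : ℂ)) * q ‖x‖

/-- Lebesgue measure on the plane is pushed forward by `x ↦ |x|` to `2π r dr`. -/
theorem map_norm_volume :
    Measure.map (fun x : ℂ => ‖x‖) volume = ENNReal.ofReal (2 * Real.pi) • radialMeasure := by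
  ext s hs
  have hfm : Measurable (s.indicator (fun _ : ℝ => (1 : ℝ≥0∞))) := measurable_const.indicator hs
  rw [← lintegral_indicator_one hs, ← lintegral_indicator_one hs]
  change ∫⁻ a, s.indicator (fun _ => (1 : ℝ≥0∞)) a ∂(Measure.map (fun x : ℂ => ‖x‖) volume)
    = ∫⁻ a, s.indicator (fun _ => (1 : ℝ≥0∞)) a ∂_
  rw [lintegral_map hfm measurable_norm, lintegral_smul_measure,
    ← Complex.lintegral_comp_polarCoord_symm, radialMeasure,
    lintegral_withDensity_eq_lintegral_mul _ ENNReal.measurable_ofReal hfm,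
    polarCoord_target]
  rw [Measure.volume_eq_prod, ← Measure.prod_restrict]
  have h1 : ∀ p : ℝ × ℝ, p ∈ Ioi (0 : ℝ) ×ˢ Ioo (-Real.pi) Real.pi →
      ENNReal.ofReal p.1 • s.indicator (fun _ => (1 : ℝ≥0∞)) ‖Complex.polarCoord.symm p‖ =
      ENNReal.ofReal p.1 * s.indicator (fun _ => (1 : ℝ≥0∞)) p.1 := by
    intro p hp
    rw [Complex.norm_polarCoord_symm, abs_of_pos hp.1, smul_eq_mul]
  rw [Measure.prod_restrict,
    setLIntegral_congr_fun (measurableSet_Ioi.prod measurableSet_Ioo) h1,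
    ← Measure.prod_restrict, lintegral_prod]
  · simp only [lintegral_const, Measure.restrict_apply MeasurableSet.univ, univ_inter,
      Real.volume_Ioo, Pi.mul_apply]
    rw [lintegral_mul_const (f := fun r => ENNReal.ofReal r * s.indicator (fun _ => 1) r) _
      (ENNReal.measurable_ofReal.mul hfm), mul_comm, smul_eq_mul]
    congr 2
    ring
  · exact ((ENNReal.measurable_ofReal.mul hfm).comp measurable_fst).aemeasurable

theorem memLp_vortex {q : ℝ → ℂ} (hq : MemLp q 2 radialMeasure) :
    MemLp (vortex q) 2 (volume : Measure ℂ) := by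
  have hq' : MemLp q 2 (Measure.map (fun x : ℂ => ‖x‖) volume) := by
    rw [map_norm_volume]
    exact hq.smul_measure ENNReal.ofReal_ne_top
  have hc : MemLp (q ∘ fun x : ℂ => ‖x‖) 2 volume := hq'.comp_of_map measurable_norm.aemeasurable
  refine hc.of_le (AEStronglyMeasurable.mul ?_ hc.1) (Eventually.of_forall fun x => ?_)
  · exact (Measurable.div measurable_id (by fun_prop)).aestronglyMeasurable
  · rw [vortex, norm_mul]
    refine mul_le_of_le_one_left (norm_nonneg _) ?_
    rw [norm_div, Complex.norm_real, norm_norm]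
    exact div_self_le_one _

/-- `q ↦ e^{iθ} q(r)` as a map from radial `L²` functions to `L²(ℝ²)`. It intertwines
`Δ - 1/r²` on radial functions with the Laplacian on `ℝ²`. -/
def vortexL2 (q : RadialL2) : Lp ℂ 2 (volume : Measure ℂ) := (memLp_vortex (Lp.memLp q)).toLp

/-- The Fourier symbol `exp(-4π² i t |ξ|²)` of `e^{itΔ}` (Fourier transform with phase
`e^{-2πi x·ξ}`). -/
def freeSymbol (t : ℝ) (ξ : ℂ) : ℂ :=
  Complex.exp (((-(4 * Real.pi ^ 2 * t) * ‖ξ‖ ^ 2 : ℝ) : ℂ) * Complex.I)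

theorem norm_freeSymbol (t : ℝ) (ξ : ℂ) : ‖freeSymbol t ξ‖ = 1 :=
  Complex.norm_exp_ofReal_mul_I _

theorem continuous_freeSymbol (t : ℝ) : Continuous (freeSymbol t) := by
  unfold freeSymbol; fun_prop

/-- The symbol is an admissible multiplier on Schwartz functions. -/
theorem hasTemperateGrowth_freeSymbol (t : ℝ) : (freeSymbol t).HasTemperateGrowth := by
  have hexp : Function.HasTemperateGrowth (fun s : ℝ => Complex.exp ((s : ℂ) * Complex.I)) := by
    have hd : ∀ n : ℕ, iteratedDeriv n (fun s : ℝ => Complex.exp ((s : ℂ) * Complex.I)) =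
        fun s : ℝ => Complex.I ^ n * Complex.exp ((s : ℂ) * Complex.I) := by
      intro n
      induction n with
      | zero => simp
      | succ n ih =>
        rw [iteratedDeriv_succ, ih]
        ext s
        have h : HasDerivAt (fun s : ℝ => Complex.exp ((s : ℂ) * Complex.I))
            (Complex.exp ((s : ℂ) * Complex.I) * (1 * Complex.I)) s :=
          ((Complex.ofRealCLM.hasDerivAt (x := s)).mul_const Complex.I).cexp
        rw [(h.const_mul (Complex.I ^ n)).deriv]
        ring
    refine ⟨(Complex.ofRealCLM.contDiff.mul contDiff_const).cexp, fun n => ⟨0, 1, fun s => ?_⟩⟩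
    rw [norm_iteratedFDeriv_eq_norm_iteratedDeriv, hd]
    simp [Complex.norm_exp_ofReal_mul_I]
  have hsq : Function.HasTemperateGrowth
      (fun ξ : ℂ => -(4 * Real.pi ^ 2 * t) * ‖ξ‖ ^ 2) :=
    (Function.HasTemperateGrowth.const _).mul (Function.hasTemperateGrowth_norm_sq ℂ)
  exact hexp.comp hsq

/-- The free propagator `e^{itΔ}` on Schwartz functions on the plane. -/
def freeSchwartz (t : ℝ) : 𝓢(ℂ, ℂ) →L[ℂ] 𝓢(ℂ, ℂ) :=
  SchwartzMap.fourierMultiplierCLM ℂ (freeSymbol t)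

theorem memLp_freeSymbol_mul (t : ℝ) (f : Lp ℂ 2 (volume : Measure ℂ)) :
    MemLp (fun ξ => freeSymbol t ξ * f ξ) 2 (volume : Measure ℂ) := by
  refine (Lp.memLp f).of_le
    ((continuous_freeSymbol t).aestronglyMeasurable.mul (Lp.memLp f).1)
    (Eventually.of_forall fun ξ => ?_)
  rw [norm_mul, norm_freeSymbol, one_mul]

/-- The free propagator `e^{itΔ}` on `L²(ℝ²)`. -/
def freeL2 (t : ℝ) (f : Lp ℂ 2 (volume : Measure ℂ)) : Lp ℂ 2 (volume : Measure ℂ) :=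
  𝓕⁻ (memLp_freeSymbol_mul t (𝓕 f)).toLp

/-- The nonlinearity
`F(q)(r) = (K ∫_r^∞ |q(ρ)|² dρ/ρ - (lam/2) |q(r)|²) q(r)`. -/
def nonlinearity (K lam : ℝ) (q : ℝ → ℂ) (r : ℝ) : ℂ :=
  ((K * (∫ ρ in Ioi r, ‖q ρ‖ ^ 2 / ρ) - lam / 2 * ‖q r‖ ^ 2 : ℝ) : ℂ) * q r

/-- The fourth power of the space-time norm, `∫_I ∫ |q(r,t)|⁴ r dr dt`, possibly infinite. -/
def scatteringSize (I : Set ℝ) (q : ℝ → RadialL2) : ℝ≥0∞ :=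
  ∫⁻ t in I, ∫⁻ r, ‖q t r‖ₑ ^ 4 ∂radialMeasure

/-- `q` is a strong solution on the interval `I` of the equation with forcing `e`,
`i q_t = -Δ q + q / r² + F(q) + e`: it lies in `C(I; L²) ∩ L⁴_loc(I; L⁴)` and satisfies the
Duhamel formula
`q(t₁) = e^{i(t₁-t₀)(Δ-1/r²)} q(t₀) - i ∫_{t₀}^{t₁} e^{i(t₁-s)(Δ-1/r²)} (F(q(s)) + e(s)) ds`
for all `t₀, t₁ ∈ I`, as an identity of tempered distributions for `e^{iθ} q`. -/
structure IsForcedSolution (K lam : ℝ) (I : Set ℝ) (q : ℝ → RadialL2) (e : ℝ → ℝ → ℂ) :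
    Prop where
  ordConnected : I.OrdConnected
  continuousOn : ContinuousOn q I
  locallyL4 : ∀ a ∈ I, ∀ b ∈ I, scatteringSize (Icc a b) q < ∞
  duhamel : ∀ t₀ ∈ I, ∀ t₁ ∈ I, ∀ φ : 𝓢(ℂ, ℂ),
    ∫ x : ℂ, vortex (q t₁) x * φ x =
      (∫ x : ℂ, vortex (q t₀) x * freeSchwartz (t₁ - t₀) φ x) -
        Complex.I * ∫ s in t₀..t₁, ∫ x : ℂ,
          vortex (fun r => nonlinearity K lam (q s) r + e s r) x * freeSchwartz (t₁ - s) φ x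

/-- `q` is a strong solution of `i q_t = -Δ q + q / r² + F(q)` on the interval `I`. -/
def IsSolution (K lam : ℝ) (I : Set ℝ) (q : ℝ → RadialL2) : Prop :=
  IsForcedSolution K lam I q (fun _ _ => 0)

/-- The open interval `(Tmin, Tmax)` with possibly infinite end points. -/
def lifespan (Tmin Tmax : EReal) : Set ℝ := {t : ℝ | Tmin < (t : EReal) ∧ (t : EReal) < Tmax}

/-- `q` is a solution with data `q₀` at time `0` on `(Tmin, Tmax) ∋ 0`, and it has no extension to
a solution on a strictly larger interval. (The values of `q` outside the interval play no role.) -/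
structure IsMaximalSolution (K lam : ℝ) (q₀ : RadialL2) (Tmin Tmax : EReal)
    (q : ℝ → RadialL2) : Prop where
  Tmin_neg : Tmin < 0
  Tmax_pos : 0 < Tmax
  isSolution : IsSolution K lam (lifespan Tmin Tmax) q
  initial : q 0 = q₀
  maximal : ∀ (J : Set ℝ) (p : ℝ → RadialL2), lifespan Tmin Tmax ⊆ J → IsSolution K lam J p →
    EqOn p q (lifespan Tmin Tmax) → J = lifespan Tmin Tmax

/-- `q(t)` is asymptotic in `L²` to the free evolution `e^{it(Δ-1/r²)} q₊` of some radial
`q₊ ∈ L²` as `t → +∞` (`l = atTop`) or `t → -∞` (`l = atBot`). -/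
def Scatters (q : ℝ → RadialL2) (l : Filter ℝ) : Prop :=
  ∃ qAsym : RadialL2, Tendsto (fun t => ‖vortexL2 (q t) - freeL2 t (vortexL2 qAsym)‖) l (𝓝 0)

end RadialNLS

end

noncomputable section

namespace RadialNLS

/-! ### The free propagator on `L²(ℝ²)` -/

/-! Multiplication by e^{iθ} turns Δ − 1/r² on radial profiles into the planar Laplacian. Since
e^{itΔ} commutes with rotations, it preserves the functions that transform like e^{iθ}, and so
descends to a unitary group `flow` on `RadialL2`. The problem is mass-critical, and the
well-posedness theory runs in L⁴(dt; L⁴) with dual L^{4/3}(dt; L^{4/3}).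

The linear input is the L⁴ Strichartz estimate (`strichartz_freeL2`), proved from scratch. The
fourth power of the L⁴ norm of a free wave is the squared L² norm of a self-convolution on the
Fourier side. The parallelogram law separates the time phase into a factor depending on the sum of
the two frequencies and a factor in |b|², where b is half their difference; Plancherel in t then
applies, because in dimension two |b|² pushes Lebesgue measure to a multiple of ds. Duality gives
the adjoint `evolveDual`, and a Christ–Kiselev decomposition of time by the mass of the force gives
the retarded estimate (`scatteringSize_retarded_le`, `norm_duhamel_le`).

The nonlinear input is the cubic bound `norm_force_sub_le`: the operator g ↦ ∫_r^∞ g dρ/ρ is bounded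
on L²(r dr), so the nonlocal term obeys the same Hölder estimate as |q|²q. The nonlinearity also
acts separately at each time, so it commutes with cutting to a set of times.

The equation is rewritten in the interaction picture: e^{-it(Δ−1/r²)}q(t) changes by increments of
`partialDual` applied to the force (`duhamel_iff_profile`). Existence and stability both come from
`exists_perturbation`, a contraction argument iterated over finitely many time shells around t₀,
each carrying a small amount of the L⁴ mass of u. Existence perturbs the zero solution, small either
because the interval is short or because the data are small. Uniqueness (`eq_of_sub_eq_cut`) uses
the same shells. Maximal solutions are unions of glued local ones; finite L⁴ size lets a solution be
continued to a finite endpoint, and makes the profile converge at infinity.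

Mass conservation avoids regularization. On a short time interval the first-order change of ‖q‖²
vanishes because −iF(q) is pointwise orthogonal to q, so the change is quadratic in the L^{4/3} norm
of the force, that is, of order 3/2 in an additive continuous quantity. Such a function is constant
(`eq_of_abs_sub_le_rpow`). -/

abbrev PlaneL2 : Type := Lp ℂ 2 (volume : Measure ℂ)

theorem freeSymbol_add (s t : ℝ) (ξ : ℂ) :
    freeSymbol (s + t) ξ = freeSymbol s ξ * freeSymbol t ξ := by
  rw [freeSymbol, freeSymbol, freeSymbol, ← Complex.exp_add]
  congr 1
  push_cast
  ring

theorem freeSymbol_zero (ξ : ℂ) : freeSymbol 0 ξ = 1 := by simp [freeSymbol]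

/-- Multiplication by the Fourier symbol of `e^{itΔ}`. -/
def symbolMul (t : ℝ) (g : PlaneL2) : PlaneL2 := (memLp_freeSymbol_mul t g).toLp

theorem coeFn_symbolMul (t : ℝ) (g : PlaneL2) :
    symbolMul t g =ᵐ[volume] fun ξ => freeSymbol t ξ * g ξ := MemLp.coeFn_toLp _

theorem freeL2_eq (t : ℝ) (f : PlaneL2) : freeL2 t f = 𝓕⁻ (symbolMul t (𝓕 f)) := rfl

theorem symbolMul_add (t : ℝ) (f g : PlaneL2) :
    symbolMul t (f + g) = symbolMul t f + symbolMul t g := by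
  apply Lp.ext
  filter_upwards [coeFn_symbolMul t (f + g), coeFn_symbolMul t f, coeFn_symbolMul t g,
    Lp.coeFn_add f g, Lp.coeFn_add (symbolMul t f) (symbolMul t g)] with x h1 h2 h3 h4 h5
  rw [h1, h5, h4, Pi.add_apply, Pi.add_apply, h2, h3, mul_add]

theorem symbolMul_smul (t : ℝ) (c : ℂ) (f : PlaneL2) :
    symbolMul t (c • f) = c • symbolMul t f := by
  apply Lp.ext
  filter_upwards [coeFn_symbolMul t (c • f), coeFn_symbolMul t f,
    Lp.coeFn_smul c f, Lp.coeFn_smul c (symbolMul t f)] with x h1 h2 h4 h5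
  rw [h1, h5, h4, Pi.smul_apply, Pi.smul_apply, h2, smul_eq_mul, smul_eq_mul]
  ring

theorem norm_symbolMul (t : ℝ) (f : PlaneL2) : ‖symbolMul t f‖ = ‖f‖ := by
  rw [Lp.norm_def, Lp.norm_def]
  congr 1
  apply eLpNorm_congr_norm_ae
  filter_upwards [coeFn_symbolMul t f] with x h1
  rw [h1, norm_mul, norm_freeSymbol, one_mul]

theorem symbolMul_symbolMul (s t : ℝ) (f : PlaneL2) :
    symbolMul s (symbolMul t f) = symbolMul (s + t) f := by
  apply Lp.ext
  filter_upwards [coeFn_symbolMul t f, coeFn_symbolMul s (symbolMul t f),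
    coeFn_symbolMul (s + t) f] with x h1 h2 h3
  rw [h2, h1, h3, freeSymbol_add, mul_assoc]

theorem symbolMul_zero (f : PlaneL2) : symbolMul 0 f = f := by
  apply Lp.ext
  filter_upwards [coeFn_symbolMul 0 f] with x h1
  rw [h1, freeSymbol_zero, one_mul]

/-- Dominated convergence: the symbol is continuous in t and has modulus one, so (2|g|)² is an
integrable majorant. -/
theorem continuous_symbolMul (g : PlaneL2) : Continuous fun t => symbolMul t g := by
  rw [continuous_iff_continuousAt]
  intro t
  rw [ContinuousAt, Lp.tendsto_Lp_iff_tendsto_eLpNorm']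
  have hlim : Tendsto (fun s => ∫⁻ x, ‖(freeSymbol s x - freeSymbol t x) * g x‖ₑ ^ (2 : ℝ))
      (𝓝 t) (𝓝 (∫⁻ _ : ℂ, 0)) := by
    apply tendsto_lintegral_filter_of_dominated_convergence (fun x => (2 * ‖g x‖ₑ) ^ (2 : ℝ))
    · refine Eventually.of_forall fun s => ?_
      have h1 : Measurable (fun x => (freeSymbol s x - freeSymbol t x) * g x) :=
        (((continuous_freeSymbol s).sub (continuous_freeSymbol t)).measurable).mul
          (Lp.stronglyMeasurable g).measurable
      exact h1.enorm.pow_const _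
    · refine Eventually.of_forall fun s => Eventually.of_forall fun x => ?_
      gcongr
      rw [enorm_mul]
      gcongr
      refine (enorm_sub_le).trans ?_
      rw [← ofReal_norm, ← ofReal_norm, norm_freeSymbol, norm_freeSymbol]
      norm_num
    · have h := (Lp.memLp g).2
      rw [eLpNorm_lt_top_iff_lintegral_rpow_enorm_lt_top (by norm_num) (by norm_num)] at h
      simp only [ENNReal.toReal_ofNat] at h
      simp_rw [ENNReal.mul_rpow_of_nonneg _ _ (by norm_num : (0:ℝ) ≤ 2)]
      rw [lintegral_const_mul' _ _ (by norm_num)]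
      exact ENNReal.mul_ne_top (by norm_num) h.ne
    · refine Eventually.of_forall fun x => ?_
      have hc : Continuous fun s => ‖(freeSymbol s x - freeSymbol t x) * g x‖ₑ ^ (2 : ℝ) := by
        refine ENNReal.continuous_rpow_const.comp (continuous_enorm.comp ?_)
        unfold freeSymbol
        fun_prop
      have := hc.tendsto t
      simpa using this
  have h2 : ∀ s, eLpNorm (symbolMul s g - symbolMul t g : ℂ → ℂ) 2 volume =
      (∫⁻ x, ‖(freeSymbol s x - freeSymbol t x) * g x‖ₑ ^ (2 : ℝ)) ^ (1 / (2 : ℝ)) := by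
    intro s
    rw [eLpNorm_eq_lintegral_rpow_enorm_toReal (by norm_num) (by norm_num)]
    simp only [ENNReal.toReal_ofNat]
    congr 1
    apply lintegral_congr_ae
    filter_upwards [coeFn_symbolMul s g, coeFn_symbolMul t g] with x h1 h2
    rw [Pi.sub_apply, h1, h2, sub_mul]
  simp_rw [h2]
  have h3 := ((ENNReal.continuous_rpow_const (y := 1 / (2 : ℝ))).tendsto _).comp hlim
  simpa [Function.comp_def] using h3

theorem freeL2_add (t : ℝ) (f g : PlaneL2) : freeL2 t (f + g) = freeL2 t f + freeL2 t g := by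
  rw [freeL2_eq, freeL2_eq, freeL2_eq, FourierTransform.fourier_add, symbolMul_add,
    FourierTransform.fourierInv_add]

theorem freeL2_smul (t : ℝ) (c : ℂ) (f : PlaneL2) : freeL2 t (c • f) = c • freeL2 t f := by
  rw [freeL2_eq, freeL2_eq, FourierTransform.fourier_smul, symbolMul_smul,
    FourierTransform.fourierInv_smul]

theorem norm_freeL2 (t : ℝ) (f : PlaneL2) : ‖freeL2 t f‖ = ‖f‖ := by
  rw [freeL2_eq, ← Lp.norm_fourier_eq, FourierTransform.fourier_fourierInv_eq, norm_symbolMul,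
    Lp.norm_fourier_eq]

theorem freeL2_freeL2 (s t : ℝ) (f : PlaneL2) : freeL2 s (freeL2 t f) = freeL2 (s + t) f := by
  rw [freeL2_eq, freeL2_eq, freeL2_eq, FourierTransform.fourier_fourierInv_eq,
    symbolMul_symbolMul]

theorem freeL2_zero (f : PlaneL2) : freeL2 0 f = f := by
  rw [freeL2_eq, symbolMul_zero, FourierTransform.fourierInv_fourier_eq]

theorem continuous_freeL2 (f : PlaneL2) : Continuous fun t => freeL2 t f := by
  simp_rw [freeL2_eq]
  exact (ContinuousFourierInv.continuous_fourierInv).comp (continuous_symbolMul (𝓕 f))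

/-- The free propagator as a linear isometry. -/
def freeIsometry (t : ℝ) : PlaneL2 →ₗᵢ[ℂ] PlaneL2 where
  toFun := freeL2 t
  map_add' := freeL2_add t
  map_smul' := freeL2_smul t
  norm_map' := norm_freeL2 t

/-! ### Schwartz data: rotation symmetry and the transpose of the propagator -/

theorem freeSchwartz_apply (t : ℝ) (φ : 𝓢(ℂ, ℂ)) :
    freeSchwartz t φ = 𝓕⁻ (SchwartzMap.smulLeftCLM ℂ (freeSymbol t) (𝓕 φ)) := rfl

theorem freeL2_toLp (t : ℝ) (φ : 𝓢(ℂ, ℂ)) :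
    freeL2 t (φ.toLp 2) = (freeSchwartz t φ).toLp 2 := by
  rw [freeL2_eq, SchwartzMap.toLp_fourier_eq, freeSchwartz_apply, ← SchwartzMap.toLp_fourierInv_eq]
  congr 1
  apply Lp.ext
  filter_upwards [coeFn_symbolMul t ((𝓕 φ).toLp 2), (𝓕 φ).coeFn_toLp 2 volume,
    (SchwartzMap.smulLeftCLM ℂ (freeSymbol t) (𝓕 φ)).coeFn_toLp 2 volume] with x h1 h2 h3
  rw [h1, h2, h3, SchwartzMap.smulLeftCLM_apply_apply (hasTemperateGrowth_freeSymbol t),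
    smul_eq_mul]

/-- Composition of a Schwartz function with a linear isometry of the plane. -/
def compIsometry (A : ℂ ≃ₗᵢ[ℝ] ℂ) : 𝓢(ℂ, ℂ) →L[ℂ] 𝓢(ℂ, ℂ) :=
  SchwartzMap.compCLMOfContinuousLinearEquiv ℂ A.toContinuousLinearEquiv

theorem compIsometry_apply (A : ℂ ≃ₗᵢ[ℝ] ℂ) (φ : 𝓢(ℂ, ℂ)) (x : ℂ) :
    compIsometry A φ x = φ (A x) := rfl

theorem fourier_compIsometry (A : ℂ ≃ₗᵢ[ℝ] ℂ) (φ : 𝓢(ℂ, ℂ)) :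
    𝓕 (compIsometry A φ) = compIsometry A (𝓕 φ) := by
  ext x
  rw [compIsometry_apply, SchwartzMap.fourier_coe, SchwartzMap.fourier_coe]
  exact Real.fourier_comp_linearIsometry A φ x

theorem fourierInv_compIsometry (A : ℂ ≃ₗᵢ[ℝ] ℂ) (φ : 𝓢(ℂ, ℂ)) :
    𝓕⁻ (compIsometry A φ) = compIsometry A (𝓕⁻ φ) := by
  ext x
  rw [compIsometry_apply, SchwartzMap.fourierInv_coe, SchwartzMap.fourierInv_coe]
  exact Real.fourierInv_comp_linearIsometry A φ x

theorem smulLeft_compIsometry (t : ℝ) (A : ℂ ≃ₗᵢ[ℝ] ℂ) (φ : 𝓢(ℂ, ℂ)) :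
    SchwartzMap.smulLeftCLM ℂ (freeSymbol t) (compIsometry A φ) =
      compIsometry A (SchwartzMap.smulLeftCLM ℂ (freeSymbol t) φ) := by
  ext x
  rw [compIsometry_apply, SchwartzMap.smulLeftCLM_apply_apply (hasTemperateGrowth_freeSymbol t),
    SchwartzMap.smulLeftCLM_apply_apply (hasTemperateGrowth_freeSymbol t), compIsometry_apply,
    freeSymbol, freeSymbol, A.norm_map]

theorem freeSchwartz_compIsometry (t : ℝ) (A : ℂ ≃ₗᵢ[ℝ] ℂ) (φ : 𝓢(ℂ, ℂ)) :
    freeSchwartz t (compIsometry A φ) = compIsometry A (freeSchwartz t φ) := by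
  rw [freeSchwartz_apply, freeSchwartz_apply, fourier_compIsometry, smulLeft_compIsometry,
    fourierInv_compIsometry]

theorem fourierInv_eq_compIsometry_fourier (φ : 𝓢(ℂ, ℂ)) :
    𝓕⁻ φ = compIsometry (LinearIsometryEquiv.neg ℝ) (𝓕 φ) := rfl

/-- The symbol is even, so conjugating it by 𝓕 or by 𝓕⁻ gives the same operator. Hence e^{itΔ} is
its own transpose for the bilinear pairing ∫ fg, with no conjugation and no change of sign of t. -/
theorem fourierMultiplier_transpose (t : ℝ) (φ : 𝓢(ℂ, ℂ)) :
    𝓕 (SchwartzMap.smulLeftCLM ℂ (freeSymbol t) (𝓕⁻ φ)) = freeSchwartz t φ := by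
  rw [freeSchwartz_apply, fourierInv_eq_compIsometry_fourier φ, smulLeft_compIsometry,
    fourier_compIsometry, fourierInv_eq_compIsometry_fourier]

theorem integral_freeSchwartz_mul (t : ℝ) (ψ φ : 𝓢(ℂ, ℂ)) :
    ∫ x, freeSchwartz t ψ x * φ x = ∫ x, ψ x * freeSchwartz t φ x := by
  rw [← fourierMultiplier_transpose t φ, ← SchwartzMap.integral_fourier_mul_eq,
    freeSchwartz_apply, SchwartzMap.integral_fourierInv_mul_eq]
  refine integral_congr_ae (Eventually.of_forall fun x => ?_)
  simp only [SchwartzMap.smulLeftCLM_apply_apply (hasTemperateGrowth_freeSymbol t), smul_eq_mul]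
  ring

theorem continuous_integral_mul_schwartz (ψ : 𝓢(ℂ, ℂ)) :
    Continuous fun g : PlaneL2 => ∫ x, g x * ψ x := by
  have h : ∀ g : PlaneL2, ∫ x, g x * ψ x =
      (ContinuousLinearMap.mul ℂ ℂ).lpPairing volume 2 2 g (ψ.toLp 2) := by
    intro g
    rw [ContinuousLinearMap.lpPairing_eq_integral]
    apply integral_congr_ae
    filter_upwards [ψ.coeFn_toLp 2 volume] with x hx
    rw [hx, ContinuousLinearMap.mul_apply']
  simp_rw [h]
  fun_prop

theorem integral_freeL2_toLp_mul (t : ℝ) (ψ φ : 𝓢(ℂ, ℂ)) :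
    ∫ x, freeL2 t (ψ.toLp 2) x * φ x = ∫ x, (ψ.toLp 2 : PlaneL2) x * freeSchwartz t φ x := by
  rw [freeL2_toLp, integral_congr_ae (g := fun x => freeSchwartz t ψ x * φ x),
    integral_freeSchwartz_mul]
  · apply integral_congr_ae
    filter_upwards [ψ.coeFn_toLp 2 volume] with x hx
    rw [hx]
  · filter_upwards [(freeSchwartz t ψ).coeFn_toLp 2 volume] with x hx
    rw [hx]

theorem denseRange_schwartz_toLp : DenseRange fun ψ : 𝓢(ℂ, ℂ) => (ψ.toLp 2 : PlaneL2) :=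
  SchwartzMap.denseRange_toLpCLM (E := ℂ) (F := ℂ) (p := 2) (μ := volume) (by norm_num)

theorem continuous_freeL2_right (t : ℝ) : Continuous (freeL2 t) := (freeIsometry t).continuous

/-- Both sides are continuous in f for the L² norm, so the Schwartz case extends by density. This
links the propagator on test functions in the weak Duhamel formula to the one on L². -/
theorem integral_freeL2_mul (t : ℝ) (f : PlaneL2) (φ : 𝓢(ℂ, ℂ)) :
    ∫ x, freeL2 t f x * φ x = ∫ x, f x * freeSchwartz t φ x := by
  refine denseRange_schwartz_toLp.induction_on
    (p := fun f => ∫ x, freeL2 t f x * φ x = ∫ x, f x * freeSchwartz t φ x) f ?_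
    fun ψ => integral_freeL2_toLp_mul t ψ φ
  exact isClosed_eq ((continuous_integral_mul_schwartz φ).comp (continuous_freeL2_right t))
    (continuous_integral_mul_schwartz (freeSchwartz t φ))

/-! ### The `L⁴` Strichartz estimate -/

/-- Plancherel's theorem for functions in `L¹ ∩ L²` on the line. -/
theorem eLpNorm_fourier_eq {φ : ℝ → ℂ} (h1 : Integrable φ) (h2 : MemLp φ 2) :
    eLpNorm (𝓕 φ) 2 volume = eLpNorm φ 2 volume := by
  set g : Lp ℂ 2 (volume : Measure ℝ) := 𝓕 (h2.toLp φ) with hg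
  have hcont : Continuous (𝓕 φ) :=
    VectorFourier.fourierIntegral_continuous Real.continuous_fourierChar (by fun_prop) h1
  -- The L² transform, defined by extension, agrees with the Fourier integral: tested against smooth
  -- compactly supported functions, both pass the transform to the test function.
  have hae : (g : ℝ → ℂ) =ᵐ[volume] 𝓕 φ := by
    apply ae_eq_of_integral_contDiff_smul_eq
      ((Lp.memLp g).locallyIntegrable (by norm_num)) hcont.locallyIntegrable
    intro ψ hψ hψc
    have hg₁ : HasCompactSupport (Complex.ofRealCLM ∘ ψ) := hψc.comp_left rfl
    have hg₂ : ContDiff ℝ ((⊤ : ℕ∞) : WithTop ℕ∞) (Complex.ofRealCLM ∘ ψ) :=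
      Complex.ofRealCLM.contDiff.comp hψ
    set Ψ : 𝓢(ℝ, ℂ) := hg₁.toSchwartzMap hg₂ with hΨ
    have e1 : ∀ k : ℝ → ℂ, ∫ x, ψ x • k x = ∫ x, Ψ x • k x := by
      intro k
      refine integral_congr_ae (Eventually.of_forall fun x => ?_)
      simp [hΨ]
    rw [e1, e1, ← Lp.toTemperedDistribution_apply, hg, ← Lp.fourier_toTemperedDistribution_eq,
      TemperedDistribution.fourier_apply, Lp.toTemperedDistribution_apply]
    have e2 : ∫ x, 𝓕 Ψ x • (h2.toLp φ : ℝ → ℂ) x = ∫ x, 𝓕 Ψ x • φ x := by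
      apply integral_congr_ae
      filter_upwards [h2.coeFn_toLp] with x hx
      rw [hx]
    rw [e2]
    have := VectorFourier.integral_bilin_fourierIntegral_eq_flip (ContinuousLinearMap.mul ℂ ℂ)
      (L := innerₗ ℝ) (μ := volume) (ν := volume) Real.continuous_fourierChar continuous_inner
      (Ψ.integrable (μ := volume)) h1
    simpa using! this
  rw [← eLpNorm_congr_ae hae, ← eLpNorm_congr_ae h2.coeFn_toLp, ← Lp.enorm_def, ← Lp.enorm_def, hg,
    ← ofReal_norm, ← ofReal_norm, Lp.norm_fourier_eq]

theorem lintegral_comp_norm (g : ℝ → ℝ≥0∞) (hg : Measurable g) :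
    ∫⁻ x : ℂ, g ‖x‖ = ENNReal.ofReal (2 * Real.pi) * ∫⁻ r, g r ∂radialMeasure := by
  rw [← lintegral_map hg measurable_norm, map_norm_volume, lintegral_smul_measure, smul_eq_mul]

theorem lintegral_radialMeasure (g : ℝ → ℝ≥0∞) (hg : Measurable g) :
    ∫⁻ r, g r ∂radialMeasure = ∫⁻ r in Ioi (0 : ℝ), ENNReal.ofReal r * g r := by
  rw [radialMeasure, lintegral_withDensity_eq_lintegral_mul _ ENNReal.measurable_ofReal hg]
  rfl

/-- In dimension two the area element is linear in r, so s = 4πr² flattens it: 2πr dr = ds/4. The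
factor 1/4 is discarded. -/
theorem lintegral_comp_norm_sq_le (g : ℝ → ℝ≥0∞) (hg : Measurable g) :
    ∫⁻ b : ℂ, g (4 * Real.pi * ‖b‖ ^ 2) ≤ ∫⁻ s, g s := by
  have hm : Measurable fun r : ℝ => g (4 * Real.pi * r ^ 2) := hg.comp (by fun_prop)
  rw [lintegral_comp_norm (fun r => g (4 * Real.pi * r ^ 2)) hm, lintegral_radialMeasure _ hm]
  have hpi := Real.pi_pos
  have hinj : InjOn (fun r : ℝ => 4 * Real.pi * r ^ 2) (Ioi 0) := by
    intro a ha b hb hab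
    have h : a ^ 2 = b ^ 2 := mul_left_cancel₀ (by positivity) hab
    exact (pow_left_inj₀ (le_of_lt ha) (le_of_lt hb) two_ne_zero).1 h
  have hder : ∀ r ∈ Ioi (0 : ℝ), HasDerivWithinAt (fun r : ℝ => 4 * Real.pi * r ^ 2)
      (4 * Real.pi * (2 * r)) (Ioi 0) r := by
    intro r _
    have := ((hasDerivAt_pow 2 r).const_mul (4 * Real.pi)).hasDerivWithinAt (s := Ioi 0)
    simpa using this
  have hcv := lintegral_image_eq_lintegral_abs_deriv_mul measurableSet_Ioi hder hinj g
  calc ENNReal.ofReal (2 * Real.pi) * ∫⁻ r in Ioi (0 : ℝ), ENNReal.ofReal r * g (4 * Real.pi * r ^ 2)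
      = ∫⁻ r in Ioi (0 : ℝ), ENNReal.ofReal (2 * Real.pi) *
          (ENNReal.ofReal r * g (4 * Real.pi * r ^ 2)) :=
        (lintegral_const_mul _ (by fun_prop)).symm
    _ ≤ ∫⁻ r in Ioi (0 : ℝ), ENNReal.ofReal |4 * Real.pi * (2 * r)| * g (4 * Real.pi * r ^ 2) := by
        apply setLIntegral_mono' measurableSet_Ioi
        intro r hr
        have hr' : (0 : ℝ) < r := hr
        rw [← mul_assoc, ← ENNReal.ofReal_mul (by positivity), abs_of_pos (by positivity)]
        gcongr ?_ * _
        exact ENNReal.ofReal_le_ofReal (by nlinarith)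
    _ = ∫⁻ s in (fun r : ℝ => 4 * Real.pi * r ^ 2) '' Ioi 0, g s := hcv.symm
    _ ≤ ∫⁻ s, g s := setLIntegral_le_lintegral _ _

/-- The oscillatory integral `t ↦ ∫ h(b) e^{-8π² i t |b|²} db`. -/
def quadraticPhase (h : ℂ → ℂ) (t : ℝ) : ℂ :=
  ∫ b, Real.fourierChar (-(t * (4 * Real.pi * ‖b‖ ^ 2))) • h b

theorem continuous_quadraticPhase {h : ℂ → ℂ} (h1 : Integrable h) :
    Continuous (quadraticPhase h) := by
  unfold quadraticPhase
  refine continuous_of_dominated (bound := fun b => ‖h b‖) (fun t => ?_) (fun t => ?_) h1.norm ?_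
  · refine AEStronglyMeasurable.smul ?_ h1.1
    exact ((continuous_subtype_val.comp Real.continuous_fourierChar).comp
      (f := fun b : ℂ => -(t * (4 * Real.pi * ‖b‖ ^ 2))) (by fun_prop)).aestronglyMeasurable
  · exact Eventually.of_forall fun b => by rw [Circle.norm_smul]
  · exact Eventually.of_forall fun b =>
      (Real.continuous_fourierChar.comp
        (f := fun t : ℝ => -(t * (4 * Real.pi * ‖b‖ ^ 2))) (by fun_prop)).smul continuous_const

theorem norm_quadraticPhase_le (h : ℂ → ℂ) (t : ℝ) :
    ‖quadraticPhase h t‖ ≤ ∫ b, ‖h b‖ := by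
  refine (norm_integral_le_integral_norm _).trans_eq ?_
  simp_rw [Circle.norm_smul]

/-- Duality. Pairing Ψ with its own truncated conjugate φ gives M = ∫ h(b) φ̂(4π|b|²) db by Fubini.
Cauchy–Schwarz, the flattening of |b|² and Plancherel bound this by ‖h‖₂ M^{1/2}. Truncation in time
keeps M finite, so that M^{1/2} can be cancelled. -/
theorem lintegral_quadraticPhase_Icc_le {h : ℂ → ℂ} (h1 : Integrable h)
    (n : ℝ) :
    ∫⁻ t in Icc (-n) n, ‖quadraticPhase h t‖ₑ ^ 2 ≤ ∫⁻ b, ‖h b‖ₑ ^ 2 := by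
  set Ψ := quadraticPhase h with hΨ
  have hΨc : Continuous Ψ := continuous_quadraticPhase h1
  set φ : ℝ → ℂ := (Icc (-n) n).indicator fun t => (starRingEnd ℂ) (Ψ t) with hφ
  have hφb : ∀ t, ‖φ t‖ ≤ ∫ b, ‖h b‖ := by
    intro t
    refine (norm_indicator_le_norm_self _ _).trans ?_
    rw [RCLike.norm_conj]
    exact norm_quadraticPhase_le h t
  have hφm : StronglyMeasurable φ :=
    (Complex.continuous_conj.comp hΨc).stronglyMeasurable.indicator measurableSet_Icc
  have hφ1 : Integrable φ :=
    ((Complex.continuous_conj.comp hΨc).integrableOn_Icc).integrable_indicator measurableSet_Icc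
  have hφ2 : MemLp φ 2 := by
    rw [hφ, memLp_indicator_iff_restrict measurableSet_Icc]
    refine MemLp.of_bound (Complex.continuous_conj.comp hΨc).aestronglyMeasurable (∫ b, ‖h b‖)
      (Eventually.of_forall fun t => ?_)
    rw [RCLike.norm_conj]
    exact norm_quadraticPhase_le h t
  set M := ∫⁻ t in Icc (-n) n, ‖Ψ t‖ₑ ^ 2 with hM
  have hMφ : ∫⁻ t, ‖φ t‖ₑ ^ 2 = M := by
    rw [hM, ← lintegral_indicator measurableSet_Icc]
    congr 1
    ext t
    by_cases ht : t ∈ Icc (-n) n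
    · simp [hφ, ht, ← ofReal_norm]
    · simp [hφ, ht]
  have hMfin : M ≠ ∞ := by
    rw [← hMφ]
    have := hφ2.2
    rw [eLpNorm_lt_top_iff_lintegral_rpow_enorm_lt_top (by norm_num) (by norm_num)] at this
    simpa using this.ne
  have hMint : ‖∫ t, φ t * Ψ t‖ₑ = M := by
    have e1 : ∀ t, φ t * Ψ t = ((‖φ t‖ ^ 2 : ℝ) : ℂ) := by
      intro t
      by_cases ht : t ∈ Icc (-n) n
      · simp only [hφ, indicator_of_mem ht, RCLike.norm_conj]
        rw [Complex.conj_mul']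
        push_cast
        rfl
      · simp [hφ, ht]
    simp_rw [e1]
    rw [integral_complex_ofReal, ← ofReal_norm, Complex.norm_real, Real.norm_of_nonneg
      (integral_nonneg fun _ => by positivity), ofReal_integral_eq_lintegral_ofReal, ← hMφ]
    · refine lintegral_congr fun t => ?_
      rw [ENNReal.ofReal_pow (norm_nonneg _), ofReal_norm]
    · exact (memLp_two_iff_integrable_sq_norm hφ2.1).1 hφ2
    · exact Eventually.of_forall fun _ => by positivity
  have hswap : ∫ t, φ t * Ψ t = ∫ b, h b * 𝓕 φ (4 * Real.pi * ‖b‖ ^ 2) := by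
    have e1 : ∀ t, φ t * Ψ t =
        ∫ b, Real.fourierChar (-(t * (4 * Real.pi * ‖b‖ ^ 2))) • (φ t * h b) := by
      intro t
      rw [hΨ, quadraticPhase, ← integral_const_mul]
      refine integral_congr_ae (Eventually.of_forall fun b => ?_)
      simp only [Circle.smul_def, smul_eq_mul]
      ring
    simp_rw [e1]
    rw [integral_integral_swap]
    · refine integral_congr_ae (Eventually.of_forall fun b => ?_)
      simp only
      rw [Real.fourier_real_eq, ← integral_const_mul]
      refine integral_congr_ae (Eventually.of_forall fun t => ?_)
      simp only [Circle.smul_def, smul_eq_mul]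
      ring
    · refine (hφ1.mul_prod h1).mono ?_ (Eventually.of_forall fun z => ?_)
      · refine AEStronglyMeasurable.smul ?_ (hφ1.mul_prod h1).1
        exact ((continuous_subtype_val.comp Real.continuous_fourierChar).comp
          (f := fun z : ℝ × ℂ => -(z.1 * (4 * Real.pi * ‖z.2‖ ^ 2))) (by fun_prop)).aestronglyMeasurable
      · simp [Function.uncurry, Circle.norm_smul]
  have hcont : Continuous (𝓕 φ) :=
    VectorFourier.fourierIntegral_continuous Real.continuous_fourierChar (by fun_prop) hφ1
  have hFφ : ∫⁻ b : ℂ, ‖𝓕 φ (4 * Real.pi * ‖b‖ ^ 2)‖ₑ ^ 2 ≤ M := by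
    refine (lintegral_comp_norm_sq_le (fun s => ‖𝓕 φ s‖ₑ ^ 2)
      (hcont.measurable.enorm.pow_const 2)).trans_eq ?_
    have := congrArg (· ^ (2 : ℝ)) (eLpNorm_fourier_eq hφ1 hφ2)
    simp only [eLpNorm_eq_lintegral_rpow_enorm_toReal (two_ne_zero) (ENNReal.ofNat_ne_top),
      ENNReal.toReal_ofNat, ← ENNReal.rpow_mul] at this
    rw [← hMφ]
    simpa using this
  have hMle : M ≤ (∫⁻ b, ‖h b‖ₑ ^ 2) ^ (1 / 2 : ℝ) * M ^ (1 / 2 : ℝ) := by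
    calc M = ‖∫ b, h b * 𝓕 φ (4 * Real.pi * ‖b‖ ^ 2)‖ₑ := by rw [← hswap, hMint]
      _ ≤ ∫⁻ b, ‖h b * 𝓕 φ (4 * Real.pi * ‖b‖ ^ 2)‖ₑ := enorm_integral_le_lintegral_enorm _
      _ = ∫⁻ b, ((fun b : ℂ => ‖h b‖ₑ) * fun b : ℂ => ‖𝓕 φ (4 * Real.pi * ‖b‖ ^ 2)‖ₑ) b := by
          simp only [enorm_mul, Pi.mul_apply]
      _ ≤ (∫⁻ b, ‖h b‖ₑ ^ (2 : ℝ)) ^ (1 / 2 : ℝ) *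
          (∫⁻ b : ℂ, ‖𝓕 φ (4 * Real.pi * ‖b‖ ^ 2)‖ₑ ^ (2 : ℝ)) ^ (1 / 2 : ℝ) := by
          refine ENNReal.lintegral_mul_le_Lp_mul_Lq _ Real.HolderConjugate.two_two
            h1.1.enorm ?_
          exact (hcont.comp (by fun_prop)).measurable.enorm.aemeasurable
      _ ≤ _ := by
          gcongr
          · simp
          · simpa using hFφ
  rcases eq_or_ne M 0 with h0 | h0
  · rw [h0]; exact zero_le
  have h3 : M ^ (1 / 2 : ℝ) ≤ (∫⁻ b, ‖h b‖ₑ ^ 2) ^ (1 / 2 : ℝ) := by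
    have h4 : M = M ^ (1 / 2 : ℝ) * M ^ (1 / 2 : ℝ) := by
      rw [← ENNReal.rpow_add _ _ h0 hMfin]; norm_num
    have hMle' : M ^ (1 / 2 : ℝ) * M ^ (1 / 2 : ℝ) ≤
        (∫⁻ b, ‖h b‖ₑ ^ 2) ^ (1 / 2 : ℝ) * M ^ (1 / 2 : ℝ) := by rwa [← h4]
    refine (ENNReal.mul_le_mul_iff_left ?_ ?_).1 hMle'
    · exact (ENNReal.rpow_pos (pos_iff_ne_zero.2 h0) hMfin).ne'
    · exact ENNReal.rpow_ne_top_of_nonneg (by norm_num) hMfin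
  exact (ENNReal.rpow_le_rpow_iff (by norm_num)).1 h3

theorem lintegral_quadraticPhase_le {h : ℂ → ℂ} (h1 : Integrable h) :
    ∫⁻ t, ‖quadraticPhase h t‖ₑ ^ 2 ≤ ∫⁻ b, ‖h b‖ₑ ^ 2 := by
  have hcov : AECover volume atTop fun n : ℝ => Icc (-n) n :=
    aecover_Icc tendsto_neg_atTop_atBot tendsto_id
  refine le_of_tendsto' (hcov.lintegral_tendsto_of_countably_generated
    ((continuous_quadraticPhase h1).measurable.enorm.pow_const 2).aemeasurable)
    fun n => lintegral_quadraticPhase_Icc_le h1 n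

/-! ### The fourth power of the L⁴ norm as the L² norm of a self-convolution -/

theorem lintegral_enorm_sq_toLp (C : 𝓢(ℂ, ℂ)) :
    ∫⁻ x, ‖C x‖ₑ ^ 2 = ‖(C.toLp 2 : PlaneL2)‖ₑ ^ 2 := by
  rw [Lp.enorm_def, eLpNorm_congr_ae (C.coeFn_toLp 2 volume),
    eLpNorm_eq_lintegral_rpow_enorm_toReal (by norm_num) (by norm_num), ← ENNReal.rpow_natCast,
    ← ENNReal.rpow_mul]
  simp

theorem lintegral_enorm_sq_fourier (C : 𝓢(ℂ, ℂ)) :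
    ∫⁻ x, ‖𝓕 C x‖ₑ ^ 2 = ∫⁻ x, ‖C x‖ₑ ^ 2 := by
  rw [lintegral_enorm_sq_toLp, lintegral_enorm_sq_toLp, ← ofReal_norm, ← ofReal_norm,
    SchwartzMap.norm_fourier_toL2_eq]

/-- The convolution of two Schwartz functions on the plane. -/
def schwartzConv (f g : 𝓢(ℂ, ℂ)) : 𝓢(ℂ, ℂ) :=
  SchwartzMap.convolution (ContinuousLinearMap.mul ℂ ℂ) f g

theorem schwartzConv_apply (f g : 𝓢(ℂ, ℂ)) (a : ℂ) :
    schwartzConv f g a = ∫ y, f y * g (a - y) := by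
  rw [schwartzConv, SchwartzMap.convolution_apply, convolution]
  rfl

/-- Write |f|⁴ = |f²|² and apply Plancherel to f², whose transform is a convolution. -/
theorem lintegral_fourierInv_pow_four (G : 𝓢(ℂ, ℂ)) :
    ∫⁻ x, ‖𝓕⁻ G x‖ₑ ^ 4 = ∫⁻ a, ‖schwartzConv G G a‖ₑ ^ 2 := by
  rw [← lintegral_enorm_sq_fourier (schwartzConv G G)]
  have h1 : ∀ x, ‖𝓕 (schwartzConv G G) x‖ₑ ^ 2 = ‖𝓕 G x‖ₑ ^ 4 := by
    intro x
    rw [schwartzConv, SchwartzMap.fourier_convolution, SchwartzMap.pairing_apply_apply,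
      ContinuousLinearMap.mul_apply', enorm_mul]
    ring
  simp_rw [h1]
  rw [← lintegral_neg_eq_self (μ := volume) (f := fun x => ‖𝓕 G x‖ₑ ^ 4)]
  refine lintegral_congr fun x => ?_
  rw [fourierInv_eq_compIsometry_fourier, compIsometry_apply]
  rfl

/-- The product `G(a/2 + b) G(a/2 - b)`. -/
def midpointProduct (G : 𝓢(ℂ, ℂ)) (a b : ℂ) : ℂ := G (a / 2 + b) * G (a / 2 - b)

theorem integrable_midpointProduct (G : 𝓢(ℂ, ℂ)) (a : ℂ) :
    Integrable (midpointProduct G a) := by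
  have h1 : Integrable fun b => G (a / 2 + b) := G.integrable.comp_add_left (a / 2)
  obtain ⟨C, hC⟩ := G.decay 0 0
  refine h1.mul_bdd (c := C) ?_ (Eventually.of_forall fun b => ?_)
  · exact (G.continuous.comp (by fun_prop)).aestronglyMeasurable
  · simpa using hC.2 (a / 2 - b)

/-- By the parallelogram law |a/2+b|² + |a/2−b|² = |a|²/2 + 2|b|². The |a|² part is a unimodular
constant that leaves the integral; the |b|² part is the phase of `quadraticPhase`. -/
theorem norm_schwartzConv_symbol (G : 𝓢(ℂ, ℂ)) (t : ℝ) (a : ℂ) :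
    ‖schwartzConv (SchwartzMap.smulLeftCLM ℂ (freeSymbol t) G)
      (SchwartzMap.smulLeftCLM ℂ (freeSymbol t) G) a‖ = ‖quadraticPhase (midpointProduct G a) t‖ := by
  rw [schwartzConv_apply, ← integral_add_left_eq_self _ (a / 2), quadraticPhase]
  have h : ∀ b : ℂ, SchwartzMap.smulLeftCLM ℂ (freeSymbol t) G (a / 2 + b) *
      SchwartzMap.smulLeftCLM ℂ (freeSymbol t) G (a - (a / 2 + b)) =
      Complex.exp (((-(2 * Real.pi ^ 2 * t * ‖a‖ ^ 2) : ℝ) : ℂ) * Complex.I) *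
      (Real.fourierChar (-(t * (4 * Real.pi * ‖b‖ ^ 2))) • midpointProduct G a b) := by
    intro b
    have e1 : a - (a / 2 + b) = a / 2 - b := by ring
    have hp := parallelogram_law_with_norm ℝ (a / 2) b
    have hn : ‖a / 2‖ = ‖a‖ / 2 := by rw [norm_div]; simp
    rw [hn] at hp
    have hp' : ‖a / 2 + b‖ ^ 2 + ‖a / 2 - b‖ ^ 2 = ‖a‖ ^ 2 / 2 + 2 * ‖b‖ ^ 2 := by nlinarith
    have key : freeSymbol t (a / 2 + b) * freeSymbol t (a / 2 - b) =
        Complex.exp (((-(2 * Real.pi ^ 2 * t * ‖a‖ ^ 2) : ℝ) : ℂ) * Complex.I) *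
          (Real.fourierChar (-(t * (4 * Real.pi * ‖b‖ ^ 2))) : ℂ) := by
      have : -(4 * Real.pi ^ 2 * t) * ‖a / 2 + b‖ ^ 2 + -(4 * Real.pi ^ 2 * t) * ‖a / 2 - b‖ ^ 2 =
          -(2 * Real.pi ^ 2 * t * ‖a‖ ^ 2) + 2 * Real.pi * (-(t * (4 * Real.pi * ‖b‖ ^ 2))) := by
        linear_combination (-(4 * Real.pi ^ 2 * t)) * hp'
      rw [freeSymbol, freeSymbol, Real.fourierChar_apply, ← Complex.exp_add, ← Complex.exp_add,
        ← add_mul, ← add_mul, ← Complex.ofReal_add, ← Complex.ofReal_add, this]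
    rw [e1, SchwartzMap.smulLeftCLM_apply_apply (hasTemperateGrowth_freeSymbol t),
      SchwartzMap.smulLeftCLM_apply_apply (hasTemperateGrowth_freeSymbol t), midpointProduct,
      Circle.smul_def, smul_eq_mul, smul_eq_mul, smul_eq_mul]
    linear_combination (G (a / 2 + b) * G (a / 2 - b)) * key
  simp_rw [h]
  rw [integral_const_mul, norm_mul, Complex.norm_exp_ofReal_mul_I, one_mul]

theorem measurable_quadraticPhase_midpointProduct (G : 𝓢(ℂ, ℂ)) :
    Measurable fun z : ℝ × ℂ => quadraticPhase (midpointProduct G z.2) z.1 := by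
  unfold quadraticPhase midpointProduct
  refine StronglyMeasurable.measurable ?_
  refine StronglyMeasurable.integral_prod_right (f := fun z : ℝ × ℂ => fun b : ℂ =>
    Real.fourierChar (-(z.1 * (4 * Real.pi * ‖b‖ ^ 2))) • (G (z.2 / 2 + b) * G (z.2 / 2 - b))) ?_
  refine Continuous.stronglyMeasurable ?_
  simp only [Function.uncurry_def]
  refine Continuous.smul ((continuous_subtype_val.comp Real.continuous_fourierChar).comp
    (f := fun z : (ℝ × ℂ) × ℂ => -(z.1.1 * (4 * Real.pi * ‖z.2‖ ^ 2))) (by fun_prop)) ?_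
  exact (G.continuous.comp (f := fun z : (ℝ × ℂ) × ℂ => z.1.2 / 2 + z.2) (by fun_prop)).mul
    (G.continuous.comp (f := fun z : (ℝ × ℂ) × ℂ => z.1.2 / 2 - z.2) (by fun_prop))

/-- The change of variables (a, b) ↦ (a/2+b, a/2−b) preserves measure, here through a translation in
b followed by one in a; the double integral then factors. -/
theorem lintegral_midpointProduct (G : 𝓢(ℂ, ℂ)) :
    ∫⁻ a, ∫⁻ b, ‖midpointProduct G a b‖ₑ ^ 2 = (∫⁻ x, ‖G x‖ₑ ^ 2) ^ 2 := by
  have hG : Measurable fun x => ‖G x‖ₑ ^ 2 := G.continuous.measurable.enorm.pow_const 2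
  have h1 : ∀ a, ∫⁻ b, ‖midpointProduct G a b‖ₑ ^ 2 =
      ∫⁻ y, ‖G y‖ₑ ^ 2 * ‖G (a - y)‖ₑ ^ 2 := by
    intro a
    rw [← lintegral_add_left_eq_self (fun y => ‖G y‖ₑ ^ 2 * ‖G (a - y)‖ₑ ^ 2) (a / 2)]
    refine lintegral_congr fun b => ?_
    rw [midpointProduct, enorm_mul, mul_pow, show a - (a / 2 + b) = a / 2 - b by ring]
  simp_rw [h1]
  rw [lintegral_lintegral_swap]
  · have h2 : ∀ y, ∫⁻ a, ‖G y‖ₑ ^ 2 * ‖G (a - y)‖ₑ ^ 2 = ‖G y‖ₑ ^ 2 * ∫⁻ x, ‖G x‖ₑ ^ 2 := by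
      intro y
      rw [lintegral_const_mul' _ _ (ENNReal.pow_ne_top enorm_ne_top),
        lintegral_sub_right_eq_self (fun a => ‖G a‖ₑ ^ 2) y]
    simp_rw [h2]
    rw [lintegral_mul_const _ hG, sq]
  · refine Measurable.aemeasurable ?_
    simp only [Function.uncurry_def]
    exact (hG.comp measurable_snd).mul (hG.comp (f := fun z : ℂ × ℂ => z.1 - z.2) (by fun_prop))

/-- The `L⁴` Strichartz estimate for Schwartz data. -/
theorem strichartz_schwartz (f : 𝓢(ℂ, ℂ)) :
    ∫⁻ t, ∫⁻ x, ‖freeSchwartz t f x‖ₑ ^ 4 ≤ (∫⁻ x, ‖f x‖ₑ ^ 2) ^ 2 := by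
  set G := 𝓕 f with hG
  have h1 : ∀ t, ∫⁻ x, ‖freeSchwartz t f x‖ₑ ^ 4 =
      ∫⁻ a, ‖quadraticPhase (midpointProduct G a) t‖ₑ ^ 2 := by
    intro t
    rw [freeSchwartz_apply, lintegral_fourierInv_pow_four]
    refine lintegral_congr fun a => ?_
    rw [← ofReal_norm, norm_schwartzConv_symbol, ofReal_norm]
  simp_rw [h1]
  rw [lintegral_lintegral_swap]
  · rw [← lintegral_enorm_sq_fourier, ← lintegral_midpointProduct]
    exact lintegral_mono fun a => lintegral_quadraticPhase_le (integrable_midpointProduct G a)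
  · exact ((measurable_quadraticPhase_midpointProduct G).enorm.pow_const 2).aemeasurable

/-- The fourth power of the `L⁴` norm is lower semicontinuous on `L²`. -/
theorem lowerSemicontinuous_lintegral_pow_four {α : Type*} [MeasurableSpace α] (μ : Measure α) :
    LowerSemicontinuous fun h : Lp ℂ 2 μ => ∫⁻ x, ‖h x‖ₑ ^ 4 ∂μ := by
  rw [lowerSemicontinuous_iff_isClosed_preimage]
  intro c
  -- An L² convergent sequence has an almost everywhere convergent subsequence, to which Fatou's
  -- lemma applies.
  refine IsSeqClosed.isClosed fun u h hu huh => ?_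
  have h1 : TendstoInMeasure μ (fun n => (u n : α → ℂ)) atTop h :=
    tendstoInMeasure_of_tendsto_Lp huh
  obtain ⟨ns, -, hns⟩ := h1.exists_seq_tendsto_ae
  have h2 : ∫⁻ x, ‖h x‖ₑ ^ 4 ∂μ ≤
      ∫⁻ x, liminf (fun n => ‖u (ns n) x‖ₑ ^ 4) atTop ∂μ := by
    apply lintegral_mono_ae
    filter_upwards [hns] with x hx
    have : Tendsto (fun n => ‖u (ns n) x‖ₑ ^ 4) atTop (𝓝 (‖h x‖ₑ ^ 4)) :=
      ((ENNReal.continuous_pow 4).tendsto _).comp ((continuous_enorm.tendsto _).comp hx)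
    exact this.liminf_eq.ge
  refine h2.trans ((lintegral_liminf_le fun n =>
    (Lp.stronglyMeasurable (u (ns n))).measurable.enorm.pow_const 4).trans ?_)
  refine liminf_le_of_frequently_le' (Frequently.of_forall fun n => ?_)
  exact hu (ns n)

theorem lintegral_pow_four_le_liminf {α : Type*} [MeasurableSpace α] {μ : Measure α}
    {u : ℕ → Lp ℂ 2 μ} {h : Lp ℂ 2 μ} (hu : Tendsto u atTop (𝓝 h)) :
    ∫⁻ x, ‖h x‖ₑ ^ 4 ∂μ ≤ liminf (fun n => ∫⁻ x, ‖u n x‖ₑ ^ 4 ∂μ) atTop := by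
  refine le_of_forall_lt_imp_le_of_dense fun c hc => le_liminf_of_le (by isBoundedDefault) ?_
  exact (hu.eventually (lowerSemicontinuous_lintegral_pow_four μ h c hc)).mono fun _ => le_of_lt

/-- The `L⁴` Strichartz estimate on the plane. -/
theorem strichartz_freeL2 (f : PlaneL2) :
    ∫⁻ t, ∫⁻ x, ‖freeL2 t f x‖ₑ ^ 4 ≤ ‖f‖ₑ ^ 4 := by
  have hls := lowerSemicontinuous_lintegral_pow_four (volume : Measure ℂ)
  obtain ⟨u, hu, huf⟩ := mem_closure_iff_seq_limit.1 (denseRange_schwartz_toLp f)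
  choose ψ hψ using hu
  simp only at hψ
  have h1 : ∀ t, ∫⁻ x, ‖freeL2 t f x‖ₑ ^ 4 ≤
      liminf (fun n => ∫⁻ x, ‖freeL2 t (u n) x‖ₑ ^ 4) atTop := by
    intro t
    exact lintegral_pow_four_le_liminf (((continuous_freeL2_right t).tendsto f).comp huf)
  have h2 : ∀ n, ∫⁻ t, ∫⁻ x, ‖freeL2 t (u n) x‖ₑ ^ 4 ≤ ‖u n‖ₑ ^ 4 := by
    intro n
    have e1 : ∀ t, ∫⁻ x, ‖freeL2 t (u n) x‖ₑ ^ 4 = ∫⁻ x, ‖freeSchwartz t (ψ n) x‖ₑ ^ 4 := by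
      intro t
      rw [← hψ n, freeL2_toLp]
      apply lintegral_congr_ae
      filter_upwards [(freeSchwartz t (ψ n)).coeFn_toLp 2 volume] with x hx
      rw [hx]
    simp_rw [e1]
    refine (strichartz_schwartz (ψ n)).trans_eq ?_
    rw [lintegral_enorm_sq_toLp, hψ n, ← pow_mul]
  calc ∫⁻ t, ∫⁻ x, ‖freeL2 t f x‖ₑ ^ 4
      ≤ ∫⁻ t, liminf (fun n => ∫⁻ x, ‖freeL2 t (u n) x‖ₑ ^ 4) atTop := lintegral_mono h1
    -- Fatou in t. The measurability in t that it needs comes from lower semicontinuity of the L⁴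
    -- integral on L² and continuity of the free evolution.
    _ ≤ liminf (fun n => ∫⁻ t, ∫⁻ x, ‖freeL2 t (u n) x‖ₑ ^ 4) atTop :=
        lintegral_liminf_le fun n => (LowerSemicontinuous.comp hls (continuous_freeL2 (u n))).measurable
    _ ≤ liminf (fun n => ‖u n‖ₑ ^ 4) atTop := liminf_le_liminf (Eventually.of_forall h2)
    _ = ‖f‖ₑ ^ 4 := Tendsto.liminf_eq
        (((ENNReal.continuous_pow 4).tendsto _).comp ((continuous_enorm.tendsto _).comp huf))

/-! ### Rotations and the radial propagator -/

theorem ae_comp_norm {P : ℝ → Prop} (h : ∀ᵐ r ∂radialMeasure, P r) : ∀ᵐ x : ℂ, P ‖x‖ := by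
  refine ae_of_ae_map (f := fun x : ℂ => ‖x‖) (p := P) measurable_norm.aemeasurable ?_
  rw [map_norm_volume]
  exact Measure.ae_smul_measure h _

theorem lintegral_comp_norm' {g : ℝ → ℝ≥0∞} (hg : AEMeasurable g radialMeasure) :
    ∫⁻ x : ℂ, g ‖x‖ = ENNReal.ofReal (2 * Real.pi) * ∫⁻ r, g r ∂radialMeasure := by
  rw [lintegral_congr_ae hg.ae_eq_mk, ← lintegral_comp_norm _ hg.measurable_mk]
  exact lintegral_congr_ae (ae_comp_norm hg.ae_eq_mk)

theorem ae_radialMeasure_pos : ∀ᵐ r ∂radialMeasure, 0 < r := by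
  unfold radialMeasure
  exact (withDensity_absolutelyContinuous _ _).ae_le (ae_restrict_mem measurableSet_Ioi)

theorem ae_ne_zero_plane : ∀ᵐ x : ℂ, x ≠ 0 := by
  simp [ae_iff]

theorem norm_vortex (q : ℝ → ℂ) {x : ℂ} (hx : x ≠ 0) : ‖vortex q x‖ = ‖q ‖x‖‖ := by
  rw [vortex, norm_mul, norm_div, Complex.norm_real, norm_norm, div_self (norm_ne_zero_iff.2 hx),
    one_mul]

theorem lintegral_vortex {q : ℝ → ℂ} (hq : AEStronglyMeasurable q radialMeasure) (p : ℝ) :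
    ∫⁻ x : ℂ, ‖vortex q x‖ₑ ^ p =
      ENNReal.ofReal (2 * Real.pi) * ∫⁻ r, ‖q r‖ₑ ^ p ∂radialMeasure := by
  rw [← lintegral_comp_norm' (hq.enorm.pow_const p)]
  apply lintegral_congr_ae
  filter_upwards [ae_ne_zero_plane] with x hx
  rw [← ofReal_norm, norm_vortex q hx, ofReal_norm]

theorem coeFn_vortexL2 (q : RadialL2) : vortexL2 q =ᵐ[volume] vortex q := MemLp.coeFn_toLp _

theorem vortex_congr {p q : ℝ → ℂ} (h : p =ᵐ[radialMeasure] q) :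
    vortex p =ᵐ[volume] vortex q := by
  filter_upwards [ae_comp_norm h] with x hx
  rw [vortex, vortex, hx]

theorem vortexL2_add (p q : RadialL2) : vortexL2 (p + q) = vortexL2 p + vortexL2 q := by
  apply Lp.ext
  filter_upwards [coeFn_vortexL2 (p + q), coeFn_vortexL2 p, coeFn_vortexL2 q,
    Lp.coeFn_add (vortexL2 p) (vortexL2 q), vortex_congr (Lp.coeFn_add p q)] with x h1 h2 h3 h4 h5
  rw [h1, h4, Pi.add_apply, h2, h3, h5, vortex, vortex, vortex, Pi.add_apply, mul_add]

theorem vortexL2_smul (c : ℂ) (q : RadialL2) : vortexL2 (c • q) = c • vortexL2 q := by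
  apply Lp.ext
  filter_upwards [coeFn_vortexL2 (c • q), coeFn_vortexL2 q,
    Lp.coeFn_smul c (vortexL2 q), vortex_congr (Lp.coeFn_smul c q)] with x h1 h2 h4 h5
  rw [h1, h4, Pi.smul_apply, h2, h5, vortex, vortex, Pi.smul_apply, smul_eq_mul, smul_eq_mul]
  ring

theorem enorm_Lp_two_sq {α : Type*} [MeasurableSpace α] {μ : Measure α} (f : Lp ℂ 2 μ) :
    ‖f‖ₑ ^ 2 = ∫⁻ x, ‖f x‖ₑ ^ (2 : ℝ) ∂μ := by
  rw [Lp.enorm_def, eLpNorm_eq_lintegral_rpow_enorm_toReal (by norm_num) (by norm_num),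
    ← ENNReal.rpow_natCast, ← ENNReal.rpow_mul]
  simp

theorem enorm_vortexL2_sq (q : RadialL2) :
    ‖vortexL2 q‖ₑ ^ 2 = ENNReal.ofReal (2 * Real.pi) * ‖q‖ₑ ^ 2 := by
  rw [enorm_Lp_two_sq, enorm_Lp_two_sq, ← lintegral_vortex (Lp.aestronglyMeasurable q)]
  apply lintegral_congr_ae
  filter_upwards [coeFn_vortexL2 q] with x hx
  rw [hx]

theorem norm_vortexL2 (q : RadialL2) : ‖vortexL2 q‖ = √(2 * Real.pi) * ‖q‖ := by
  have h := enorm_vortexL2_sq q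
  rw [← ofReal_norm, ← ofReal_norm, ← ENNReal.ofReal_pow (norm_nonneg _),
    ← ENNReal.ofReal_pow (norm_nonneg _), ← ENNReal.ofReal_mul (by positivity),
    ENNReal.ofReal_eq_ofReal_iff (by positivity) (by positivity)] at h
  rw [← Real.sqrt_sq (norm_nonneg (vortexL2 q)), h, Real.sqrt_mul (by positivity),
    Real.sqrt_sq (norm_nonneg _)]

/-- `q ↦ e^{iθ} q(r)` as a linear map. -/
def vortexLM : RadialL2 →ₗ[ℂ] PlaneL2 where
  toFun := vortexL2
  map_add' := vortexL2_add
  map_smul' := vortexL2_smul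

theorem vortexL2_sub (p q : RadialL2) : vortexL2 (p - q) = vortexL2 p - vortexL2 q :=
  vortexLM.map_sub p q

theorem vortexL2_injective : Function.Injective vortexL2 := by
  intro p q h
  have h1 : ‖vortexL2 (p - q)‖ = 0 := by rw [vortexL2_sub, h, sub_self, norm_zero]
  rw [norm_vortexL2] at h1
  have h2 : √(2 * Real.pi) ≠ 0 := by positivity
  exact sub_eq_zero.1 (norm_eq_zero.1 ((mul_eq_zero.1 h1).resolve_left h2))

/-- Composition with a rotation. -/
def rotL2 (ω : Circle) : PlaneL2 →ₗᵢ[ℂ] PlaneL2 :=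
  Lp.compMeasurePreservingₗᵢ ℂ (rotation ω) (rotation ω).measurePreserving

theorem coeFn_rotL2 (ω : Circle) (f : PlaneL2) :
    rotL2 ω f =ᵐ[volume] fun x => f (ω * x) :=
  Lp.coeFn_compMeasurePreserving f (rotation ω).measurePreserving

theorem rotL2_toLp (ω : Circle) (ψ : 𝓢(ℂ, ℂ)) :
    rotL2 ω (ψ.toLp 2) = (compIsometry (rotation ω) ψ).toLp 2 := by
  apply Lp.ext
  filter_upwards [coeFn_rotL2 ω (ψ.toLp 2), (compIsometry (rotation ω) ψ).coeFn_toLp 2 volume,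
    (rotation ω).measurePreserving.quasiMeasurePreserving.ae (ψ.coeFn_toLp 2 volume)] with x h1 h2 h3
  rw [h1, h2, compIsometry_apply, ← h3]
  rfl

theorem freeL2_rotL2 (t : ℝ) (ω : Circle) (f : PlaneL2) :
    freeL2 t (rotL2 ω f) = rotL2 ω (freeL2 t f) := by
  refine denseRange_schwartz_toLp.induction_on
    (p := fun f => freeL2 t (rotL2 ω f) = rotL2 ω (freeL2 t f)) f ?_ fun ψ => ?_
  · exact isClosed_eq ((continuous_freeL2_right t).comp (rotL2 ω).continuous)
      ((rotL2 ω).continuous.comp (continuous_freeL2_right t))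
  · rw [rotL2_toLp, freeL2_toLp, freeL2_toLp, rotL2_toLp, freeSchwartz_compIsometry]

theorem rotL2_vortexL2 (ω : Circle) (q : RadialL2) :
    rotL2 ω (vortexL2 q) = (ω : ℂ) • vortexL2 q := by
  apply Lp.ext
  filter_upwards [coeFn_rotL2 ω (vortexL2 q), coeFn_vortexL2 q, Lp.coeFn_smul (ω : ℂ) (vortexL2 q),
    (rotation ω).measurePreserving.quasiMeasurePreserving.ae (coeFn_vortexL2 q)] with x h1 h2 h3 h4
  rw [rotation_apply] at h4
  rw [h1, h3, Pi.smul_apply, h2, h4, vortex, vortex, norm_mul, Circle.norm_coe, one_mul,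
    smul_eq_mul]
  ring

/-- The `n = 1` angular Fourier coefficient of a function on the plane. -/
def angularProfile (g : ℂ → ℂ) (r : ℝ) : ℂ :=
  ((2 * Real.pi : ℝ) : ℂ)⁻¹ * ∫ θ in (-Real.pi)..Real.pi,
    Complex.exp (-(θ * Complex.I)) * g (Complex.exp (θ * Complex.I) * r)

/-- Averaging over the whole circle is insensitive to the starting angle: shifting θ by arg x
replaces |x| by x in the argument of g and produces the factor x/|x|. -/
theorem vortex_angularProfile (g : ℂ → ℂ) {x : ℂ} (hx : x ≠ 0) :
    vortex (angularProfile g) x = ((2 * Real.pi : ℝ) : ℂ)⁻¹ * ∫ θ in (-Real.pi)..Real.pi,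
      Complex.exp (-(θ * Complex.I)) * g (Complex.exp (θ * Complex.I) * x) := by
  set α := Complex.arg x with hα
  have hxe : x = ‖x‖ * Complex.exp (α * Complex.I) := (Complex.norm_mul_exp_arg_mul_I x).symm
  have hn : (‖x‖ : ℂ) ≠ 0 := by exact_mod_cast norm_ne_zero_iff.2 hx
  have hdiv : x / (‖x‖ : ℂ) = Complex.exp (α * Complex.I) := by
    rw [div_eq_iff hn, mul_comm, ← hxe]
  set k : ℝ → ℂ := fun θ => Complex.exp (-(θ * Complex.I)) * g (Complex.exp (θ * Complex.I) * ‖x‖)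
    with hk
  have hper : Function.Periodic k (2 * Real.pi) := by
    intro θ
    simp only [hk]
    have e1 : Complex.exp (((θ + 2 * Real.pi : ℝ) : ℂ) * Complex.I) = Complex.exp (θ * Complex.I) := by
      rw [Complex.exp_eq_exp_iff_exists_int]
      exact ⟨1, by push_cast; ring⟩
    rw [Complex.exp_neg, e1, Complex.exp_neg]
  have hshift : ∫ θ in (-Real.pi)..Real.pi, k (θ + α) = ∫ θ in (-Real.pi)..Real.pi, k θ := by
    rw [intervalIntegral.integral_comp_add_right]
    have := hper.intervalIntegral_add_eq (-Real.pi + α) (-Real.pi)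
    rw [show -Real.pi + α + 2 * Real.pi = Real.pi + α by ring,
      show -Real.pi + 2 * Real.pi = Real.pi by ring] at this
    exact this
  rw [vortex, angularProfile, hdiv, ← hk, ← hshift, mul_left_comm,
    ← intervalIntegral.integral_const_mul]
  congr 2
  ext θ
  simp only [hk]
  have e2 : Complex.exp (((θ + α : ℝ) : ℂ) * Complex.I) * ‖x‖ = Complex.exp (θ * Complex.I) * x := by
    nth_rewrite 2 [hxe]
    push_cast
    rw [add_mul, Complex.exp_add]
    ring
  rw [e2, ← mul_assoc, ← Complex.exp_add]
  congr 2
  push_cast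
  ring

theorem stronglyMeasurable_angularProfile {g : ℂ → ℂ} (hg : StronglyMeasurable g) :
    StronglyMeasurable (angularProfile g) := by
  unfold angularProfile
  refine StronglyMeasurable.const_mul ?_ _
  simp_rw [intervalIntegral.integral_of_le (by linarith [Real.pi_pos] : -Real.pi ≤ Real.pi)]
  refine StronglyMeasurable.integral_prod_right (f := fun r : ℝ => fun θ : ℝ =>
    Complex.exp (-(θ * Complex.I)) * g (Complex.exp (θ * Complex.I) * r)) ?_
  simp only [Function.uncurry_def]
  refine StronglyMeasurable.mul (Continuous.stronglyMeasurable (by fun_prop)) ?_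
  exact hg.comp_measurable (Continuous.measurable (by fun_prop))

/-- A function in `L²(ℝ²)` that transforms like `e^{iθ}` under rotations is of vortex type. -/
theorem exists_vortexL2_eq (g : PlaneL2) (hg : ∀ ω : Circle, rotL2 ω g = (ω : ℂ) • g) :
    ∃ q : RadialL2, vortexL2 q = g := by
  have hgm : StronglyMeasurable (g : ℂ → ℂ) := Lp.stronglyMeasurable g
  have h1 : ∀ θ : ℝ, ∀ᵐ x : ℂ,
      g (Complex.exp (θ * Complex.I) * x) = Complex.exp (θ * Complex.I) * g x := by
    intro θ
    filter_upwards [coeFn_rotL2 (Circle.exp θ) g, Lp.coeFn_smul (Circle.exp θ : ℂ) g] with x h1 h2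
    rw [hg, h2, Pi.smul_apply, smul_eq_mul, Circle.coe_exp] at h1
    exact h1.symm
  -- Fubini exchanges the quantifiers, so that the covariance can be integrated over θ at a fixed x.
  have h2 : ∀ᵐ x : ℂ, ∀ᵐ θ : ℝ,
      g (Complex.exp (θ * Complex.I) * x) = Complex.exp (θ * Complex.I) * g x := by
    refine (Measure.ae_ae_comm (p := fun (θ : ℝ) (x : ℂ) =>
      g (Complex.exp (θ * Complex.I) * x) = Complex.exp (θ * Complex.I) * g x) ?_).1
      (Eventually.of_forall h1)
    refine measurableSet_eq_fun ?_ ?_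
    · exact hgm.measurable.comp (Continuous.measurable (by fun_prop))
    · exact (Continuous.measurable (by fun_prop)).mul (hgm.measurable.comp measurable_snd)
  have h3 : vortex (angularProfile g) =ᵐ[volume] g := by
    filter_upwards [h2, ae_ne_zero_plane] with x hx hx0
    rw [vortex_angularProfile _ hx0]
    have : ∫ θ in (-Real.pi)..Real.pi,
        Complex.exp (-(θ * Complex.I)) * g (Complex.exp (θ * Complex.I) * x) =
        ∫ _ in (-Real.pi)..Real.pi, g x := by
      apply intervalIntegral.integral_congr_ae
      filter_upwards [hx] with θ hθ _
      rw [hθ, ← mul_assoc, ← Complex.exp_add]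
      simp
    rw [this, intervalIntegral.integral_const, Complex.real_smul, ← mul_assoc]
    have hpi : ((2 * Real.pi : ℝ) : ℂ) ≠ 0 := by exact_mod_cast (by positivity)
    rw [show Real.pi - -Real.pi = 2 * Real.pi by ring, inv_mul_cancel₀ hpi, one_mul]
  have hPm := (stronglyMeasurable_angularProfile hgm).aestronglyMeasurable (μ := radialMeasure)
  have hmem : MemLp (angularProfile g) 2 radialMeasure := by
    refine ⟨hPm, ?_⟩
    have h4 := (Lp.memLp g).2
    rw [eLpNorm_lt_top_iff_lintegral_rpow_enorm_lt_top (by norm_num) (by norm_num)] at h4 ⊢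
    have h5 := lintegral_vortex hPm (2 : ℝ≥0∞).toReal
    have h6 : ∫⁻ x, ‖g x‖ₑ ^ (2 : ℝ≥0∞).toReal =
        ∫⁻ x, ‖vortex (angularProfile g) x‖ₑ ^ (2 : ℝ≥0∞).toReal := by
      apply lintegral_congr_ae
      filter_upwards [h3] with x hx
      rw [hx]
    rw [h6, h5] at h4
    exact ENNReal.lt_top_of_mul_ne_top_right h4.ne (by simp [Real.pi_pos])
  refine ⟨hmem.toLp, Lp.ext ?_⟩
  filter_upwards [coeFn_vortexL2 hmem.toLp, vortex_congr hmem.coeFn_toLp, h3] with x h1 h2 h3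
  rw [h1, h2, h3]

/-- The propagator `e^{it(Δ - 1/r²)}` on radial functions. -/
theorem exists_vortexL2_eq_freeL2 (t : ℝ) (q : RadialL2) :
    ∃ p : RadialL2, vortexL2 p = freeL2 t (vortexL2 q) := by
  refine exists_vortexL2_eq _ fun ω => ?_
  rw [← freeL2_rotL2, rotL2_vortexL2, freeL2_smul]

/-- The propagator `e^{it(Δ - 1/r²)}` on radial functions, as a linear isometry. -/
def flow (t : ℝ) : RadialL2 →ₗᵢ[ℂ] RadialL2 where
  toFun q := (exists_vortexL2_eq_freeL2 t q).choose
  map_add' p q := by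
    apply vortexL2_injective
    rw [(exists_vortexL2_eq_freeL2 t (p + q)).choose_spec, vortexL2_add, vortexL2_add,
      (exists_vortexL2_eq_freeL2 t p).choose_spec, (exists_vortexL2_eq_freeL2 t q).choose_spec,
      freeL2_add]
  map_smul' c q := by
    apply vortexL2_injective
    rw [(exists_vortexL2_eq_freeL2 t (c • q)).choose_spec, vortexL2_smul, RingHom.id_apply,
      vortexL2_smul, (exists_vortexL2_eq_freeL2 t q).choose_spec, freeL2_smul]
  norm_map' q := by
    have h := congrArg norm (exists_vortexL2_eq_freeL2 t q).choose_spec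
    rw [norm_freeL2, norm_vortexL2, norm_vortexL2] at h
    exact mul_left_cancel₀ (by positivity) h

theorem vortexL2_flow (t : ℝ) (q : RadialL2) : vortexL2 (flow t q) = freeL2 t (vortexL2 q) :=
  (exists_vortexL2_eq_freeL2 t q).choose_spec

theorem flow_flow (s t : ℝ) (q : RadialL2) : flow s (flow t q) = flow (s + t) q := by
  apply vortexL2_injective
  rw [vortexL2_flow, vortexL2_flow, vortexL2_flow, freeL2_freeL2]

theorem flow_zero (q : RadialL2) : flow 0 q = q := by
  apply vortexL2_injective
  rw [vortexL2_flow, freeL2_zero]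

theorem norm_flow (t : ℝ) (q : RadialL2) : ‖flow t q‖ = ‖q‖ := (flow t).norm_map q

theorem continuous_flow (q : RadialL2) : Continuous fun t => flow t q := by
  rw [Metric.continuous_iff]
  intro t ε hε
  have hs : (0 : ℝ) < √(2 * Real.pi) := by positivity
  obtain ⟨δ, hδ, h⟩ := Metric.continuous_iff.1 (continuous_freeL2 (vortexL2 q)) t
    (√(2 * Real.pi) * ε) (by positivity)
  refine ⟨δ, hδ, fun s hst => ?_⟩
  have h1 := h s hst
  rw [dist_eq_norm, ← vortexL2_flow, ← vortexL2_flow, ← vortexL2_sub, norm_vortexL2] at h1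
  rw [dist_eq_norm]
  exact lt_of_mul_lt_mul_left h1 hs.le

/-- An isometric group is unitary: the adjoint at time t is the flow at time −t. -/
theorem inner_flow_right (t : ℝ) (p q : RadialL2) :
    inner ℂ p (flow t q) = inner ℂ (flow (-t) p) q := by
  rw [← (flow t).inner_map_map (flow (-t) p) q, flow_flow, add_neg_cancel, flow_zero]

theorem lintegral_freeL2_vortexL2 (t : ℝ) (q : RadialL2) :
    ∫⁻ x, ‖freeL2 t (vortexL2 q) x‖ₑ ^ 4 =
      ENNReal.ofReal (2 * Real.pi) * ∫⁻ r, ‖flow t q r‖ₑ ^ 4 ∂radialMeasure := by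
  have h := lintegral_vortex (Lp.aestronglyMeasurable (flow t q)) 4
  norm_cast at h
  rw [← vortexL2_flow, ← h]
  apply lintegral_congr_ae
  filter_upwards [coeFn_vortexL2 (flow t q)] with x hx
  rw [hx]

/-- The `L⁴` Strichartz estimate for the radial propagator. -/
theorem strichartz_flow (q : RadialL2) :
    ∫⁻ t, ∫⁻ r, ‖flow t q r‖ₑ ^ 4 ∂radialMeasure ≤ (2 * ‖q‖ₑ) ^ 4 := by
  have h := strichartz_freeL2 (vortexL2 q)
  simp_rw [lintegral_freeL2_vortexL2] at h
  rw [lintegral_const_mul' _ _ ENNReal.ofReal_ne_top, show 4 = 2 * 2 by norm_num,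
    pow_mul ‖vortexL2 q‖ₑ, enorm_vortexL2_sq] at h
  -- The planar bound reads 2π∫∫ ≤ (2π)²‖q‖⁴. One factor 2π cancels, and the other is at most 16 =
  -- 2⁴.
  have hpi : ENNReal.ofReal (2 * Real.pi) ≠ 0 := by simp [Real.pi_pos]
  rw [mul_pow, sq (ENNReal.ofReal _), mul_assoc,
    ENNReal.mul_le_mul_iff_right hpi ENNReal.ofReal_ne_top] at h
  refine h.trans ?_
  rw [mul_pow, ← pow_mul]
  gcongr
  refine (ENNReal.ofReal_le_ofReal (by linarith [Real.pi_le_four] : 2 * Real.pi ≤ 8)).trans ?_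
  norm_num

/-! ### Pairing of radial functions with Schwartz functions -/

/-- The circle integral `∫ e^{iθ} ψ(r e^{iθ}) dθ`. -/
def circlePairing (ψ : 𝓢(ℂ, ℂ)) (r : ℝ) : ℂ :=
  ∫ θ in Ioo (-Real.pi) Real.pi, Complex.exp (θ * Complex.I) * ψ (r * Complex.exp (θ * Complex.I))

theorem stronglyMeasurable_circlePairing (ψ : 𝓢(ℂ, ℂ)) :
    StronglyMeasurable (circlePairing ψ) := by
  unfold circlePairing
  refine StronglyMeasurable.integral_prod_right (f := fun r : ℝ => fun θ : ℝ =>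
    Complex.exp (θ * Complex.I) * ψ (r * Complex.exp (θ * Complex.I))) ?_
  refine Continuous.stronglyMeasurable ?_
  simp only [Function.uncurry_def]
  exact Continuous.mul (by fun_prop) (ψ.continuous.comp (by fun_prop))

theorem exists_norm_le_schwartz (ψ : 𝓢(ℂ, ℂ)) :
    ∃ C : ℝ, ∀ x, ‖ψ x‖ ≤ C * (1 + ‖x‖ ^ 2) ^ (-1 : ℝ) := by
  obtain ⟨C0, -, h0⟩ := ψ.decay 0 0
  obtain ⟨C2, -, h2⟩ := ψ.decay 2 0
  refine ⟨C0 + C2, fun x => ?_⟩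
  have h0' := h0 x
  have h2' := h2 x
  simp only [pow_zero, norm_iteratedFDeriv_zero, one_mul] at h0' h2'
  rw [Real.rpow_neg_one, ← div_eq_mul_inv, le_div_iff₀ (by positivity)]
  linarith

theorem exists_norm_circlePairing_le (ψ : 𝓢(ℂ, ℂ)) :
    ∃ C : ℝ, ∀ r, ‖circlePairing ψ r‖ ≤ C * (1 + r ^ 2) ^ (-1 : ℝ) := by
  obtain ⟨C, hC⟩ := exists_norm_le_schwartz ψ
  refine ⟨C * (2 * Real.pi), fun r => ?_⟩
  have := norm_setIntegral_le_of_norm_le_const (μ := volume) (s := Ioo (-Real.pi) Real.pi)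
    (f := fun θ : ℝ => Complex.exp (θ * Complex.I) * ψ (r * Complex.exp (θ * Complex.I)))
    (C := C * (1 + r ^ 2) ^ (-1 : ℝ)) (by simp) (fun θ _ => by
      rw [norm_mul, Complex.norm_exp_ofReal_mul_I, one_mul]
      refine (hC _).trans_eq ?_
      rw [norm_mul, Complex.norm_exp_ofReal_mul_I, mul_one, Complex.norm_real, Real.norm_eq_abs,
        sq_abs])
  refine this.trans_eq ?_
  rw [measureReal_def, Real.volume_Ioo, ENNReal.toReal_ofReal (by linarith [Real.pi_pos])]
  ring

/-- The square of (1+r²)^{-1} is integrable on the plane, hence against r dr. -/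
theorem memLp_circlePairing (ψ : 𝓢(ℂ, ℂ)) : MemLp (circlePairing ψ) 2 radialMeasure := by
  obtain ⟨C, hC⟩ := exists_norm_circlePairing_le ψ
  have hk : MemLp (fun r : ℝ => (1 + r ^ 2) ^ (-1 : ℝ)) 2 radialMeasure := by
    have hm : Measurable fun r : ℝ => (1 + r ^ 2) ^ (-1 : ℝ) := by fun_prop
    refine ⟨hm.aestronglyMeasurable, ?_⟩
    rw [eLpNorm_lt_top_iff_lintegral_rpow_enorm_lt_top (by norm_num) (by norm_num)]
    have h1 := lintegral_comp_norm (fun r => ‖(1 + r ^ 2) ^ (-1 : ℝ)‖ₑ ^ (2 : ℝ≥0∞).toReal)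
      (hm.enorm.pow_const _)
    have h2 : Integrable fun x : ℂ => (1 + ‖x‖ ^ 2) ^ (-(4 : ℝ) / 2) :=
      integrable_rpow_neg_one_add_norm_sq (by rw [Complex.finrank_real_complex]; norm_num)
    have h3 : ∫⁻ x : ℂ, ‖(1 + ‖x‖ ^ 2) ^ (-1 : ℝ)‖ₑ ^ (2 : ℝ≥0∞).toReal < ∞ := by
      refine lt_of_eq_of_lt (lintegral_congr fun x => ?_) h2.2
      rw [← ofReal_norm, ← ofReal_norm, Real.norm_of_nonneg (by positivity),
        Real.norm_of_nonneg (by positivity), ENNReal.ofReal_rpow_of_nonneg (by positivity) (by simp),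
        ← Real.rpow_mul (by positivity)]
      norm_num
    rw [h1] at h3
    exact ENNReal.lt_top_of_mul_ne_top_right h3.ne (by simp [Real.pi_pos])
  refine (hk.const_mul C).of_le (stronglyMeasurable_circlePairing ψ).aestronglyMeasurable
    (Eventually.of_forall fun r => (hC r).trans (le_abs_self _))

theorem integral_radialMeasure (g : ℝ → ℂ) :
    ∫ r, g r ∂radialMeasure = ∫ r in Ioi (0 : ℝ), (r : ℂ) * g r := by
  rw [radialMeasure, integral_withDensity_eq_integral_toReal_smul ENNReal.measurable_ofReal
    (Eventually.of_forall fun _ => ENNReal.ofReal_lt_top)]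
  refine setIntegral_congr_fun measurableSet_Ioi fun r hr => ?_
  rw [ENNReal.toReal_ofReal (le_of_lt hr), Complex.real_smul]

theorem integral_vortex_mul_of_stronglyMeasurable {G : ℝ → ℂ} (hG : StronglyMeasurable G)
    (ψ : 𝓢(ℂ, ℂ)) (hint : Integrable fun x => vortex G x * ψ x) :
    ∫ x, vortex G x * ψ x = ∫ r, G r * circlePairing ψ r ∂radialMeasure := by
  have hform : ∀ p ∈ Ioi (0 : ℝ) ×ˢ Ioo (-Real.pi) Real.pi,
      p.1 • (vortex G (Complex.polarCoord.symm p) * ψ (Complex.polarCoord.symm p)) =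
      (p.1 : ℂ) * (G p.1 * (Complex.exp (p.2 * Complex.I) *
        ψ (p.1 * Complex.exp (p.2 * Complex.I)))) := by
    intro p hp
    have hp1 : (0 : ℝ) < p.1 := hp.1
    have hp1' : (p.1 : ℂ) ≠ 0 := by exact_mod_cast hp1.ne'
    have he : Complex.polarCoord.symm p = p.1 * Complex.exp (p.2 * Complex.I) := by
      rw [Complex.polarCoord_symm_apply, Complex.exp_mul_I]
      push_cast
      rfl
    rw [vortex, Complex.norm_polarCoord_symm, abs_of_pos hp1, he, Complex.real_smul,
      mul_div_cancel_left₀ _ hp1']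
    ring
  have hm : Measurable fun p : ℝ × ℝ => (p.1 : ℂ) * (G p.1 * (Complex.exp (p.2 * Complex.I) *
      ψ (p.1 * Complex.exp (p.2 * Complex.I)))) := by
    refine Measurable.mul (by fun_prop) ((hG.measurable.comp measurable_fst).mul ?_)
    exact Measurable.mul (by fun_prop) (ψ.continuous.measurable.comp (by fun_prop))
  have hms : MeasurableSet (Ioi (0 : ℝ) ×ˢ Ioo (-Real.pi) Real.pi) :=
    measurableSet_Ioi.prod measurableSet_Ioo
  have hI : IntegrableOn (fun p : ℝ × ℝ => (p.1 : ℂ) * (G p.1 * (Complex.exp (p.2 * Complex.I) *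
      ψ (p.1 * Complex.exp (p.2 * Complex.I))))) (Ioi (0 : ℝ) ×ˢ Ioo (-Real.pi) Real.pi) := by
    refine ⟨hm.aestronglyMeasurable, ?_⟩
    refine lt_of_eq_of_lt ?_ hint.2
    rw [← Complex.lintegral_comp_polarCoord_symm, polarCoord_target]
    refine setLIntegral_congr_fun hms fun p hp => ?_
    simp only
    rw [← hform p hp, enorm_smul, smul_eq_mul, Real.enorm_of_nonneg (le_of_lt hp.1)]
  rw [← Complex.integral_comp_polarCoord_symm, polarCoord_target,
    setIntegral_congr_fun hms hform, Measure.volume_eq_prod, setIntegral_prod _ hI,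
    integral_radialMeasure]
  refine setIntegral_congr_fun measurableSet_Ioi fun r _ => ?_
  simp only
  rw [circlePairing, ← integral_const_mul, ← integral_const_mul]

theorem memLp_vortex_of_memLp {q : ℝ → ℂ} {p : ℝ≥0∞} (hq : MemLp q p radialMeasure) :
    MemLp (vortex q) p (volume : Measure ℂ) := by
  have hq' : MemLp q p (Measure.map (fun x : ℂ => ‖x‖) volume) := by
    rw [map_norm_volume]
    exact hq.smul_measure ENNReal.ofReal_ne_top
  have hc : MemLp (q ∘ fun x : ℂ => ‖x‖) p volume := hq'.comp_of_map measurable_norm.aemeasurable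
  refine hc.of_le (AEStronglyMeasurable.mul ?_ hc.1) ?_
  · exact (Measurable.div measurable_id (by fun_prop)).aestronglyMeasurable
  · filter_upwards [ae_ne_zero_plane] with x hx
    rw [norm_vortex _ hx]
    rfl

/-- Polar coordinates. The exponent is left free because the formula is needed with p = 2 for the
solution and with p = 4/3 for the force. -/
theorem integral_vortex_mul {G : ℝ → ℂ} {p q : ℝ≥0∞} [p.HolderConjugate q]
    (hG : MemLp G p radialMeasure) (ψ : 𝓢(ℂ, ℂ)) :
    ∫ x, vortex G x * ψ x = ∫ r, G r * circlePairing ψ r ∂radialMeasure := by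
  obtain ⟨G', hG', hae⟩ := hG.1
  have hG'p : MemLp G' p radialMeasure := hG.ae_eq hae
  have e1 : ∫ x, vortex G x * ψ x = ∫ x, vortex G' x * ψ x := by
    apply integral_congr_ae
    filter_upwards [vortex_congr hae] with x hx
    rw [hx]
  have e2 : ∫ r, G r * circlePairing ψ r ∂radialMeasure =
      ∫ r, G' r * circlePairing ψ r ∂radialMeasure := by
    apply integral_congr_ae
    filter_upwards [hae] with x hx
    rw [hx]
  rw [e1, e2]
  exact integral_vortex_mul_of_stronglyMeasurable hG' ψ
    ((memLp_vortex_of_memLp hG'p).integrable_mul (ψ.memLp q))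

/-- The radial `L²` function representing the functional `f ↦ ∫ e^{iθ} f(r) ψ(x) dx`. -/
def sharp (ψ : 𝓢(ℂ, ℂ)) : RadialL2 :=
  ((memLp_circlePairing ψ).star).toLp

theorem coeFn_sharp (ψ : 𝓢(ℂ, ℂ)) :
    sharp ψ =ᵐ[radialMeasure] fun r => (starRingEnd ℂ) (circlePairing ψ r) := MemLp.coeFn_toLp _

theorem integral_vortex_mul_eq_sharp {G : ℝ → ℂ} {p q : ℝ≥0∞} [p.HolderConjugate q]
    (hG : MemLp G p radialMeasure) (ψ : 𝓢(ℂ, ℂ)) :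
    ∫ x, vortex G x * ψ x = ∫ r, (starRingEnd ℂ) (sharp ψ r) * G r ∂radialMeasure := by
  rw [integral_vortex_mul (q := q) hG]
  apply integral_congr_ae
  filter_upwards [coeFn_sharp ψ] with r hr
  rw [hr, Complex.conj_conj, mul_comm]

theorem inner_sharp (ψ : 𝓢(ℂ, ℂ)) (f : RadialL2) :
    inner ℂ (sharp ψ) f = ∫ x, vortex f x * ψ x := by
  rw [integral_vortex_mul_eq_sharp (q := 2) (Lp.memLp f), L2.inner_def]
  simp [mul_comm]

/-- Evolving the test function is the inverse evolution of its Riesz representative. This turns the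
distributional Duhamel formula into an identity in L². -/
theorem sharp_freeSchwartz (t : ℝ) (φ : 𝓢(ℂ, ℂ)) :
    sharp (freeSchwartz t φ) = flow (-t) (sharp φ) := by
  refine ext_inner_right ℂ fun f => ?_
  have h : ∀ (g : RadialL2) (χ : 𝓢(ℂ, ℂ)), ∫ x, vortex g x * χ x = ∫ x, vortexL2 g x * χ x := by
    intro g χ
    apply integral_congr_ae
    filter_upwards [coeFn_vortexL2 g] with x hx
    rw [hx]
  rw [← inner_flow_right, inner_sharp, inner_sharp, h, h, vortexL2_flow, integral_freeL2_mul]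

/-- An L² function on the plane is determined by the tempered distribution it defines. -/
theorem eq_of_inner_sharp {f g : RadialL2}
    (h : ∀ φ : 𝓢(ℂ, ℂ), inner ℂ (sharp φ) f = inner ℂ (sharp φ) g) : f = g := by
  apply vortexL2_injective
  have hker := LinearMap.ker_eq_bot.1
    (Lp.ker_toTemperedDistributionCLM_eq_bot (E := ℂ) (F := ℂ) (μ := volume) (p := 2))
  apply hker
  ext φ
  have h1 : ∀ k : RadialL2, Lp.toTemperedDistribution (vortexL2 k) φ = inner ℂ (sharp φ) k := by
    intro k
    rw [inner_sharp, Lp.toTemperedDistribution_apply]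
    apply integral_congr_ae
    filter_upwards [coeFn_vortexL2 k] with x hx
    rw [hx, smul_eq_mul, mul_comm]
  simpa [h1] using h φ

/-! ### Space-time functions and their time slices -/

instance fact_one_le_four : Fact ((1 : ℝ≥0∞) ≤ 4) := ⟨by norm_num⟩

theorem one_le_four_thirds : (1 : ℝ≥0∞) ≤ 4 / 3 := by
  rw [ENNReal.le_div_iff_mul_le (by simp) (by simp)]
  norm_num

instance fact_one_le_four_thirds : Fact ((1 : ℝ≥0∞) ≤ 4 / 3) := ⟨one_le_four_thirds⟩

theorem four_thirds_ne_zero : (4 / 3 : ℝ≥0∞) ≠ 0 := by simp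

theorem four_thirds_ne_top : (4 / 3 : ℝ≥0∞) ≠ ∞ := ENNReal.div_ne_top (by simp) (by simp)

theorem toReal_four_thirds : (4 / 3 : ℝ≥0∞).toReal = 4 / 3 := by simp

instance holderConjugate_four : ENNReal.HolderConjugate 4 (4 / 3) := by
  rw [ENNReal.holderConjugate_iff, ENNReal.inv_div (by simp) (by simp)]
  rw [← one_div, ← ENNReal.add_div]
  norm_num
  exact ENNReal.div_self (by simp) (by simp)

instance fact_two_ne_top : Fact ((2 : ℝ≥0∞) ≠ ∞) := ⟨by simp⟩

/-- The measure `dt ⊗ r dr` on space-time. -/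
abbrev spacetime : Measure (ℝ × ℝ) := (volume : Measure ℝ).prod radialMeasure

/-- The Strichartz space `L⁴(ℝ; L⁴)`. -/
abbrev StrichartzSpace : Type := Lp ℂ 4 spacetime

/-- The dual Strichartz space `L^{4/3}(ℝ; L^{4/3})`. -/
abbrev DualSpace : Type := Lp ℂ (4 / 3) spacetime

theorem ae_eq_of_slices {x y : ℝ × ℝ → ℂ} (hx : AEStronglyMeasurable x spacetime)
    (hy : AEStronglyMeasurable y spacetime)
    (h : ∀ᵐ t : ℝ, (fun r => x (t, r)) =ᵐ[radialMeasure] fun r => y (t, r)) :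
    x =ᵐ[spacetime] y := by
  have hxy : hx.mk x =ᵐ[spacetime] hy.mk y := by
    refine (Measure.ae_prod_iff_ae_ae (p := fun z => hx.mk x z = hy.mk y z) ?_).2 ?_
    · exact measurableSet_eq_fun hx.stronglyMeasurable_mk.measurable
        hy.stronglyMeasurable_mk.measurable
    · filter_upwards [h, Measure.ae_ae_of_ae_prod hx.ae_eq_mk,
        Measure.ae_ae_of_ae_prod hy.ae_eq_mk] with t h1 h2 h3
      filter_upwards [h1, h2, h3] with r h4 h5 h6
      rw [← h5, ← h6, h4]
  exact hx.ae_eq_mk.trans (hxy.trans hy.ae_eq_mk.symm)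

theorem ae_slices {x y : ℝ × ℝ → ℂ} (h : x =ᵐ[spacetime] y) :
    ∀ᵐ t : ℝ, (fun r => x (t, r)) =ᵐ[radialMeasure] fun r => y (t, r) :=
  Measure.ae_ae_of_ae_prod h

/-- A strongly measurable path of radial `L²` functions has a jointly measurable version. -/
theorem exists_measurable_slices {v : ℝ → RadialL2} (hv : StronglyMeasurable v) :
    ∃ x : ℝ × ℝ → ℂ, StronglyMeasurable x ∧
      ∀ t, (fun r => x (t, r)) =ᵐ[radialMeasure] v t := by
  classical
  -- Approximating v t within 4^{-k} by the first suitable member of a dense sequence uses countably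
  -- many functions, which gives joint measurability. The geometric rate makes the whole sequence
  -- converge almost everywhere at every t, so one pointwise limit serves all times; a subsequence
  -- then identifies it with v t.
  have hex : ∀ (k : ℕ) (t : ℝ), ∃ n, dist (v t) (TopologicalSpace.denseSeq RadialL2 n) < 4⁻¹ ^ k :=
    fun k t => (TopologicalSpace.denseRange_denseSeq RadialL2).exists_dist_lt (v t) (by positivity)
  set N : ℕ → ℝ → ℕ := fun k t => Nat.find (hex k t) with hN
  have hNm : ∀ k, Measurable (N k) := fun k =>
    measurable_find (hex k) fun n => measurableSet_lt
      (hv.dist stronglyMeasurable_const).measurable measurable_const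
  have hNd : ∀ k t, dist (v t) (TopologicalSpace.denseSeq RadialL2 (N k t)) < 4⁻¹ ^ k :=
    fun k t => Nat.find_spec (hex k t)
  set X : ℕ → ℝ × ℝ → ℂ := fun k z => TopologicalSpace.denseSeq RadialL2 (N k z.1) z.2 with hX
  have hXm : ∀ k, StronglyMeasurable (X k) := by
    intro k
    have h1 : Measurable fun p : ℕ × ℝ => TopologicalSpace.denseSeq RadialL2 p.1 p.2 :=
      measurable_from_prod_countable_right fun n =>
        (Lp.stronglyMeasurable (TopologicalSpace.denseSeq RadialL2 n)).measurable
    exact (h1.comp (((hNm k).comp measurable_fst).prodMk measurable_snd)).stronglyMeasurable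
  refine ⟨fun z => limUnder atTop fun k => X k z, StronglyMeasurable.limUnder hXm, fun t => ?_⟩
  set u : ℕ → RadialL2 := fun k => TopologicalSpace.denseSeq RadialL2 (N k t) with hu
  have hut : Tendsto u atTop (𝓝 (v t)) := by
    rw [tendsto_iff_dist_tendsto_zero]
    refine squeeze_zero (fun _ => dist_nonneg) (fun k => ?_)
      (tendsto_pow_atTop_nhds_zero_of_lt_one (by norm_num : (0 : ℝ) ≤ 4⁻¹) (by norm_num))
    rw [dist_comm]
    exact (hNd k t).le
  have hcau : ∀ᵐ r ∂radialMeasure, ∃ l, Tendsto (fun k => u k r) atTop (𝓝 l) := by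
    refine Lp.ae_tendsto_of_cauchy_eLpNorm (p := 2) (fun k => Lp.aestronglyMeasurable (u k))
      (by norm_num) (B := fun k => ENNReal.ofReal (2 * 4⁻¹ ^ k)) ?_ ?_
    · rw [← ENNReal.ofReal_tsum_of_nonneg (fun _ => by positivity)]
      · exact ENNReal.ofReal_ne_top
      · exact (summable_geometric_of_lt_one (by norm_num) (by norm_num)).mul_left 2
    · intro K n m hn hm
      rw [← eLpNorm_congr_ae (Lp.coeFn_sub (u n) (u m)), ← Lp.enorm_def, ← ofReal_norm,
        ← dist_eq_norm]
      refine (ENNReal.ofReal_lt_ofReal_iff (by positivity)).2 ?_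
      have h1 : (4⁻¹ : ℝ) ^ n ≤ 4⁻¹ ^ K := pow_le_pow_of_le_one (by norm_num) (by norm_num) hn
      have h2 : (4⁻¹ : ℝ) ^ m ≤ 4⁻¹ ^ K := pow_le_pow_of_le_one (by norm_num) (by norm_num) hm
      calc dist (u n) (u m) ≤ dist (v t) (u n) + dist (v t) (u m) := dist_triangle_left _ _ _
        _ < 4⁻¹ ^ n + 4⁻¹ ^ m := add_lt_add (hNd n t) (hNd m t)
        _ ≤ 2 * 4⁻¹ ^ K := by linarith
  obtain ⟨ns, hns, hae⟩ := (tendstoInMeasure_of_tendsto_Lp hut).exists_seq_tendsto_ae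
  filter_upwards [hcau, hae] with r hr1 hr2
  have h1 : Tendsto (fun k => X k (t, r)) atTop (𝓝 (limUnder atTop fun k => X k (t, r))) :=
    tendsto_nhds_limUnder hr1
  exact tendsto_nhds_unique (h1.comp hns.tendsto_atTop) hr2

theorem lintegral_rpow_enorm_Lp {α : Type*} [MeasurableSpace α] {μ : Measure α} {p : ℝ≥0∞}
    (hp : p ≠ 0) (hp' : p ≠ ∞) (f : Lp ℂ p μ) :
    ‖f‖ₑ ^ p.toReal = ∫⁻ x, ‖f x‖ₑ ^ p.toReal ∂μ := by
  rw [Lp.enorm_def, eLpNorm_eq_lintegral_rpow_enorm_toReal hp hp', ← ENNReal.rpow_mul,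
    one_div, inv_mul_cancel₀ (ENNReal.toReal_pos hp hp').ne', ENNReal.rpow_one]

theorem enorm_pow_four (x : StrichartzSpace) :
    ‖x‖ₑ ^ 4 = ∫⁻ t, ∫⁻ r, ‖x (t, r)‖ₑ ^ 4 ∂radialMeasure := by
  have h := lintegral_rpow_enorm_Lp (by simp) (by simp) x
  rw [ENNReal.toReal_ofNat] at h
  norm_cast at h
  rw [h, lintegral_prod]
  exact ((Lp.aestronglyMeasurable x).enorm).pow_const 4

/-- `x` is a space-time version of the path `v`. -/
def IsVersion (x : ℝ × ℝ → ℂ) (v : ℝ → RadialL2) : Prop :=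
  ∀ᵐ t : ℝ, (fun r => x (t, r)) =ᵐ[radialMeasure] v t

theorem IsVersion.enorm_pow_four {x : StrichartzSpace} {v : ℝ → RadialL2} (h : IsVersion x v) :
    ‖x‖ₑ ^ 4 = scatteringSize univ v := by
  rw [RadialNLS.enorm_pow_four, scatteringSize, Measure.restrict_univ]
  apply lintegral_congr_ae
  filter_upwards [h] with t ht
  apply lintegral_congr_ae
  filter_upwards [ht] with r hr
  rw [hr]

theorem IsVersion.add {x y : StrichartzSpace} {v w : ℝ → RadialL2} (hx : IsVersion x v)
    (hy : IsVersion y w) : IsVersion (x + y : StrichartzSpace) (fun t => v t + w t) := by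
  filter_upwards [hx, hy, ae_slices (Lp.coeFn_add x y)] with t h1 h2 h3
  filter_upwards [h1, h2, h3, Lp.coeFn_add (v t) (w t)] with r h4 h5 h6 h7
  rw [h6, h7, Pi.add_apply, Pi.add_apply, h4, h5]

theorem IsVersion.sub {x y : StrichartzSpace} {v w : ℝ → RadialL2} (hx : IsVersion x v)
    (hy : IsVersion y w) : IsVersion (x - y : StrichartzSpace) (fun t => v t - w t) := by
  filter_upwards [hx, hy, ae_slices (Lp.coeFn_sub x y)] with t h1 h2 h3
  filter_upwards [h1, h2, h3, Lp.coeFn_sub (v t) (w t)] with r h4 h5 h6 h7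
  rw [h6, h7, Pi.sub_apply, Pi.sub_apply, h4, h5]

theorem IsVersion.smul {x : StrichartzSpace} {v : ℝ → RadialL2} (c : ℂ) (hx : IsVersion x v) :
    IsVersion (c • x : StrichartzSpace) (fun t => c • v t) := by
  filter_upwards [hx, ae_slices (Lp.coeFn_smul c x)] with t h1 h3
  filter_upwards [h1, h3, Lp.coeFn_smul c (v t)] with r h4 h6 h7
  rw [h6, h7, Pi.smul_apply, Pi.smul_apply, h4]

theorem IsVersion.unique {p : ℝ≥0∞} {x y : Lp ℂ p spacetime} {v : ℝ → RadialL2}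
    (hx : IsVersion x v) (hy : IsVersion y v) : x = y := by
  apply Lp.ext
  refine ae_eq_of_slices (Lp.aestronglyMeasurable x) (Lp.aestronglyMeasurable y) ?_
  filter_upwards [hx, hy] with t h1 h2
  exact h1.trans h2.symm

/-- A measurable path of finite scattering size defines an element of the Strichartz space. -/
theorem exists_isVersion {v : ℝ → RadialL2} (hv : StronglyMeasurable v)
    (hfin : scatteringSize univ v < ∞) : ∃ x : StrichartzSpace, IsVersion x v := by
  obtain ⟨x, hxm, hx⟩ := exists_measurable_slices hv
  have hmem : MemLp x 4 spacetime := by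
    refine ⟨hxm.aestronglyMeasurable, ?_⟩
    rw [eLpNorm_lt_top_iff_lintegral_rpow_enorm_lt_top (by norm_num) (by norm_num),
      ENNReal.toReal_ofNat, lintegral_prod _ (hxm.measurable.enorm.pow_const _).aemeasurable]
    refine lt_of_eq_of_lt ?_ hfin
    rw [scatteringSize, Measure.restrict_univ]
    refine lintegral_congr fun t => lintegral_congr_ae ?_
    filter_upwards [hx t] with r hr
    rw [hr]
    norm_cast
  refine ⟨hmem.toLp, ?_⟩
  filter_upwards [ae_slices hmem.coeFn_toLp] with t ht
  exact ht.trans (hx t)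

theorem scatteringSize_indicator {I : Set ℝ} (hI : MeasurableSet I) (v : ℝ → RadialL2) :
    scatteringSize univ (I.indicator v) = scatteringSize I v := by
  rw [scatteringSize, scatteringSize, Measure.restrict_univ, ← lintegral_indicator hI]
  refine lintegral_congr fun t => ?_
  by_cases ht : t ∈ I
  · simp [ht]
  · simp only [ht, not_false_eq_true, indicator_of_notMem]
    rw [lintegral_eq_zero_iff' (by fun_prop)]
    filter_upwards [Lp.coeFn_zero ℂ 2 radialMeasure] with r hr
    rw [hr]
    simp

/-! ### Linear evolution in the Strichartz space -/

theorem stronglyMeasurable_flow (q : RadialL2) : StronglyMeasurable fun t => flow t q :=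
  (continuous_flow q).stronglyMeasurable

theorem scatteringSize_flow_le (q : RadialL2) :
    scatteringSize univ (fun t => flow t q) ≤ (2 * ‖q‖ₑ) ^ 4 := by
  rw [scatteringSize, Measure.restrict_univ]
  exact strichartz_flow q

theorem exists_isVersion_flow (q : RadialL2) :
    ∃ x : StrichartzSpace, IsVersion x (fun t => flow t q) :=
  exists_isVersion (stronglyMeasurable_flow q) ((scatteringSize_flow_le q).trans_lt
    (ENNReal.pow_lt_top (ENNReal.mul_lt_top (by simp) enorm_lt_top)))

theorem enorm_le_of_pow_four_le {a b : ℝ≥0∞} (h : a ^ 4 ≤ b ^ 4) : a ≤ b :=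
  (ENNReal.pow_le_pow_left_iff (by norm_num)).1 h

/-- The free evolution as a bounded map from `L²` to the Strichartz space. -/
def evolve : RadialL2 →L[ℂ] StrichartzSpace :=
  LinearMap.mkContinuous
    { toFun := fun q => (exists_isVersion_flow q).choose
      map_add' := fun p q => by
        have h := (exists_isVersion_flow p).choose_spec.add (exists_isVersion_flow q).choose_spec
        simp_rw [← map_add] at h
        exact (exists_isVersion_flow (p + q)).choose_spec.unique h
      map_smul' := fun c q => by
        have h := (exists_isVersion_flow q).choose_spec.smul c
        simp_rw [← map_smul] at h
        exact (exists_isVersion_flow (c • q)).choose_spec.unique h } 2 (fun q => by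
    have h1 := (exists_isVersion_flow q).choose_spec.enorm_pow_four
    have h2 := enorm_le_of_pow_four_le (h1.trans_le (scatteringSize_flow_le q))
    have h3 : (2 : ℝ≥0∞) * ‖q‖ₑ = ENNReal.ofReal (2 * ‖q‖) := by
      rw [ENNReal.ofReal_mul (by norm_num), ofReal_norm]
      norm_num
    rw [h3, ← ofReal_norm, ENNReal.ofReal_le_ofReal_iff (by positivity)] at h2
    exact h2)

theorem isVersion_evolve (q : RadialL2) : IsVersion (evolve q) (fun t => flow t q) :=
  (exists_isVersion_flow q).choose_spec

theorem norm_evolve_le (q : RadialL2) : ‖evolve q‖ ≤ 2 * ‖q‖ :=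
  ContinuousLinearMap.le_of_opNorm_le _ (LinearMap.mkContinuous_norm_le _ (by norm_num) _) q

/-! ### The dual of the free evolution -/

/-- The real pairing `Re ∫∫ x̄ f` between the Strichartz space and its dual. -/
def dualPairing : StrichartzSpace →L[ℝ] DualSpace →L[ℝ] ℝ :=
  (innerSL ℝ : ℂ →L[ℝ] ℂ →L[ℝ] ℝ).lpPairing spacetime 4 (4 / 3)

theorem dualPairing_apply (x : StrichartzSpace) (f : DualSpace) :
    dualPairing x f = ∫ z, inner ℝ (x z) (f z) ∂spacetime := by
  rw [dualPairing, ContinuousLinearMap.lpPairing_eq_integral]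
  rfl

theorem abs_dualPairing_le (x : StrichartzSpace) (f : DualSpace) :
    |dualPairing x f| ≤ ‖x‖ * ‖f‖ := by
  rw [dualPairing_apply, ← Real.norm_eq_abs]
  have h1 : ENNReal.HolderTriple 4 (4 / 3) 1 := inferInstance
  have hxf := eLpNorm_le_eLpNorm_mul_eLpNorm_of_nnnorm (p := 4) (q := 4 / 3) (r := 1)
    (Lp.aestronglyMeasurable x) (Lp.aestronglyMeasurable f)
    (fun a b : ℂ => inner ℝ a b) 1 (Eventually.of_forall fun z => by
      rw [one_mul]; exact nnnorm_inner_le_nnnorm _ _)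
  rw [eLpNorm_one_eq_lintegral_enorm, ENNReal.coe_one, one_mul, ← Lp.enorm_def, ← Lp.enorm_def,
    ← ofReal_norm, ← ofReal_norm, ← ENNReal.ofReal_mul (norm_nonneg _)] at hxf
  have h2 := (enorm_integral_le_lintegral_enorm
    (fun z => inner ℝ (x z) (f z)) (μ := spacetime)).trans hxf
  rwa [← ofReal_norm, ENNReal.ofReal_le_ofReal_iff (by positivity)] at h2

/-- The Riesz representative of the functional `h ↦ Re ∫∫ (e^{it(Δ - 1/r²)} h)⁻ f`. -/
def evolveDualFun (f : DualSpace) : RadialL2 :=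
  (InnerProductSpace.toDual ℝ RadialL2).symm (dualPairing.flip f ∘L evolve.restrictScalars ℝ)

theorem inner_evolveDualFun (f : DualSpace) (h : RadialL2) :
    inner ℝ (evolveDualFun f) h = dualPairing (evolve h) f := by
  rw [evolveDualFun, InnerProductSpace.toDual_symm_apply]
  rfl

theorem norm_evolveDualFun_le (f : DualSpace) : ‖evolveDualFun f‖ ≤ 2 * ‖f‖ := by
  have h1 : ‖evolveDualFun f‖ * ‖evolveDualFun f‖ ≤ (2 * ‖evolveDualFun f‖) * ‖f‖ := by
    rw [← real_inner_self_eq_norm_mul_norm, inner_evolveDualFun]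
    refine (le_abs_self _).trans ((abs_dualPairing_le _ _).trans ?_)
    gcongr
    exact norm_evolve_le _
  rcases eq_or_lt_of_le (norm_nonneg (evolveDualFun f)) with h | h
  · rw [← h]; positivity
  · nlinarith

/-- The dual of the free evolution, `f ↦ ∫ e^{-is(Δ - 1/r²)} f(s) ds`. -/
def evolveDual : DualSpace →L[ℝ] RadialL2 :=
  LinearMap.mkContinuous
    { toFun := evolveDualFun
      map_add' := fun f g => ext_inner_right ℝ fun h => by
        rw [inner_add_left, inner_evolveDualFun, inner_evolveDualFun, inner_evolveDualFun, map_add]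
      map_smul' := fun c f => ext_inner_right ℝ fun h => by
        rw [RingHom.id_apply, real_inner_smul_left, inner_evolveDualFun, inner_evolveDualFun,
          map_smul, smul_eq_mul] } 2 norm_evolveDualFun_le

theorem inner_evolveDual (f : DualSpace) (h : RadialL2) :
    inner ℝ (evolveDual f) h = dualPairing (evolve h) f := inner_evolveDualFun f h

theorem norm_evolveDual_le (f : DualSpace) : ‖evolveDual f‖ ≤ 2 * ‖f‖ := norm_evolveDualFun_le f

theorem integrable_conj_mul (x : StrichartzSpace) (f : DualSpace) :
    Integrable (fun z => (starRingEnd ℂ) (x z) * f z) spacetime :=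
  (Lp.memLp x).star.integrable_mul (Lp.memLp f)

theorem re_inner_RadialL2 (h g : RadialL2) : (inner ℂ h g).re = inner ℝ h g := by
  rw [L2.inner_def, L2.inner_def]
  have h1 : Integrable (fun r => inner ℂ (h r) (g r)) radialMeasure := L2.integrable_inner h g
  rw [← RCLike.re_eq_complex_re, ← integral_re h1]
  rfl

/-- The adjoint is defined by a real pairing only. The imaginary part is recovered by replacing h by
ih, since `evolve` is complex linear. -/
theorem inner_evolveDual_complex (f : DualSpace) (h : RadialL2) :
    inner ℂ h (evolveDual f) = ∫ z, (starRingEnd ℂ) (evolve h z) * f z ∂spacetime := by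
  have key : ∀ h : RadialL2, (inner ℂ h (evolveDual f)).re =
      (∫ z, (starRingEnd ℂ) (evolve h z) * f z ∂spacetime).re := by
    intro h
    rw [re_inner_RadialL2, real_inner_comm, inner_evolveDual, dualPairing_apply,
      ← RCLike.re_eq_complex_re, ← integral_re (integrable_conj_mul _ _)]
    refine integral_congr_ae (Eventually.of_forall fun z => ?_)
    simp [Complex.inner, mul_comm]
  refine Complex.ext (key h) ?_
  have h2 := key (Complex.I • h)
  rw [inner_smul_left, map_smul] at h2
  have h3 : ∫ z, (starRingEnd ℂ) ((Complex.I • evolve h : StrichartzSpace) z) * f z ∂spacetime =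
      (starRingEnd ℂ) Complex.I * ∫ z, (starRingEnd ℂ) (evolve h z) * f z ∂spacetime := by
    rw [← integral_const_mul]
    apply integral_congr_ae
    filter_upwards [Lp.coeFn_smul Complex.I (evolve h)] with z hz
    rw [hz, Pi.smul_apply, smul_eq_mul, map_mul]
    ring
  rw [h3] at h2
  simpa using h2

/-! ### Restriction to sets of times -/

variable {p : ℝ≥0∞}

theorem memLp_timeIndicator {E : Set ℝ} (hE : MeasurableSet E) (f : Lp ℂ p spacetime) :
    MemLp ((Prod.fst ⁻¹' E).indicator f) p spacetime :=
  (Lp.memLp f).indicator (measurable_fst hE)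

open Classical in
/-- Multiplication by the indicator function of a measurable set of times. -/
def cut (E : Set ℝ) (f : Lp ℂ p spacetime) : Lp ℂ p spacetime :=
  -- With 0 as the value on non-measurable sets, additivity and the bound `norm_cut_le` hold for
  -- every E.
  if hE : MeasurableSet E then (memLp_timeIndicator hE f).toLp else 0

theorem coeFn_cut {E : Set ℝ} (hE : MeasurableSet E) (f : Lp ℂ p spacetime) :
    cut E f =ᵐ[spacetime] (Prod.fst ⁻¹' E).indicator f := by
  rw [cut, dif_pos hE]
  exact MemLp.coeFn_toLp _

theorem cut_add (E : Set ℝ) (f g : Lp ℂ p spacetime) : cut E (f + g) = cut E f + cut E g := by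
  by_cases hE : MeasurableSet E
  · apply Lp.ext
    filter_upwards [coeFn_cut hE (f + g), coeFn_cut hE f, coeFn_cut hE g, Lp.coeFn_add f g,
      Lp.coeFn_add (cut E f) (cut E g)] with z h1 h2 h3 h4 h5
    rw [h1, h5, Pi.add_apply, h2, h3]
    by_cases hz : z ∈ Prod.fst ⁻¹' E
    · rw [indicator_of_mem hz, indicator_of_mem hz, indicator_of_mem hz, h4, Pi.add_apply]
    · simp [hz]
  · simp [cut, hE]

theorem cut_zero (E : Set ℝ) : cut E (0 : Lp ℂ p spacetime) = 0 := by
  have := cut_add E (0 : Lp ℂ p spacetime) 0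
  simpa using this

theorem cut_neg (E : Set ℝ) (f : Lp ℂ p spacetime) : cut E (-f) = -cut E f := by
  have := cut_add E f (-f)
  rw [add_neg_cancel, cut_zero] at this
  exact (neg_eq_of_add_eq_zero_right this.symm).symm

theorem cut_sub (E : Set ℝ) (f g : Lp ℂ p spacetime) : cut E (f - g) = cut E f - cut E g := by
  rw [sub_eq_add_neg, cut_add, cut_neg, sub_eq_add_neg]

theorem cut_cut {E F : Set ℝ} (hE : MeasurableSet E) (hF : MeasurableSet F)
    (f : Lp ℂ p spacetime) : cut E (cut F f) = cut (E ∩ F) f := by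
  apply Lp.ext
  filter_upwards [coeFn_cut hE (cut F f), coeFn_cut hF f, coeFn_cut (hE.inter hF) f]
    with z h1 h2 h3
  rw [h1, h3]
  by_cases hz : z ∈ Prod.fst ⁻¹' E <;> by_cases hz' : z ∈ Prod.fst ⁻¹' F <;>
    simp_all

theorem cut_univ (f : Lp ℂ p spacetime) : cut univ f = f := by
  apply Lp.ext
  filter_upwards [coeFn_cut MeasurableSet.univ f] with z h1
  rw [h1]
  simp

theorem cut_empty (f : Lp ℂ p spacetime) : cut ∅ f = 0 := by
  apply Lp.ext
  filter_upwards [coeFn_cut MeasurableSet.empty f, Lp.coeFn_zero ℂ p spacetime] with z h1 h2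
  rw [h1, h2]
  simp

theorem cut_union {E F : Set ℝ} (hE : MeasurableSet E) (hF : MeasurableSet F)
    (hEF : Disjoint E F) (f : Lp ℂ p spacetime) : cut (E ∪ F) f = cut E f + cut F f := by
  apply Lp.ext
  filter_upwards [coeFn_cut hE f, coeFn_cut hF f, coeFn_cut (hE.union hF) f,
    Lp.coeFn_add (cut E f) (cut F f)] with z h1 h2 h3 h4
  rw [h3, h4, Pi.add_apply, h1, h2]
  by_cases hz : z ∈ Prod.fst ⁻¹' E <;> by_cases hz' : z ∈ Prod.fst ⁻¹' F
  · exact absurd (disjoint_left.1 hEF hz) (not_not.2 hz')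
  all_goals simp_all

theorem cut_sub_cut {E F : Set ℝ} (hE : MeasurableSet E) (hF : MeasurableSet F) (hEF : E ⊆ F)
    (f : Lp ℂ p spacetime) : cut F f - cut E f = cut (F \ E) f := by
  rw [sub_eq_iff_eq_add', ← cut_union hE (hF.diff hE) disjoint_sdiff_right,
    union_sdiff_cancel hEF]

/-- The distribution `E ↦ ∫_E ‖f(t)‖_p^p dt` of the mass of `f` in time. -/
def timeMeasure (f : Lp ℂ p spacetime) : Measure ℝ :=
  (spacetime.withDensity fun z => ‖f z‖ₑ ^ p.toReal).map Prod.fst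

theorem enorm_cut_rpow (hp : p ≠ 0) (hp' : p ≠ ∞) {E : Set ℝ} (hE : MeasurableSet E)
    (f : Lp ℂ p spacetime) : ‖cut E f‖ₑ ^ p.toReal = timeMeasure f E := by
  have hpos := ENNReal.toReal_pos hp hp'
  rw [lintegral_rpow_enorm_Lp hp hp', timeMeasure, Measure.map_apply measurable_fst hE,
    withDensity_apply _ (measurable_fst hE), ← lintegral_indicator (measurable_fst hE)]
  apply lintegral_congr_ae
  filter_upwards [coeFn_cut hE f] with z h1
  rw [h1]
  by_cases hz : z ∈ Prod.fst ⁻¹' E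
  · simp [hz]
  · simp [hz, hpos]

theorem timeMeasure_univ (hp : p ≠ 0) (hp' : p ≠ ∞) (f : Lp ℂ p spacetime) :
    timeMeasure f univ = ‖f‖ₑ ^ p.toReal := by
  rw [← enorm_cut_rpow hp hp' MeasurableSet.univ, cut_univ]

theorem isFiniteMeasure_timeMeasure (hp : p ≠ 0) (hp' : p ≠ ∞) (f : Lp ℂ p spacetime) :
    IsFiniteMeasure (timeMeasure f) := by
  refine ⟨?_⟩
  rw [timeMeasure_univ hp hp']
  exact ENNReal.rpow_lt_top_of_nonneg ENNReal.toReal_nonneg enorm_ne_top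

/-- A single time is a null set of space-time. Without atoms the mass grows continuously in time, so
prescribed fractions of it are attained exactly. -/
theorem noAtoms_timeMeasure (f : Lp ℂ p spacetime) : NullSingletonClass (timeMeasure f) := by
  refine ⟨fun t => ?_⟩
  rw [timeMeasure, Measure.map_apply measurable_fst (measurableSet_singleton t)]
  refine withDensity_absolutelyContinuous _ _ ?_
  rw [← prod_univ, Measure.prod_prod, Real.volume_singleton, zero_mul]

theorem enorm_cut_le (hp : p ≠ 0) (hp' : p ≠ ∞) (E : Set ℝ) (f : Lp ℂ p spacetime) :
    ‖cut E f‖ₑ ≤ ‖f‖ₑ := by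
  by_cases hE : MeasurableSet E
  · rw [← ENNReal.rpow_le_rpow_iff (ENNReal.toReal_pos hp hp'), enorm_cut_rpow hp hp' hE,
      ← timeMeasure_univ hp hp']
    exact measure_mono (subset_univ E)
  · rw [cut, dif_neg hE, Lp.enorm_def, eLpNorm_congr_ae (Lp.coeFn_zero _ _ _), eLpNorm_zero]
    exact zero_le

theorem norm_cut_le [Fact (1 ≤ p)] (hp' : p ≠ ∞) (E : Set ℝ) (f : Lp ℂ p spacetime) :
    ‖cut E f‖ ≤ ‖f‖ := by
  have hp : p ≠ 0 := (zero_lt_one.trans_le Fact.out).ne'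
  have := enorm_cut_le hp hp' E f
  rwa [← ofReal_norm, ← ofReal_norm, ENNReal.ofReal_le_ofReal_iff (norm_nonneg _)] at this

/-! ### The retarded Strichartz estimate -/

theorem rpow_enorm_cut (f : DualSpace) {E : Set ℝ} (hE : MeasurableSet E) :
    ‖cut E f‖ₑ ^ (4 / 3 : ℝ) = timeMeasure f E := by
  have := enorm_cut_rpow four_thirds_ne_zero four_thirds_ne_top hE f
  rwa [toReal_four_thirds] at this

theorem rpow_norm_cut (f : DualSpace) {E : Set ℝ} (hE : MeasurableSet E) :
    ‖cut E f‖ ^ (4 / 3 : ℝ) = (timeMeasure f).real E := by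
  rw [measureReal_def, ← rpow_enorm_cut f hE, ← ENNReal.toReal_rpow, toReal_enorm]

theorem norm_cut_eq (f : DualSpace) {E : Set ℝ} (hE : MeasurableSet E) :
    ‖cut E f‖ = (timeMeasure f).real E ^ (3 / 4 : ℝ) := by
  rw [← rpow_norm_cut f hE, ← Real.rpow_mul (norm_nonneg _)]
  norm_num

theorem pow_four_norm_cut (f : DualSpace) {E : Set ℝ} (hE : MeasurableSet E) :
    ‖cut E f‖ ^ 4 = (timeMeasure f).real E ^ 3 := by
  rw [norm_cut_eq f hE, ← Real.rpow_natCast, ← Real.rpow_mul measureReal_nonneg,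
    ← Real.rpow_natCast]
  norm_num

instance (f : DualSpace) : IsFiniteMeasure (timeMeasure f) :=
  isFiniteMeasure_timeMeasure four_thirds_ne_zero four_thirds_ne_top f

instance (f : StrichartzSpace) : IsFiniteMeasure (timeMeasure f) :=
  isFiniteMeasure_timeMeasure (by simp) (by simp) f

instance {p : ℝ≥0∞} (f : Lp ℂ p spacetime) : NullSingletonClass (timeMeasure f) :=
  noAtoms_timeMeasure f

theorem continuous_measureReal_Iic (μ : Measure ℝ) [IsFiniteMeasure μ] [NullSingletonClass μ] :
    Continuous fun t => μ.real (Iic t) := by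
  have h := intervalIntegral.continuous_primitive (μ := μ) (f := fun _ => (1 : ℝ))
    (fun a b => intervalIntegrable_const) 0
  have h2 : ∀ t, μ.real (Iic t) = μ.real (Iic 0) + ∫ _ in (0 : ℝ)..t, (1 : ℝ) ∂μ := by
    intro t
    have hI : ∀ s : ℝ, μ.real (Iic s) = ∫ _ in Iic s, (1 : ℝ) ∂μ := by
      intro s
      rw [setIntegral_const, smul_eq_mul, mul_one]
    have := intervalIntegral.integral_Iic_sub_Iic (μ := μ) (f := fun _ => (1 : ℝ)) (a := 0) (b := t)
      (integrable_const _).integrableOn (integrable_const _).integrableOn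
    rw [hI, hI, ← this]
    ring
  rw [funext h2]
  exact continuous_const.add h

theorem measureReal_Ioc_eq (μ : Measure ℝ) [IsFiniteMeasure μ] {s t : ℝ} (hst : s ≤ t) :
    μ.real (Ioc s t) = μ.real (Iic t) - μ.real (Iic s) := by
  rw [← Iic_sdiff_Iic, measureReal_sdiff (Iic_subset_Iic.2 hst) measurableSet_Iic]

/-- `∫_{-∞}^t e^{-is(Δ - 1/r²)} f(s) ds`. -/
def partialDual (t : ℝ) (f : DualSpace) : RadialL2 := evolveDual (cut (Iic t) f)

theorem partialDual_add (t : ℝ) (f g : DualSpace) :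
    partialDual t (f + g) = partialDual t f + partialDual t g := by
  rw [partialDual, cut_add, map_add]; rfl

theorem partialDual_sub (t : ℝ) (f g : DualSpace) :
    partialDual t (f - g) = partialDual t f - partialDual t g := by
  rw [partialDual, cut_sub, map_sub]; rfl

theorem partialDual_sub_partialDual {s t : ℝ} (hst : s ≤ t) (f : DualSpace) :
    partialDual t f - partialDual s f = evolveDual (cut (Ioc s t) f) := by
  rw [partialDual, partialDual, ← map_sub,
    cut_sub_cut measurableSet_Iic measurableSet_Iic (Iic_subset_Iic.2 hst), Iic_sdiff_Iic]

theorem norm_partialDual_le (t : ℝ) (f : DualSpace) : ‖partialDual t f‖ ≤ 2 * ‖f‖ := by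
  refine (norm_evolveDual_le _).trans ?_
  gcongr
  exact norm_cut_le four_thirds_ne_top _ _

/-- The increment over (s, t] is controlled by the L^{4/3} norm of f on that slab, the power 3/4 of
the mass there, which is continuous in the endpoints. -/
theorem continuous_partialDual (f : DualSpace) : Continuous fun t => partialDual t f := by
  set m : ℝ → ℝ := fun t => (timeMeasure f).real (Iic t) with hm
  have hmc : Continuous m := continuous_measureReal_Iic _
  have key : ∀ s t, s ≤ t → ‖partialDual t f - partialDual s f‖ ≤ 2 * |m t - m s| ^ (3 / 4 : ℝ) := by
    intro s t hst
    rw [partialDual_sub_partialDual hst]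
    refine (norm_evolveDual_le _).trans ?_
    rw [norm_cut_eq f measurableSet_Ioc, measureReal_Ioc_eq _ hst]
    gcongr
    · have : m s ≤ m t := measureReal_mono (Iic_subset_Iic.2 hst)
      exact sub_nonneg.2 this
    · exact le_abs_self _
  have key' : ∀ s t, ‖partialDual t f - partialDual s f‖ ≤ 2 * |m t - m s| ^ (3 / 4 : ℝ) := by
    intro s t
    rcases le_total s t with h | h
    · exact key s t h
    · rw [norm_sub_rev, abs_sub_comm]
      exact key t s h
  rw [continuous_iff_continuousAt]
  intro s
  rw [ContinuousAt, tendsto_iff_norm_sub_tendsto_zero]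
  refine squeeze_zero (fun _ => norm_nonneg _) (fun t => key' s t) ?_
  have hc : Continuous fun t => 2 * |m t - m s| ^ (3 / 4 : ℝ) :=
    continuous_const.mul (((hmc.sub continuous_const).abs).rpow_const fun _ => Or.inr (by norm_num))
  have := hc.tendsto s
  simpa using this

theorem enorm_le_ofReal_mul_iff {E F : Type*} [SeminormedAddCommGroup E] [SeminormedAddCommGroup F]
    {x : E} {y : F} {c : ℝ} (hc : 0 ≤ c) :
    ‖x‖ₑ ≤ ENNReal.ofReal c * ‖y‖ₑ ↔ ‖x‖ ≤ c * ‖y‖ := by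
  rw [← ofReal_norm, ← ofReal_norm, ← ENNReal.ofReal_mul hc,
    ENNReal.ofReal_le_ofReal_iff (by positivity)]

/-- Paths that follow one of finitely many free evolutions at each time. -/
theorem stronglyMeasurable_flow_select {β : ℝ → ℕ} (hβ : Measurable β) {N : ℕ}
    (hN : ∀ t, β t < N) (g : ℕ → RadialL2) :
    StronglyMeasurable fun t => flow t (g (β t)) := by
  have h : (fun t => flow t (g (β t))) = fun t => ∑ j ∈ Finset.range N,
      ({t | β t = j}).indicator (fun t => flow t (g j)) t := by
    ext1 t
    rw [Finset.sum_eq_single_of_mem (β t) (Finset.mem_range.2 (hN t))]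
    · simp
    · intro j _ hj
      exact indicator_of_notMem (fun h => hj h.symm) _
  rw [h]
  refine Finset.stronglyMeasurable_fun_sum _ fun j _ => ?_
  exact (stronglyMeasurable_flow (g j)).indicator (hβ (measurableSet_singleton j))

/-- At each time the selected term is at most the sum of all of them. The crude sum is affordable
because the summands used later decay faster than their number grows. -/
theorem scatteringSize_flow_select_le {β : ℝ → ℕ} {N : ℕ}
    (hN : ∀ t, β t < N) (g : ℕ → RadialL2) :
    scatteringSize univ (fun t => flow t (g (β t))) ≤
      ∑ j ∈ Finset.range N, (2 * ‖g j‖ₑ) ^ 4 := by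
  have hm : ∀ j, Measurable fun t => ∫⁻ r, ‖flow t (g j) r‖ₑ ^ 4 ∂radialMeasure := fun j =>
    (LowerSemicontinuous.comp (lowerSemicontinuous_lintegral_pow_four radialMeasure)
      (continuous_flow (g j))).measurable
  calc scatteringSize univ (fun t => flow t (g (β t)))
      ≤ ∫⁻ t, ∑ j ∈ Finset.range N, ∫⁻ r, ‖flow t (g j) r‖ₑ ^ 4 ∂radialMeasure := by
        rw [scatteringSize, Measure.restrict_univ]
        refine lintegral_mono fun t => ?_
        exact Finset.single_le_sum
          (f := fun j => ∫⁻ r, ‖flow t (g j) r‖ₑ ^ 4 ∂radialMeasure)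
          (fun _ _ => zero_le) (Finset.mem_range.2 (hN t))
    _ = ∑ j ∈ Finset.range N, ∫⁻ t, ∫⁻ r, ‖flow t (g j) r‖ₑ ^ 4 ∂radialMeasure :=
        lintegral_finsetSum _ fun j _ => hm j
    _ ≤ _ := Finset.sum_le_sum fun j _ => strichartz_flow (g j)

/-! ### Christ–Kiselev argument for the retarded integral -/

section ChristKiselev

variable (f : DualSpace)

/-- Half of the normalized mass of `f` up to time `t`. -/
def massFraction (t : ℝ) : ℝ := (timeMeasure f).real (Iic t) / (2 * (timeMeasure f).real univ)

/-- The index of the interval of length `2⁻ⁿ` containing the mass fraction at time `t`. -/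
def massBin (n : ℕ) (t : ℝ) : ℕ := ⌊2 ^ n * massFraction f t⌋₊

theorem massFraction_nonneg (t : ℝ) : 0 ≤ massFraction f t := by
  unfold massFraction; positivity

/-- The factor 2 in the denominator gives strictness, so at level n the bins are exactly the indices
below 2ⁿ. For f = 0 the fraction is 0/0 = 0. -/
theorem massFraction_lt_one (t : ℝ) : massFraction f t < 1 := by
  unfold massFraction
  rcases eq_or_lt_of_le (measureReal_nonneg (μ := timeMeasure f) (s := univ)) with h | h
  · rw [← h]; simp
  · rw [div_lt_one (by positivity)]
    have : (timeMeasure f).real (Iic t) ≤ (timeMeasure f).real univ :=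
      measureReal_mono (subset_univ _)
    linarith

theorem monotone_massFraction : Monotone (massFraction f) := by
  intro s t hst
  unfold massFraction
  have : (timeMeasure f).real (Iic s) ≤ (timeMeasure f).real (Iic t) :=
    measureReal_mono (Iic_subset_Iic.2 hst)
  gcongr

theorem monotone_massBin (n : ℕ) : Monotone (massBin f n) := fun s t hst =>
  Nat.floor_mono (by gcongr; exact monotone_massFraction f hst)

theorem massBin_lt (n : ℕ) (t : ℝ) : massBin f n t < 2 ^ n := by
  rw [massBin, Nat.floor_lt (by have := massFraction_nonneg f t; positivity)]
  have := massFraction_lt_one f t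
  push_cast
  exact mul_lt_of_lt_one_right (by positivity) this

theorem massBin_zero (t : ℝ) : massBin f 0 t = 0 := by
  have := massBin_lt f 0 t
  simpa using this

theorem massBin_succ_div_two (n : ℕ) (t : ℝ) : massBin f (n + 1) t / 2 = massBin f n t := by
  rw [massBin, massBin, ← Nat.floor_div_ofNat]
  congr 1
  ring

theorem measurable_massBin (n : ℕ) : Measurable (massBin f n) := (monotone_massBin f n).measurable

theorem measurableSet_massBin_eq (n j : ℕ) : MeasurableSet {s | massBin f n s = j} :=
  measurable_massBin f n (measurableSet_singleton j)

theorem measurableSet_massBin_lt (n j : ℕ) : MeasurableSet {s | massBin f n s < j} :=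
  measurable_massBin f n measurableSet_Iio

/-- The mass fraction varies by at most 2⁻ⁿ across a bin. A bin need not contain its endpoints, so
compact subsets are used, whose extreme points do lie in the bin. -/
theorem measureReal_massBin_le (n j : ℕ) :
    (timeMeasure f).real {s | massBin f n s = j} ≤
      2 * (timeMeasure f).real univ / 2 ^ n := by
  set μ := timeMeasure f with hμ
  rcases eq_or_lt_of_le (measureReal_nonneg (μ := μ) (s := univ)) with h | hM
  · have : μ.real {s | massBin f n s = j} ≤ μ.real univ := measureReal_mono (subset_univ _)
    rw [← h] at this ⊢
    simpa using this
  rw [measureReal_def]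
  refine ENNReal.toReal_le_of_le_ofReal (by positivity) ?_
  rw [MeasurableSet.measure_eq_iSup_isCompact (measurableSet_massBin_eq f n j)]
  refine iSup_le fun K => iSup_le fun hK => iSup_le fun hKc => ?_
  rcases K.eq_empty_or_nonempty with rfl | hne
  · simp
  have hs : massBin f n (sInf K) = j := hK (hKc.sInf_mem hne)
  have ht : massBin f n (sSup K) = j := hK (hKc.sSup_mem hne)
  have hst : sInf K ≤ sSup K := csInf_le_csSup hne hKc.bddBelow hKc.bddAbove
  have hKsub : K ⊆ Icc (sInf K) (sSup K) := fun x hx =>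
    ⟨csInf_le hKc.bddBelow hx, le_csSup hKc.bddAbove hx⟩
  have h1 : μ K ≤ μ (Ioc (sInf K) (sSup K)) :=
    (measure_mono hKsub).trans_eq (measure_congr (Ioc_ae_eq_Icc (μ := μ))).symm
  refine h1.trans ?_
  rw [← ofReal_measureReal, measureReal_Ioc_eq _ hst]
  apply ENNReal.ofReal_le_ofReal
  have h2 := Nat.floor_le (by have := massFraction_nonneg f (sInf K); positivity :
    0 ≤ 2 ^ n * massFraction f (sInf K))
  have h3 := Nat.lt_floor_add_one (2 ^ n * massFraction f (sSup K))
  rw [← massBin, hs] at h2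
  rw [← massBin, ht] at h3
  have h4 : 2 ^ n * massFraction f (sSup K) - 2 ^ n * massFraction f (sInf K) ≤ 1 := by linarith
  rw [massFraction, massFraction, ← mul_sub, ← sub_div, ← mul_div_assoc,
    div_le_one (by positivity)] at h4
  rw [le_div_iff₀ (by positivity), mul_comm]
  exact h4

/-- The dyadic approximation of the retarded integral. -/
def dyadicRetarded (n : ℕ) (t : ℝ) : RadialL2 :=
  flow t (evolveDual (cut {s | massBin f n s < massBin f n t} f))

/-- The contribution of the left neighbour of an odd interval. -/
def dyadicIncrement (n j : ℕ) : RadialL2 :=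
  if Odd j then evolveDual (cut {s | massBin f n s = j - 1} f) else 0

theorem dyadicRetarded_zero (t : ℝ) : dyadicRetarded f 0 t = 0 := by
  rw [dyadicRetarded]
  have : {s | massBin f 0 s < massBin f 0 t} = ∅ := by
    ext s; simp [massBin_zero]
  rw [this, cut_empty, map_zero, map_zero]

/-- Refining the bins changes the condition "s lies in an earlier bin than t" only when t is in the
right half of its old bin, that is, when its new index is odd. The added times are those in the left
sibling. -/
theorem dyadicRetarded_succ (n : ℕ) (t : ℝ) :
    dyadicRetarded f (n + 1) t = dyadicRetarded f n t +
      flow t (dyadicIncrement f (n + 1) (massBin f (n + 1) t)) := by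
  rw [dyadicRetarded, dyadicRetarded, ← map_add]
  congr 1
  have ht := massBin_succ_div_two f n t
  set j := massBin f (n + 1) t with hj
  rcases Nat.even_or_odd j with he | ho
  · rw [dyadicIncrement, if_neg (Nat.not_odd_iff_even.2 he), add_zero]
    congr 2
    ext s
    have hs := massBin_succ_div_two f n s
    obtain ⟨i, hi⟩ := he
    simp only [mem_ofPred_eq]
    omega
  · rw [dyadicIncrement, if_pos ho, ← map_add, ← cut_union (measurableSet_massBin_lt f n _)
      (measurableSet_massBin_eq f (n + 1) _)]
    · congr 2
      ext s
      have hs := massBin_succ_div_two f n s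
      obtain ⟨i, hi⟩ := ho
      simp only [mem_ofPred_eq, mem_union]
      omega
    · rw [disjoint_left]
      intro s h1 h2
      have hs := massBin_succ_div_two f n s
      obtain ⟨i, hi⟩ := ho
      simp only [mem_ofPred_eq] at h1 h2
      omega

/-- The constant is 256 = (2·2)⁴, from the selection bound and the norm of `evolveDual`; the fourth
power of the L^{4/3} norm is the cube of the mass. -/
theorem enorm_dyadicIncrement_le (n j : ℕ) :
    (2 * ‖dyadicIncrement f n j‖ₑ) ^ 4 ≤
      ENNReal.ofReal (256 * (2 * (timeMeasure f).real univ / 2 ^ n) ^ 3) := by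
  have h : (2 * ‖dyadicIncrement f n j‖) ^ 4 ≤
      256 * (2 * (timeMeasure f).real univ / 2 ^ n) ^ 3 := by
    rw [dyadicIncrement]
    split_ifs with hj
    · have h1 := norm_evolveDual_le (cut {s | massBin f n s = j - 1} f)
      calc (2 * ‖evolveDual (cut {s | massBin f n s = j - 1} f)‖) ^ 4
          ≤ (2 * (2 * ‖cut {s | massBin f n s = j - 1} f‖)) ^ 4 := by gcongr
        _ = 256 * ‖cut {s | massBin f n s = j - 1} f‖ ^ 4 := by ring
        _ ≤ _ := by
          rw [pow_four_norm_cut f (measurableSet_massBin_eq f n _)]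
          gcongr
          exact measureReal_massBin_le f n _
    · rw [norm_zero]
      simp only [mul_zero, ne_eq, OfNat.ofNat_ne_zero, not_false_eq_true, zero_pow]
      positivity
  refine le_trans (le_of_eq ?_) (ENNReal.ofReal_le_ofReal h)
  rw [ENNReal.ofReal_pow (by positivity), ENNReal.ofReal_mul (by norm_num), ofReal_norm]
  norm_num

/-- There are 2ⁿ bins, each contributing 256(2M/2ⁿ)³ to the fourth power, where M is the total mass
of f. The total, 2048·4⁻ⁿM³, decays because 4 exceeds 4/3. The rate (3/4)ⁿ is a convenient upper
bound: 1/4 ≤ (3/4)⁴ and 2048 ≤ 8⁴. -/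
theorem exists_isVersion_dyadicIncrement (n : ℕ) :
    ∃ x : StrichartzSpace,
      IsVersion x (fun t => flow t (dyadicIncrement f n (massBin f n t))) ∧
      ‖x‖ ≤ 8 * (3 / 4) ^ n * ‖f‖ := by
  have hM : ‖f‖ ^ (4 : ℕ) = (timeMeasure f).real univ ^ 3 := by
    rw [← pow_four_norm_cut f MeasurableSet.univ, cut_univ]
  have hsize : scatteringSize univ (fun t => flow t (dyadicIncrement f n (massBin f n t))) ≤
      ENNReal.ofReal ((8 * (3 / 4) ^ n * ‖f‖) ^ 4) := by
    refine (scatteringSize_flow_select_le (massBin_lt f n) (dyadicIncrement f n)).trans ?_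
    refine (Finset.sum_le_sum fun j _ => enorm_dyadicIncrement_le f n j).trans ?_
    rw [Finset.sum_const, Finset.card_range, nsmul_eq_mul,
      ← ENNReal.ofReal_natCast, ← ENNReal.ofReal_mul (by positivity)]
    apply ENNReal.ofReal_le_ofReal
    rw [mul_pow (8 * (3 / 4) ^ n : ℝ), hM]
    have h2 : (2 : ℝ) ^ n ≠ 0 := by positivity
    have h3 : ((2 ^ n : ℕ) : ℝ) * (256 * (2 * (timeMeasure f).real univ / 2 ^ n) ^ 3) =
        2048 * ((1 / 4) ^ n * (timeMeasure f).real univ ^ 3) := by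
      have : (1 / 4 : ℝ) ^ n = 1 / (2 ^ n * 2 ^ n) := by
        rw [← mul_pow, one_div_pow]; norm_num
      rw [this]
      push_cast
      field_simp
      ring
    have h4 : (8 * (3 / 4 : ℝ) ^ n) ^ 4 = 4096 * (81 / 256) ^ n := by
      rw [mul_pow, ← pow_mul, mul_comm n 4, pow_mul]
      norm_num
    rw [h3, h4]
    have h5 : (1 / 4 : ℝ) ^ n ≤ (81 / 256) ^ n :=
      pow_le_pow_left₀ (by norm_num) (by norm_num) n
    have h6 : (0 : ℝ) ≤ (timeMeasure f).real univ ^ 3 := by positivity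
    have h7 : (0 : ℝ) ≤ (81 / 256 : ℝ) ^ n := by positivity
    nlinarith [mul_le_mul_of_nonneg_right h5 h6, mul_nonneg h7 h6]
  obtain ⟨x, hx⟩ := exists_isVersion
    (stronglyMeasurable_flow_select (measurable_massBin f n) (massBin_lt f n) (dyadicIncrement f n))
    (hsize.trans_lt ENNReal.ofReal_lt_top)
  refine ⟨x, hx, ?_⟩
  rw [← hx.enorm_pow_four, ← ofReal_norm, ← ENNReal.ofReal_pow (norm_nonneg _),
    ENNReal.ofReal_le_ofReal_iff (by positivity)] at hsize
  exact (pow_le_pow_iff_left₀ (norm_nonneg _) (by positivity) (by norm_num)).1 hsize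

/-- The increments telescope: the sum of 8(3/4)^k over 1 ≤ k ≤ n is 24(1 − (3/4)ⁿ). -/
theorem exists_isVersion_dyadicRetarded (n : ℕ) :
    ∃ x : StrichartzSpace, IsVersion x (dyadicRetarded f n) ∧
      ‖x‖ ≤ 24 * (1 - (3 / 4) ^ n) * ‖f‖ := by
  induction n with
  | zero =>
    refine ⟨0, ?_, by simp⟩
    have h0 : dyadicRetarded f 0 = fun _ => 0 := funext (dyadicRetarded_zero f)
    rw [h0]
    filter_upwards [ae_slices (Lp.coeFn_zero ℂ 4 spacetime)] with t ht
    filter_upwards [ht, Lp.coeFn_zero ℂ 2 radialMeasure] with r h1 h2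
    rw [h1, h2]
    rfl
  | succ n ih =>
    obtain ⟨x, hx, hxn⟩ := ih
    obtain ⟨y, hy, hyn⟩ := exists_isVersion_dyadicIncrement f (n + 1)
    refine ⟨x + y, ?_, ?_⟩
    · have h0 : dyadicRetarded f (n + 1) = fun t => dyadicRetarded f n t +
        flow t (dyadicIncrement f (n + 1) (massBin f (n + 1) t)) := funext (dyadicRetarded_succ f n)
      rw [h0]
      exact hx.add hy
    · refine (norm_add_le _ _).trans ((add_le_add hxn hyn).trans_eq ?_)
      ring

/-- What the approximation omits from (−∞, t] lies in the bin of t, whose mass is O(2⁻ⁿ). -/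
theorem tendsto_dyadicRetarded (t : ℝ) :
    Tendsto (fun n => dyadicRetarded f n t) atTop (𝓝 (flow t (partialDual t f))) := by
  refine ((flow t).continuous.tendsto _).comp ?_
  refine ((evolveDual.continuous).tendsto (cut (Iic t) f)).comp ?_
  rw [tendsto_iff_norm_sub_tendsto_zero]
  refine squeeze_zero (g := fun n => (2 * (timeMeasure f).real univ / 2 ^ n) ^ (3 / 4 : ℝ))
    (fun _ => norm_nonneg _) (fun n => ?_) ?_
  · have hsub : {s | massBin f n s < massBin f n t} ⊆ Iic t := by
      intro s hs
      by_contra h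
      exact absurd (monotone_massBin f n (le_of_lt (not_le.1 h))) (not_le.2 hs)
    have hme := measurableSet_massBin_lt f n (massBin f n t)
    rw [norm_sub_rev, cut_sub_cut hme measurableSet_Iic hsub,
      norm_cut_eq f (measurableSet_Iic.diff hme)]
    gcongr
    refine le_trans (measureReal_mono ?_) (measureReal_massBin_le f n (massBin f n t))
    intro s hs
    exact le_antisymm (monotone_massBin f n hs.1) (not_lt.1 hs.2)
  · have h1 : Tendsto (fun n : ℕ => 2 * (timeMeasure f).real univ / 2 ^ n) atTop (𝓝 0) :=
      tendsto_const_nhds.div_atTop (tendsto_pow_atTop_atTop_of_one_lt (by norm_num))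
    have h2 := h1.rpow_const (p := 3 / 4) (Or.inr (by norm_num))
    simpa using h2

/-- The uniform bound on the dyadic approximations passes to the limit by lower semicontinuity at
each time and Fatou in time. -/
theorem scatteringSize_retarded_le :
    scatteringSize univ (fun t => flow t (partialDual t f)) ≤ (ENNReal.ofReal 24 * ‖f‖ₑ) ^ 4 := by
  choose x hx hxn using exists_isVersion_dyadicRetarded f
  have hxb : ∀ n, ∫⁻ t, ∫⁻ r, ‖x n (t, r)‖ₑ ^ 4 ∂radialMeasure ≤ (ENNReal.ofReal 24 * ‖f‖ₑ) ^ 4 := by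
    intro n
    rw [← enorm_pow_four]
    gcongr
    have h1 : ‖x n‖ ≤ 24 * ‖f‖ := (hxn n).trans (by
      gcongr
      have : (0 : ℝ) ≤ (3 / 4) ^ n := by positivity
      linarith)
    exact (enorm_le_ofReal_mul_iff (by norm_num)).2 h1
  rw [scatteringSize, Measure.restrict_univ]
  calc ∫⁻ t, ∫⁻ r, ‖flow t (partialDual t f) r‖ₑ ^ 4 ∂radialMeasure
      ≤ ∫⁻ t, liminf (fun n => ∫⁻ r, ‖x n (t, r)‖ₑ ^ 4 ∂radialMeasure) atTop := by
        apply lintegral_mono_ae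
        filter_upwards [ae_all_iff.2 hx] with t ht
        refine (lintegral_pow_four_le_liminf (tendsto_dyadicRetarded f t)).trans_eq ?_
        congr 1
        ext n
        apply lintegral_congr_ae
        filter_upwards [ht n] with r hr
        rw [hr]
    _ ≤ liminf (fun n => ∫⁻ t, ∫⁻ r, ‖x n (t, r)‖ₑ ^ 4 ∂radialMeasure) atTop :=
        lintegral_liminf_le fun n =>
          ((Lp.stronglyMeasurable (x n)).measurable.enorm.pow_const 4).lintegral_prod_right'
    _ ≤ _ := liminf_le_of_frequently_le' (Frequently.of_forall hxb)

end ChristKiselev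

/-! ### The Duhamel operator based at t₀ -/

theorem continuous_uncurry_flow : Continuous fun z : ℝ × RadialL2 => flow z.1 z.2 := by
  rw [continuous_iff_continuousAt]
  rintro ⟨t, q⟩
  rw [ContinuousAt, tendsto_iff_norm_sub_tendsto_zero]
  have h1 : Tendsto (fun z : ℝ × RadialL2 => ‖z.2 - q‖ + ‖flow z.1 q - flow t q‖) (𝓝 (t, q))
      (𝓝 0) := by
    have hcc : Continuous fun z : ℝ × RadialL2 => ‖z.2 - q‖ + ‖flow z.1 q - flow t q‖ :=
      ((continuous_snd.sub continuous_const).norm).add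
        ((((continuous_flow q).comp continuous_fst).sub continuous_const).norm)
    have := hcc.tendsto (t, q)
    simpa using this
  refine squeeze_zero (fun _ => norm_nonneg _) (fun z => ?_) h1
  have : flow z.1 z.2 - flow t q = flow z.1 (z.2 - q) + (flow z.1 q - flow t q) := by
    rw [map_sub]; abel
  rw [this]
  refine (norm_add_le _ _).trans ?_
  rw [norm_flow]

theorem continuous_flow_comp {g : ℝ → RadialL2} (hg : Continuous g) :
    Continuous fun t => flow t (g t) :=
  Continuous.comp (g := fun z : ℝ × RadialL2 => flow z.1 z.2) (f := fun t => (t, g t))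
    continuous_uncurry_flow (Continuous.prodMk continuous_id hg)

/-- The integral from t₀ is the retarded one minus a free wave, whence 28 = 24 + 2·2. -/
theorem exists_isVersion_duhamel (t₀ : ℝ) (f : DualSpace) :
    ∃ x : StrichartzSpace,
      IsVersion x (fun t => flow t (partialDual t f - partialDual t₀ f)) ∧ ‖x‖ ≤ 28 * ‖f‖ := by
  have hc := continuous_flow_comp (continuous_partialDual f)
  have hs := scatteringSize_retarded_le f
  obtain ⟨x, hx⟩ := exists_isVersion hc.stronglyMeasurable (hs.trans_lt
    (ENNReal.pow_lt_top (ENNReal.mul_lt_top ENNReal.ofReal_lt_top enorm_lt_top)))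
  refine ⟨x - evolve (partialDual t₀ f), ?_, ?_⟩
  · have := hx.sub (isVersion_evolve (partialDual t₀ f))
    simp_rw [← map_sub] at this
    exact this
  · rw [← hx.enorm_pow_four] at hs
    have h1 := enorm_le_of_pow_four_le hs
    rw [enorm_le_ofReal_mul_iff (by norm_num)] at h1
    have h2 := norm_evolve_le (partialDual t₀ f)
    have h3 := norm_partialDual_le t₀ f
    refine (norm_sub_le _ _).trans ?_
    linarith

/-- The Duhamel operator `f ↦ ∫_{t₀}^t e^{i(t-s)(Δ - 1/r²)} f(s) ds`. -/
def duhamel (t₀ : ℝ) (f : DualSpace) : StrichartzSpace := (exists_isVersion_duhamel t₀ f).choose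

theorem isVersion_duhamel (t₀ : ℝ) (f : DualSpace) :
    IsVersion (duhamel t₀ f) (fun t => flow t (partialDual t f - partialDual t₀ f)) :=
  (exists_isVersion_duhamel t₀ f).choose_spec.1

theorem norm_duhamel_le (t₀ : ℝ) (f : DualSpace) : ‖duhamel t₀ f‖ ≤ 28 * ‖f‖ :=
  (exists_isVersion_duhamel t₀ f).choose_spec.2

theorem duhamel_add (t₀ : ℝ) (f g : DualSpace) :
    duhamel t₀ (f + g) = duhamel t₀ f + duhamel t₀ g := by
  refine (isVersion_duhamel t₀ (f + g)).unique ?_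
  have := (isVersion_duhamel t₀ f).add (isVersion_duhamel t₀ g)
  simp_rw [← map_add] at this
  simp_rw [partialDual_add, add_sub_add_comm]
  exact this

theorem duhamel_sub (t₀ : ℝ) (f g : DualSpace) :
    duhamel t₀ (f - g) = duhamel t₀ f - duhamel t₀ g := by
  have := duhamel_add t₀ (f - g) g
  rw [sub_add_cancel] at this
  rw [this, add_sub_cancel_right]

/-! ### The nonlinearity -/

/-- The Hardy operator `g ↦ ∫_r^∞ g(ρ) dρ/ρ`. -/
def hardy (g : ℝ → ℝ≥0∞) (r : ℝ) : ℝ≥0∞ := ∫⁻ ρ in Ioi r, g ρ * ENNReal.ofReal ρ⁻¹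

theorem lintegral_inv_sq {r : ℝ} (hr : 0 < r) :
    ∫⁻ ρ in Ioi r, ENNReal.ofReal ρ⁻¹ ^ (2 : ℝ) = ENNReal.ofReal r⁻¹ := by
  have h1 : ∀ ρ ∈ Ioi r, ENNReal.ofReal ρ⁻¹ ^ (2 : ℝ) = ENNReal.ofReal (ρ ^ (-2 : ℝ)) := by
    intro ρ hρ
    have hρ0 : 0 < ρ := hr.trans hρ
    rw [ENNReal.ofReal_rpow_of_pos (inv_pos.2 hρ0), Real.inv_rpow hρ0.le, Real.rpow_neg hρ0.le]
  rw [setLIntegral_congr_fun measurableSet_Ioi h1, ← ofReal_integral_eq_lintegral_ofReal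
    (integrableOn_Ioi_rpow_of_lt (by norm_num) hr), integral_Ioi_rpow_of_lt (by norm_num) hr]
  · norm_num
    rw [Real.rpow_neg hr.le, Real.rpow_one]
  · filter_upwards [ae_restrict_mem measurableSet_Ioi] with ρ hρ
    exact Real.rpow_nonneg (hr.trans hρ).le _

/-- Cauchy–Schwarz against ρ⁻¹, with ∫_r^∞ ρ⁻² dρ = 1/r. -/
theorem hardy_sq_le {g : ℝ → ℝ≥0∞} (hg : Measurable g) {r : ℝ} (hr : 0 < r) :
    hardy g r ^ (2 : ℝ) ≤ (∫⁻ ρ in Ioi r, g ρ ^ (2 : ℝ)) * ENNReal.ofReal r⁻¹ := by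
  have h := ENNReal.lintegral_mul_le_Lp_mul_Lq (volume.restrict (Ioi r))
    Real.HolderConjugate.two_two hg.aemeasurable
    (g := fun ρ => ENNReal.ofReal ρ⁻¹) (by fun_prop)
  rw [lintegral_inv_sq hr] at h
  calc hardy g r ^ (2 : ℝ) ≤ _ := ENNReal.rpow_le_rpow h (by norm_num)
    _ = _ := by
      rw [ENNReal.mul_rpow_of_nonneg _ _ (by norm_num), ← ENNReal.rpow_mul, ← ENNReal.rpow_mul]
      norm_num

/-- The weight r cancels the 1/r of `hardy_sq_le`. Tonelli then gives ∫ g(ρ)² |(0, ρ)| dρ, which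
restores the weight, so the bound holds with constant one. -/
theorem lintegral_hardy_sq_le {g : ℝ → ℝ≥0∞} (hg : Measurable g) (hgm : Measurable (hardy g)) :
    ∫⁻ r, hardy g r ^ (2 : ℝ) ∂radialMeasure ≤ ∫⁻ r, g r ^ (2 : ℝ) ∂radialMeasure := by
  have hg2 : Measurable fun r => g r ^ (2 : ℝ) := hg.pow_const _
  rw [lintegral_radialMeasure _ (hgm.pow_const _), lintegral_radialMeasure _ hg2]
  calc ∫⁻ r in Ioi (0 : ℝ), ENNReal.ofReal r * hardy g r ^ (2 : ℝ)
      ≤ ∫⁻ r in Ioi (0 : ℝ), ∫⁻ ρ in Ioi r, g ρ ^ (2 : ℝ) := by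
        refine setLIntegral_mono' measurableSet_Ioi fun r (hr : 0 < r) => ?_
        calc ENNReal.ofReal r * hardy g r ^ (2 : ℝ)
            ≤ ENNReal.ofReal r * ((∫⁻ ρ in Ioi r, g ρ ^ (2 : ℝ)) * ENNReal.ofReal r⁻¹) := by
              gcongr; exact hardy_sq_le hg hr
          _ = _ := by
              rw [mul_comm, mul_assoc, ← ENNReal.ofReal_mul (inv_pos.2 hr).le,
                inv_mul_cancel₀ hr.ne', ENNReal.ofReal_one, mul_one]
    _ = ∫⁻ r in Ioi (0 : ℝ), ∫⁻ ρ, (Ioi r).indicator (fun ρ => g ρ ^ (2 : ℝ)) ρ := by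
        simp_rw [lintegral_indicator measurableSet_Ioi]
    _ = ∫⁻ ρ, ∫⁻ r in Ioi (0 : ℝ), (Ioi r).indicator (fun ρ => g ρ ^ (2 : ℝ)) ρ := by
        rw [lintegral_lintegral_swap]
        refine Measurable.aemeasurable ?_
        exact (hg2.comp measurable_snd).indicator
          (measurableSet_lt measurable_fst measurable_snd)
    _ = ∫⁻ ρ, ENNReal.ofReal ρ * g ρ ^ (2 : ℝ) := by
        refine lintegral_congr fun ρ => ?_
        have : ∀ r, (Ioi r).indicator (fun ρ => g ρ ^ (2 : ℝ)) ρ =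
            (Iio ρ).indicator (fun _ => g ρ ^ (2 : ℝ)) r := by
          intro r
          by_cases h : r < ρ <;> simp [h]
        simp_rw [this]
        rw [lintegral_indicator measurableSet_Iio, Measure.restrict_restrict measurableSet_Iio,
          lintegral_const, Measure.restrict_apply_univ, mul_comm, inter_comm, Ioi_inter_Iio,
          Real.volume_Ioo, sub_zero]
    _ = ∫⁻ r in Ioi (0 : ℝ), ENNReal.ofReal r * g r ^ (2 : ℝ) := by
        rw [← lintegral_indicator measurableSet_Ioi]
        refine lintegral_congr fun ρ => ?_
        by_cases h : 0 < ρ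
        · simp [h]
        · simp [h, ENNReal.ofReal_of_nonpos (not_lt.1 h)]

/-- The Hardy operator acting in the radial variable of space-time functions. -/
def spaceHardy (g : ℝ × ℝ → ℝ≥0∞) (z : ℝ × ℝ) : ℝ≥0∞ := hardy (fun r => g (z.1, r)) z.2

theorem measurable_spaceHardy {g : ℝ × ℝ → ℝ≥0∞} (hg : Measurable g) :
    Measurable (spaceHardy g) := by
  have h : Measurable fun w : (ℝ × ℝ) × ℝ => {w : (ℝ × ℝ) × ℝ | w.1.2 < w.2}.indicator
      (fun w => g (w.1.1, w.2) * ENNReal.ofReal w.2⁻¹) w := by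
    refine Measurable.indicator ?_ (measurableSet_lt (by fun_prop) measurable_snd)
    exact (hg.comp (by fun_prop)).mul (by fun_prop)
  have h2 := h.lintegral_prod_right' (ν := (volume : Measure ℝ))
  have h3 : ∀ z : ℝ × ℝ, (∫⁻ ρ, {w : (ℝ × ℝ) × ℝ | w.1.2 < w.2}.indicator
      (fun w => g (w.1.1, w.2) * ENNReal.ofReal w.2⁻¹) (z, ρ)) = spaceHardy g z := by
    intro z
    rw [spaceHardy, hardy, ← lintegral_indicator measurableSet_Ioi]
    rfl
  simp_rw [h3] at h2
  exact h2

theorem eLpNorm'_spaceHardy_le {g : ℝ × ℝ → ℝ≥0∞} (hg : Measurable g) :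
    eLpNorm' (spaceHardy g) 2 spacetime ≤ eLpNorm' g 2 spacetime := by
  simp only [eLpNorm', enorm_eq_self]
  gcongr ?_ ^ _
  have hm := measurable_spaceHardy hg
  rw [lintegral_prod _ (hm.pow_const _).aemeasurable,
    lintegral_prod _ (hg.pow_const _).aemeasurable]
  refine lintegral_mono fun t => ?_
  exact lintegral_hardy_sq_le (hg.comp measurable_prodMk_left) (hm.comp measurable_prodMk_left)

theorem eLpNorm'_spaceHardy_add_le {g : ℝ × ℝ → ℝ≥0∞} (hg : Measurable g) :
    eLpNorm' (spaceHardy g + g) 2 spacetime ≤ 2 * eLpNorm' g 2 spacetime := by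
  refine (eLpNorm'_add_le (measurable_spaceHardy hg).aestronglyMeasurable
    hg.aestronglyMeasurable (by norm_num)).trans ?_
  rw [two_mul]
  gcongr
  exact eLpNorm'_spaceHardy_le hg

theorem eLpNorm'_mul_le {p q r : ℝ} (hp : 0 < p) (hpq : p < q) (hpqr : 1 / p = 1 / q + 1 / r)
    {f g : ℝ × ℝ → ℝ≥0∞} (hf : Measurable f) (hg : Measurable g) :
    eLpNorm' (f * g) p spacetime ≤ eLpNorm' f q spacetime * eLpNorm' g r spacetime := by
  simp only [eLpNorm', enorm_eq_self]
  exact ENNReal.lintegral_Lp_mul_le_Lq_mul_Lr hp hpq hpqr _ hf.aemeasurable hg.aemeasurable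

/-! ### Difference estimates for the nonlinearity -/

variable (K lam : ℝ)

/-- The potential of q multiplies q − p, and the difference of potentials multiplies p; both are
bounded through |q| + |p| and |q − p|. Finiteness of the Hardy term makes the two potential
integrals converge, without which they could not be subtracted under the integral sign. -/
theorem enorm_nonlinearity_sub_le {p q : ℝ → ℂ} (hp : Measurable p) (hq : Measurable q) {r : ℝ}
    (hr : 0 < r) (hfin : hardy (fun ρ => (‖q ρ‖ₑ + ‖p ρ‖ₑ) * (‖q ρ‖ₑ + ‖p ρ‖ₑ)) r ≠ ∞) :
    ‖nonlinearity K lam q r - nonlinearity K lam p r‖ₑ ≤ (‖K‖ₑ + ‖lam‖ₑ) *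
      ((hardy (fun ρ => (‖q ρ‖ₑ + ‖p ρ‖ₑ) * (‖q ρ‖ₑ + ‖p ρ‖ₑ)) r +
          (‖q r‖ₑ + ‖p r‖ₑ) * (‖q r‖ₑ + ‖p r‖ₑ)) * ‖q r - p r‖ₑ +
        (hardy (fun ρ => (‖q ρ‖ₑ + ‖p ρ‖ₑ) * ‖q ρ - p ρ‖ₑ) r +
          (‖q r‖ₑ + ‖p r‖ₑ) * ‖q r - p r‖ₑ) * (‖q r‖ₑ + ‖p r‖ₑ)) := by
  set H := hardy (fun ρ => (‖q ρ‖ₑ + ‖p ρ‖ₑ) * (‖q ρ‖ₑ + ‖p ρ‖ₑ)) r with hH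
  set D := hardy (fun ρ => (‖q ρ‖ₑ + ‖p ρ‖ₑ) * ‖q ρ - p ρ‖ₑ) r with hD
  have henorm : ∀ {u : ℝ → ℂ}, ∀ ρ ∈ Ioi r,
      ‖‖u ρ‖ ^ 2 / ρ‖ₑ = ‖u ρ‖ₑ * ‖u ρ‖ₑ * ENNReal.ofReal ρ⁻¹ := by
    intro u ρ hρ
    rw [div_eq_mul_inv, enorm_mul, enorm_pow, enorm_norm, sq,
      Real.enorm_of_nonneg (inv_nonneg.2 (hr.trans hρ).le)]
  have hbq : ∫⁻ ρ in Ioi r, ‖‖q ρ‖ ^ 2 / ρ‖ₑ ≤ H := by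
    rw [setLIntegral_congr_fun measurableSet_Ioi henorm]
    refine lintegral_mono fun ρ => ?_
    dsimp only
    gcongr <;> exact le_self_add
  have hbp : ∫⁻ ρ in Ioi r, ‖‖p ρ‖ ^ 2 / ρ‖ₑ ≤ H := by
    rw [setLIntegral_congr_fun measurableSet_Ioi henorm]
    refine lintegral_mono fun ρ => ?_
    dsimp only
    gcongr <;> exact le_add_self
  have hiq : IntegrableOn (fun ρ => ‖q ρ‖ ^ 2 / ρ) (Ioi r) :=
    ⟨((hq.norm.pow_const 2).div measurable_id).aestronglyMeasurable,
      hbq.trans_lt (lt_top_iff_ne_top.2 hfin)⟩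
  have hip : IntegrableOn (fun ρ => ‖p ρ‖ ^ 2 / ρ) (Ioi r) :=
    ⟨((hp.norm.pow_const 2).div measurable_id).aestronglyMeasurable,
      hbp.trans_lt (lt_top_iff_ne_top.2 hfin)⟩
  have hsq : ∀ ρ, ‖‖q ρ‖ ^ 2 - ‖p ρ‖ ^ 2‖ₑ ≤ (‖q ρ‖ₑ + ‖p ρ‖ₑ) * ‖q ρ - p ρ‖ₑ := by
    intro ρ
    rw [sq_sub_sq, enorm_mul]
    gcongr
    · exact (enorm_add_le _ _).trans_eq (by simp)
    · rw [Real.enorm_eq_ofReal_abs, ← ofReal_norm]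
      exact ENNReal.ofReal_le_ofReal (abs_norm_sub_norm_le _ _)
  have hdiff : ‖(∫ ρ in Ioi r, ‖q ρ‖ ^ 2 / ρ) - ∫ ρ in Ioi r, ‖p ρ‖ ^ 2 / ρ‖ₑ ≤ D := by
    rw [← integral_sub hiq hip]
    refine (enorm_integral_le_lintegral_enorm _).trans ?_
    refine setLIntegral_mono' measurableSet_Ioi fun ρ hρ => ?_
    rw [← sub_div, div_eq_mul_inv, enorm_mul,
      Real.enorm_of_nonneg (inv_nonneg.2 (hr.trans hρ).le)]
    gcongr
    exact hsq ρ
  set hq' := ∫ ρ in Ioi r, ‖q ρ‖ ^ 2 / ρ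
  set hp' := ∫ ρ in Ioi r, ‖p ρ‖ ^ 2 / ρ
  have hhq : ‖hq'‖ₑ ≤ H := (enorm_integral_le_lintegral_enorm _).trans hbq
  have hhalf : ‖lam / 2‖ₑ ≤ ‖lam‖ₑ := by
    rw [Real.enorm_eq_ofReal_abs, Real.enorm_eq_ofReal_abs]
    refine ENNReal.ofReal_le_ofReal ?_
    rw [abs_div, abs_two]
    linarith [abs_nonneg lam]
  have hcombine : ∀ {x y : ℝ} {A B : ℝ≥0∞}, ‖x‖ₑ ≤ A → ‖y‖ₑ ≤ B →
      ‖K * x - lam / 2 * y‖ₑ ≤ (‖K‖ₑ + ‖lam‖ₑ) * (A + B) := by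
    intro x y A B hx hy
    refine (enorm_sub_le).trans ?_
    rw [enorm_mul, enorm_mul, add_mul]
    gcongr
    · exact hx.trans le_self_add
    · exact hy.trans le_add_self
  have hc1 : ‖K * hq' - lam / 2 * ‖q r‖ ^ 2‖ₑ ≤ (‖K‖ₑ + ‖lam‖ₑ) *
      (H + (‖q r‖ₑ + ‖p r‖ₑ) * (‖q r‖ₑ + ‖p r‖ₑ)) := by
    refine hcombine hhq ?_
    rw [enorm_pow, enorm_norm, sq]
    gcongr <;> exact le_self_add
  have hc2 : ‖(K * hq' - lam / 2 * ‖q r‖ ^ 2) - (K * hp' - lam / 2 * ‖p r‖ ^ 2)‖ₑ ≤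
      (‖K‖ₑ + ‖lam‖ₑ) * (D + (‖q r‖ₑ + ‖p r‖ₑ) * ‖q r - p r‖ₑ) := by
    have : (K * hq' - lam / 2 * ‖q r‖ ^ 2) - (K * hp' - lam / 2 * ‖p r‖ ^ 2) =
      K * (hq' - hp') - lam / 2 * (‖q r‖ ^ 2 - ‖p r‖ ^ 2) := by ring
    rw [this]
    exact hcombine hdiff (hsq r)
  have hdec : nonlinearity K lam q r - nonlinearity K lam p r =
      ((K * hq' - lam / 2 * ‖q r‖ ^ 2 : ℝ) : ℂ) * (q r - p r) +
      (((K * hq' - lam / 2 * ‖q r‖ ^ 2) - (K * hp' - lam / 2 * ‖p r‖ ^ 2) : ℝ) : ℂ) * p r := by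
    rw [nonlinearity, nonlinearity, Complex.ofReal_sub (K * hq' - lam / 2 * ‖q r‖ ^ 2)]
    ring
  have hre : ∀ x : ℝ, ‖(x : ℂ)‖ₑ = ‖x‖ₑ := fun x => by
    rw [← ofReal_norm, Complex.norm_real, ofReal_norm]
  rw [hdec, mul_add]
  refine (enorm_add_le _ _).trans ?_
  rw [enorm_mul, enorm_mul, hre, hre, ← mul_assoc, ← mul_assoc]
  gcongr
  exact le_add_self

theorem measurable_spacetime_nonlinearity {u : ℝ × ℝ → ℂ} (hu : StronglyMeasurable u) :
    StronglyMeasurable fun z : ℝ × ℝ => nonlinearity K lam (fun r => u (z.1, r)) z.2 := by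
  have h : StronglyMeasurable fun w : (ℝ × ℝ) × ℝ => {w : (ℝ × ℝ) × ℝ | w.1.2 < w.2}.indicator
      (fun w => ‖u (w.1.1, w.2)‖ ^ 2 / w.2) w := by
    refine StronglyMeasurable.indicator ?_ (measurableSet_lt (by fun_prop) measurable_snd)
    exact (((hu.measurable.comp (by fun_prop : Measurable fun w : (ℝ × ℝ) × ℝ =>
      (w.1.1, w.2))).norm.pow_const 2).div measurable_snd).stronglyMeasurable
  have h2 := h.integral_prod_right' (ν := (volume : Measure ℝ))
  have h3 : ∀ z : ℝ × ℝ, (∫ ρ, {w : (ℝ × ℝ) × ℝ | w.1.2 < w.2}.indicator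
      (fun w => ‖u (w.1.1, w.2)‖ ^ 2 / w.2) (z, ρ)) = ∫ ρ in Ioi z.2, ‖u (z.1, ρ)‖ ^ 2 / ρ := by
    intro z
    rw [← integral_indicator measurableSet_Ioi]
    rfl
  simp_rw [h3] at h2
  unfold nonlinearity
  exact (Complex.continuous_ofReal.comp_stronglyMeasurable
    ((h2.const_mul K).sub ((hu.norm.pow 2).const_mul _))).mul hu

/-- On (0, ∞) the measures r dr and dr have the same null sets, so the nonlocal integral also
depends only on the class of q. -/
theorem nonlinearity_congr {p q : ℝ → ℂ} (h : p =ᵐ[radialMeasure] q) :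
    nonlinearity K lam p =ᵐ[radialMeasure] nonlinearity K lam q := by
  unfold radialMeasure at *
  have h0 : ∀ᵐ r ∂(volume.restrict (Ioi (0 : ℝ))), p r = q r := by
    have := (ae_withDensity_iff ENNReal.measurable_ofReal).1 h
    filter_upwards [this, ae_restrict_mem measurableSet_Ioi] with r hr hr0
    exact hr (by simpa using hr0)
  filter_upwards [h, (withDensity_absolutelyContinuous _ _).ae_le
    (ae_restrict_mem measurableSet_Ioi)] with r hr (hr0 : 0 < r)
  have h1 : ∀ᵐ ρ ∂(volume.restrict (Ioi r)), p ρ = q ρ :=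
    ae_mono (Measure.restrict_mono (Ioi_subset_Ioi hr0.le) le_rfl) h0
  have h2 : ∫ ρ in Ioi r, ‖p ρ‖ ^ 2 / ρ = ∫ ρ in Ioi r, ‖q ρ‖ ^ 2 / ρ := by
    apply integral_congr_ae
    filter_upwards [h1] with ρ hρ
    rw [hρ]
  rw [nonlinearity, nonlinearity, h2, hr]

/-- Hölder with 3/4 = 1/2 + 1/4 and 1/2 = 1/4 + 1/4. The factor 2 counts the Hardy term and the
local term, each bounded with constant one. -/
theorem eLpNorm'_triple_le {a b d : ℝ × ℝ → ℝ≥0∞} (ha : Measurable a) (hb : Measurable b)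
    (hd : Measurable d) :
    eLpNorm' ((spaceHardy (a * b) + a * b) * d) (4 / 3) spacetime ≤
      2 * (eLpNorm' a 4 spacetime * eLpNorm' b 4 spacetime) * eLpNorm' d 4 spacetime := by
  have hab := ha.mul hb
  refine (eLpNorm'_mul_le (q := 2) (r := 4) (by norm_num) (by norm_num) (by norm_num)
    ((measurable_spaceHardy hab).add hab) hd).trans ?_
  gcongr
  refine (eLpNorm'_spaceHardy_add_le hab).trans ?_
  gcongr
  exact eLpNorm'_mul_le (by norm_num) (by norm_num) (by norm_num) ha hb

theorem ae_hardy_ne_top {a : ℝ × ℝ → ℝ≥0∞} (ha : Measurable a)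
    (hfin : eLpNorm' a 4 spacetime ≠ ∞) : ∀ᵐ z ∂spacetime, spaceHardy (a * a) z ≠ ∞ := by
  have hm := measurable_spaceHardy (ha.mul ha)
  have h1 : eLpNorm' (spaceHardy (a * a)) 2 spacetime < ∞ := by
    refine ((eLpNorm'_spaceHardy_le (ha.mul ha)).trans (eLpNorm'_mul_le (q := 4) (r := 4)
      (by norm_num) (by norm_num) (by norm_num) ha ha)).trans_lt ?_
    exact ENNReal.mul_lt_top hfin.lt_top hfin.lt_top
  have h2 := lintegral_rpow_enorm_lt_top_of_eLpNorm'_lt_top (by norm_num) h1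
  simp only [enorm_eq_self] at h2
  filter_upwards [ae_lt_top (hm.pow_const _) h2.ne] with z hz htop
  simp [htop] at hz

/-- With a = |u| + |v| and d = |u − v|, the pointwise bound has two trilinear terms, in (a, a, d)
and (a, d, a). Each costs a factor 2, whence 4. -/
theorem eLpNorm_nonlinearity_sub_le {u v : ℝ × ℝ → ℂ} (hu : StronglyMeasurable u)
    (hv : StronglyMeasurable v) (hu4 : eLpNorm u 4 spacetime ≠ ∞)
    (hv4 : eLpNorm v 4 spacetime ≠ ∞) :
    eLpNorm (fun z => nonlinearity K lam (fun r => u (z.1, r)) z.2 -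
        nonlinearity K lam (fun r => v (z.1, r)) z.2) (4 / 3) spacetime ≤
      4 * (‖K‖ₑ + ‖lam‖ₑ) * (eLpNorm u 4 spacetime + eLpNorm v 4 spacetime) ^ 2 *
        eLpNorm (u - v) 4 spacetime := by
  rw [eLpNorm_eq_eLpNorm' (by simp) (by simp)] at hu4 hv4
  rw [eLpNorm_eq_eLpNorm' four_thirds_ne_zero four_thirds_ne_top, toReal_four_thirds,
    eLpNorm_eq_eLpNorm' (f := u) (by simp) (by simp),
    eLpNorm_eq_eLpNorm' (f := v) (by simp) (by simp),
    eLpNorm_eq_eLpNorm' (f := u - v) (by simp) (by simp)]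
  rw [ENNReal.toReal_ofNat] at *
  set a : ℝ × ℝ → ℝ≥0∞ := fun z => ‖u z‖ₑ + ‖v z‖ₑ with ha
  set d : ℝ × ℝ → ℝ≥0∞ := fun z => ‖u z - v z‖ₑ with hd
  have ham : Measurable a := hu.measurable.enorm.add hv.measurable.enorm
  have hdm : Measurable d := (hu.measurable.sub hv.measurable).enorm
  have ha4 : eLpNorm' a 4 spacetime ≤ eLpNorm' u 4 spacetime + eLpNorm' v 4 spacetime :=
    ENNReal.lintegral_Lp_add_le hu.measurable.enorm.aemeasurable
      hv.measurable.enorm.aemeasurable (by norm_num)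
  have hd4 : eLpNorm' d 4 spacetime = eLpNorm' (u - v) 4 spacetime := rfl
  have hatop : eLpNorm' a 4 spacetime ≠ ∞ := ne_top_of_le_ne_top (by finiteness) ha4
  set C := ‖K‖ₑ + ‖lam‖ₑ with hC
  set G : ℝ × ℝ → ℝ≥0∞ := (spaceHardy (a * a) + a * a) * d + (spaceHardy (a * d) + a * d) * a
    with hG
  have hpos : ∀ᵐ z ∂spacetime, 0 < z.2 :=
    (Measure.quasiMeasurePreserving_snd (μ := (volume : Measure ℝ))
      (ν := radialMeasure)).ae ae_radialMeasure_pos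
  have hpt : ∀ᵐ z ∂spacetime, ‖nonlinearity K lam (fun r => u (z.1, r)) z.2 -
        nonlinearity K lam (fun r => v (z.1, r)) z.2‖ₑ ≤ ‖C * G z‖ₑ := by
    filter_upwards [hpos, ae_hardy_ne_top ham hatop] with z hz hfin
    exact enorm_nonlinearity_sub_le K lam (hv.measurable.comp measurable_prodMk_left)
      (hu.measurable.comp measurable_prodMk_left) hz hfin
  refine (eLpNorm'_mono_enorm_ae (by norm_num) hpt).trans ?_
  have hm1 : Measurable ((spaceHardy (a * a) + a * a) * d) :=
    ((measurable_spaceHardy (ham.mul ham)).add (ham.mul ham)).mul hdm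
  have hm2 : Measurable ((spaceHardy (a * d) + a * d) * a) :=
    ((measurable_spaceHardy (ham.mul hdm)).add (ham.mul hdm)).mul ham
  have hGle : eLpNorm' G (4 / 3) spacetime ≤
      4 * (eLpNorm' a 4 spacetime) ^ 2 * eLpNorm' d 4 spacetime := by
    refine (eLpNorm'_add_le hm1.aestronglyMeasurable hm2.aestronglyMeasurable
      (by norm_num)).trans ?_
    refine (add_le_add (eLpNorm'_triple_le ham ham hdm)
      (eLpNorm'_triple_le ham hdm ham)).trans_eq ?_
    ring
  have hCG : eLpNorm' (fun z => C * G z) (4 / 3) spacetime =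
      C * eLpNorm' G (4 / 3) spacetime := by
    simp only [eLpNorm', enorm_eq_self]
    simp_rw [ENNReal.mul_rpow_of_nonneg C _ (by norm_num : (0 : ℝ) ≤ 4 / 3)]
    rw [lintegral_const_mul _ ((hm1.add hm2).pow_const _),
      ENNReal.mul_rpow_of_nonneg _ _ (by norm_num), ← ENNReal.rpow_mul]
    norm_num
    rfl
  rw [hCG]
  calc C * eLpNorm' G (4 / 3) spacetime
      ≤ C * (4 * (eLpNorm' a 4 spacetime) ^ 2 * eLpNorm' d 4 spacetime) := by gcongr
    _ ≤ C * (4 * (eLpNorm' u 4 spacetime + eLpNorm' v 4 spacetime) ^ 2 *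
        eLpNorm' (u - v) 4 spacetime) := by rw [hd4]; gcongr
    _ = _ := by ring

theorem nonlinearity_zero (r : ℝ) : nonlinearity K lam (fun _ => 0) r = 0 := by
  simp [nonlinearity]

theorem memLp_nonlinearity (u : StrichartzSpace) :
    MemLp (fun z => -Complex.I * nonlinearity K lam (fun r => u (z.1, r)) z.2) (4 / 3)
      spacetime := by
  refine MemLp.const_mul ⟨(measurable_spacetime_nonlinearity K lam
    (Lp.stronglyMeasurable u)).aestronglyMeasurable, ?_⟩ _
  have h := eLpNorm_nonlinearity_sub_le K lam (Lp.stronglyMeasurable u)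
    (v := fun _ : ℝ × ℝ => (0 : ℂ)) stronglyMeasurable_const (Lp.eLpNorm_ne_top u) (by simp)
  simp only [nonlinearity_zero, sub_zero] at h
  refine h.trans_lt (lt_top_iff_ne_top.2 ?_)
  have h1 := Lp.eLpNorm_ne_top u
  have h2 : eLpNorm ((u : ℝ × ℝ → ℂ) - fun _ : ℝ × ℝ => (0 : ℂ)) 4 spacetime ≠ ∞ := by
    have : ((u : ℝ × ℝ → ℂ) - fun _ : ℝ × ℝ => (0 : ℂ)) = u := by ext z; simp
    rwa [this]
  have h3 : eLpNorm (fun _ : ℝ × ℝ => (0 : ℂ)) 4 spacetime ≠ ∞ := by simp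
  finiteness

/-- The map `u ↦ -i F(u)` from the Strichartz space to its dual. -/
def force (u : StrichartzSpace) : DualSpace := (memLp_nonlinearity K lam u).toLp

theorem coeFn_force (u : StrichartzSpace) : force K lam u =ᵐ[spacetime]
    fun z => -Complex.I * nonlinearity K lam (fun r => u (z.1, r)) z.2 :=
  MemLp.coeFn_toLp _

theorem norm_force_sub_le (u v : StrichartzSpace) :
    ‖force K lam u - force K lam v‖ ≤ 4 * (|K| + |lam|) * (‖u‖ + ‖v‖) ^ 2 * ‖u - v‖ := by
  have h := eLpNorm_nonlinearity_sub_le K lam (Lp.stronglyMeasurable u) (Lp.stronglyMeasurable v)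
    (Lp.eLpNorm_ne_top u) (Lp.eLpNorm_ne_top v)
  have h1 : ‖force K lam u - force K lam v‖ₑ =
      eLpNorm (fun z => nonlinearity K lam (fun r => u (z.1, r)) z.2 -
        nonlinearity K lam (fun r => v (z.1, r)) z.2) (4 / 3) spacetime := by
    rw [Lp.enorm_def]
    apply eLpNorm_congr_enorm_ae
    filter_upwards [Lp.coeFn_sub (force K lam u) (force K lam v), coeFn_force K lam u,
      coeFn_force K lam v] with z h1 h2 h3
    rw [h1, Pi.sub_apply, h2, h3, ← mul_sub, enorm_mul]
    simp [← ofReal_norm]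
  rw [← h1, ← Lp.enorm_def, ← Lp.enorm_def, ← eLpNorm_congr_ae (Lp.coeFn_sub u v),
    ← Lp.enorm_def] at h
  have h2 : 4 * (‖K‖ₑ + ‖lam‖ₑ) * (‖u‖ₑ + ‖v‖ₑ) ^ 2 * ‖u - v‖ₑ =
      ENNReal.ofReal (4 * (|K| + |lam|) * (‖u‖ + ‖v‖) ^ 2 * ‖u - v‖) := by
    rw [ENNReal.ofReal_mul (by positivity), ENNReal.ofReal_mul (by positivity),
      ENNReal.ofReal_mul (by positivity), ENNReal.ofReal_pow (by positivity),
      ENNReal.ofReal_add (norm_nonneg _) (norm_nonneg _),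
      ENNReal.ofReal_add (abs_nonneg _) (abs_nonneg _), ofReal_norm, ofReal_norm, ofReal_norm,
      Real.enorm_eq_ofReal_abs, Real.enorm_eq_ofReal_abs]
    norm_num
  rw [h2, ← ofReal_norm, ENNReal.ofReal_le_ofReal_iff (by positivity)] at h
  exact h

theorem force_congr {x : ℝ × ℝ → ℂ} {u : StrichartzSpace} (h : u =ᵐ[spacetime] x) :
    ∀ᵐ t : ℝ, (fun r => force K lam u (t, r)) =ᵐ[radialMeasure]
      fun r => -Complex.I * nonlinearity K lam (fun r => x (t, r)) r := by
  filter_upwards [ae_slices h, ae_slices (coeFn_force K lam u)] with t h1 h2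
  filter_upwards [nonlinearity_congr K lam h1, h2] with r h3 h4
  rw [h4, h3]

theorem IsVersion.force_slice {u : StrichartzSpace} {v : ℝ → RadialL2} (h : IsVersion u v) :
    ∀ᵐ t : ℝ, (fun r => force K lam u (t, r)) =ᵐ[radialMeasure]
      fun r => -Complex.I * nonlinearity K lam (v t) r := by
  filter_upwards [h, ae_slices (coeFn_force K lam u)] with t h1 h2
  filter_upwards [nonlinearity_congr K lam h1, h2] with r h3 h4
  rw [h4, h3]

/-- The nonlinearity is nonlocal in r but acts at each fixed time, and it vanishes on the zero
profile. Hence disjoint time sets do not interact in the force. -/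
theorem force_cut {E : Set ℝ} (hE : MeasurableSet E) (u : StrichartzSpace) :
    force K lam (cut E u) = cut E (force K lam u) := by
  apply Lp.ext
  refine ae_eq_of_slices (Lp.aestronglyMeasurable _) (Lp.aestronglyMeasurable _) ?_
  filter_upwards [force_congr K lam (coeFn_cut hE u), ae_slices (coeFn_force K lam u),
    ae_slices (coeFn_cut hE (force K lam u))] with t h1 h2 h3
  filter_upwards [h1, h2, h3] with r h4 h5 h6
  rw [h4, h6]
  by_cases ht : t ∈ E
  · have h7 : ∀ f : ℝ × ℝ → ℂ, ∀ r, (Prod.fst ⁻¹' E).indicator f (t, r) = f (t, r) :=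
      fun f r => indicator_of_mem (by simpa using ht) _
    simp only [h7, h5]
  · have h7 : ∀ f : ℝ × ℝ → ℂ, ∀ r, (Prod.fst ⁻¹' E).indicator f (t, r) = 0 :=
      fun f r => indicator_of_notMem (by simpa using ht) _
    simp only [h7, nonlinearity_zero, mul_zero]

theorem force_zero : force K lam 0 = 0 := by
  have := force_cut K lam MeasurableSet.empty 0
  rwa [cut_empty, cut_empty] at this

/-! ### Perturbation theory in the Strichartz space -/

theorem pow_four_norm_cut_strichartz (u : StrichartzSpace) {E : Set ℝ} (hE : MeasurableSet E) :
    ‖cut E u‖ ^ 4 = (timeMeasure u).real E := by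
  have h := enorm_cut_rpow (by simp) (by simp) hE u
  rw [ENNReal.toReal_ofNat] at h
  norm_cast at h
  rw [measureReal_def, ← h, ENNReal.toReal_pow, toReal_enorm]

theorem pow_four_norm_strichartz (u : StrichartzSpace) :
    ‖u‖ ^ 4 = (timeMeasure u).real univ := by
  rw [← pow_four_norm_cut_strichartz u MeasurableSet.univ, cut_univ]

theorem cut_add_cut_compl {p : ℝ≥0∞} {B : Set ℝ} (hB : MeasurableSet B) (u : Lp ℂ p spacetime) :
    cut B u + cut Bᶜ u = u := by
  rw [← cut_union hB hB.compl disjoint_compl_right, union_compl_self, cut_univ]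

theorem force_split {B : Set ℝ} (hB : MeasurableSet B) (u : StrichartzSpace) :
    force K lam u = force K lam (cut B u) + force K lam (cut Bᶜ u) := by
  rw [force_cut K lam hB, force_cut K lam hB.compl, cut_add_cut_compl hB]

/-- The Duhamel integral from `t₀` vanishes on a time interval around `t₀` on which the force
vanishes. -/
theorem cut_duhamel_eq_zero {t₀ : ℝ} {R : ℝ} (f : DualSpace)
    (hf : cut (Icc (t₀ - R) (t₀ + R))ᶜ f = f) : cut (Icc (t₀ - R) (t₀ + R)) (duhamel t₀ f) = 0 := by
  set B := Icc (t₀ - R) (t₀ + R) with hB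
  have hBm : MeasurableSet B := measurableSet_Icc
  have h0 : ∀ t ∈ B, partialDual t f = partialDual t₀ f := by
    intro t ht
    -- The force has no mass in B, so the part of it before any time in B is the part before the
    -- left end of B.
    have hset : ∀ s ∈ B, cut (Iic s) f = cut (Iio (t₀ - R)) f := by
      intro s hs
      rw [← hf, cut_cut measurableSet_Iic hBm.compl, cut_cut measurableSet_Iio hBm.compl]
      congr 1
      ext x
      simp only [hB, mem_inter_iff, mem_Iic, mem_compl_iff, mem_Icc, mem_Iio, not_and, not_le]
      constructor
      · rintro ⟨h1, h2⟩
        refine ⟨?_, h2⟩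
        by_contra h3
        have := h2 (not_lt.1 h3)
        linarith [hs.2]
      · rintro ⟨h1, h2⟩
        exact ⟨by linarith [hs.1], h2⟩
    have ht₀ : t₀ ∈ B := by
      have : 0 ≤ R := by linarith [ht.1, ht.2]
      exact ⟨by linarith, by linarith⟩
    rw [partialDual, partialDual, hset t ht, hset t₀ ht₀]
  apply Lp.ext
  refine ae_eq_of_slices (Lp.aestronglyMeasurable _) (Lp.aestronglyMeasurable _) ?_
  filter_upwards [ae_slices (coeFn_cut hBm (duhamel t₀ f)), isVersion_duhamel t₀ f,
    ae_slices (Lp.coeFn_zero ℂ 4 spacetime)] with t h1 h2 h3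
  filter_upwards [h1, h2, h3, Lp.coeFn_zero ℂ 2 radialMeasure] with r h4 h5 h6 h7
  rw [h4, h6]
  by_cases ht : t ∈ B
  · have hmem : (t, r) ∈ Prod.fst ⁻¹' B := by simpa using ht
    rw [indicator_of_mem hmem, h5, h0 t ht, sub_self, map_zero, h7]
    rfl
  · have hmem : (t, r) ∉ Prod.fst ⁻¹' B := by simpa using ht
    rw [indicator_of_notMem hmem]
    rfl

theorem norm_force_add_sub_force_add_le (u w w' : StrichartzSpace) :
    ‖force K lam (u + w) - force K lam (u + w')‖ ≤
      4 * (|K| + |lam|) * (2 * ‖u‖ + ‖w‖ + ‖w'‖) ^ 2 * ‖w - w'‖ := by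
  refine (norm_force_sub_le K lam _ _).trans ?_
  rw [add_sub_add_left_eq_sub]
  have h1 := norm_add_le u w
  have h2 := norm_add_le u w'
  have h3 : ‖u + w‖ + ‖u + w'‖ ≤ 2 * ‖u‖ + ‖w‖ + ‖w'‖ := by linarith
  gcongr

/-- The perturbed Duhamel equation, restricted to the time set `E`, has a solution of norm at most
`ε`. -/
def PerturbationSolvable (t₀ : ℝ) (E : Set ℝ) (u ω : StrichartzSpace) (ε : ℝ) : Prop :=
  ∃ w : StrichartzSpace,
    w = cut E (ω + duhamel t₀ (force K lam (u + w) - force K lam u)) ∧ ‖w‖ ≤ ε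

/-- A contraction in the ball of radius min ε κ. The threshold η on u depends only on K and lam,
while ε affects only δ; this is what allows the statement to be iterated. -/
theorem exists_perturbation_of_small : ∃ η > (0 : ℝ), ∀ ε > (0 : ℝ), ∃ δ > (0 : ℝ),
    ∀ (t₀ : ℝ) (E : Set ℝ) (u ω : StrichartzSpace), ‖u‖ ^ 4 ≤ η → ‖cut E ω‖ ≤ δ →
      PerturbationSolvable K lam t₀ E u ω ε := by
  set C := 4 * (|K| + |lam|) with hC
  have hC0 : 0 ≤ C := by positivity
  -- Chosen so that 28·C·(4κ)² ≤ 1/2: 28 is the Duhamel constant and 4κ bounds 2‖u‖ + ‖w‖ + ‖w'‖.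
  -- Using C + 1 covers C = 0.
  set κ := (1 / (56 * 16 * (C + 1))) ^ (1 / 2 : ℝ) with hκ
  have hκ0 : 0 < κ := by positivity
  have hκ2 : κ ^ 2 = 1 / (56 * 16 * (C + 1)) := by
    rw [hκ, ← Real.rpow_natCast, ← Real.rpow_mul (by positivity)]
    norm_num
  have hκC : 28 * (C * (16 * κ ^ 2)) ≤ 1 / 2 := by
    rw [hκ2]
    have : 28 * (C * (16 * (1 / (56 * 16 * (C + 1))))) = (C / (C + 1)) * (1 / 2) := by
      field_simp
      ring
    rw [this]
    have : C / (C + 1) ≤ 1 := (div_le_one (by linarith)).2 (by linarith)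
    linarith
  refine ⟨κ ^ 4, by positivity, fun ε hε => ⟨min ε κ / 2, by positivity, ?_⟩⟩
  intro t₀ E u ω hu hω
  set ρ := min ε κ with hρ
  have hρ0 : 0 < ρ := lt_min hε hκ0
  have hρκ : ρ ≤ κ := min_le_right _ _
  have huκ : ‖u‖ ≤ κ := le_of_pow_le_pow_left₀ (by norm_num) hκ0.le hu
  set Φ : StrichartzSpace → StrichartzSpace := fun w =>
    cut E (ω + duhamel t₀ (force K lam (u + w) - force K lam u)) with hΦ
  have hlip : ∀ w w', ‖w‖ ≤ ρ → ‖w'‖ ≤ ρ → ‖Φ w - Φ w'‖ ≤ 1 / 2 * ‖w - w'‖ := by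
    intro w w' hw hw'
    have h1 : Φ w - Φ w' = cut E (duhamel t₀ (force K lam (u + w) - force K lam (u + w'))) := by
      rw [hΦ]
      dsimp only
      rw [← cut_sub, add_sub_add_left_eq_sub, ← duhamel_sub, sub_sub_sub_cancel_right]
    rw [h1]
    calc _ ≤ 28 * (C * (2 * ‖u‖ + ‖w‖ + ‖w'‖) ^ 2 * ‖w - w'‖) :=
          (norm_cut_le (by simp) _ _).trans ((norm_duhamel_le _ _).trans
            (mul_le_mul_of_nonneg_left (norm_force_add_sub_force_add_le K lam u w w')
              (by norm_num)))
      _ ≤ 28 * (C * (4 * κ) ^ 2 * ‖w - w'‖) := by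
          gcongr
          linarith
      _ = 28 * (C * (16 * κ ^ 2)) * ‖w - w'‖ := by ring
      _ ≤ _ := by gcongr
  have hΦ0 : Φ 0 = cut E ω := by
    have h2 : duhamel t₀ 0 = 0 := by
      have := duhamel_sub t₀ 0 0
      rwa [sub_self, sub_self] at this
    simp only [hΦ, add_zero, sub_self, h2]
  have hmaps : MapsTo Φ (Metric.closedBall 0 ρ) (Metric.closedBall 0 ρ) := by
    intro w hw
    rw [mem_closedBall_zero_iff] at hw ⊢
    have h1 := hlip w 0 hw (by simpa using hρ0.le)
    rw [hΦ0, sub_zero] at h1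
    have h3 : Φ w = (Φ w - cut E ω) + cut E ω := by abel
    rw [h3]
    refine (norm_add_le _ _).trans ?_
    linarith
  have hcontr : ContractingWith (1 / 2 : ℝ).toNNReal (hmaps.restrict Φ _ _) := by
    refine ⟨by norm_num, LipschitzWith.of_dist_le_mul ?_⟩
    rintro ⟨w, hw⟩ ⟨w', hw'⟩
    rw [Real.coe_toNNReal _ (by norm_num), Subtype.dist_eq, Subtype.dist_eq, dist_eq_norm,
      dist_eq_norm]
    exact hlip w w' (by simpa using hw) (by simpa using hw')
  obtain ⟨w, hw, hfix, -⟩ := hcontr.exists_fixedPoint' Metric.isClosed_closedBall.isComplete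
    hmaps (x := 0) (by simpa using hρ0.le) (edist_ne_top _ _)
  rw [mem_closedBall_zero_iff] at hw
  exact ⟨w, hfix.symm, hw.trans (min_le_left _ _)⟩

/-! ### Dividing time into shells around t₀ -/

theorem continuous_measureReal_Icc (μ : Measure ℝ) [IsFiniteMeasure μ] [NullSingletonClass μ]
    (t₀ : ℝ) : ContinuousOn (fun R => μ.real (Icc (t₀ - R) (t₀ + R))) (Ici 0) := by
  have hc := continuous_measureReal_Iic μ
  have h : Continuous fun R => μ.real (Iic (t₀ + R)) - μ.real (Iic (t₀ - R)) :=
    (hc.comp (by fun_prop)).sub (hc.comp (by fun_prop))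
  refine h.continuousOn.congr fun R (hR : 0 ≤ R) => ?_
  dsimp only
  rw [← measureReal_Ioc_eq μ (by linarith)]
  exact measureReal_congr Ioc_ae_eq_Icc.symm

/-- The mass of a centred interval varies continuously with its radius, from 0 towards the total, so
every smaller value is attained. -/
theorem exists_measureReal_Icc_eq (μ : Measure ℝ) [IsFiniteMeasure μ] [NullSingletonClass μ]
    (t₀ : ℝ) {c : ℝ} (hc : 0 ≤ c) (hc' : c < μ.real univ) :
    ∃ R, 0 ≤ R ∧ μ.real (Icc (t₀ - R) (t₀ + R)) = c := by
  have hlim : Tendsto (fun n : ℕ => μ.real (Icc (t₀ - n) (t₀ + n))) atTop (𝓝 (μ.real univ)) := by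
    have hU : ⋃ n : ℕ, Icc (t₀ - (n : ℝ)) (t₀ + n) = univ := by
      refine eq_univ_of_forall fun x => mem_iUnion.2 ?_
      obtain ⟨n, hn⟩ := exists_nat_ge |x - t₀|
      refine ⟨n, ?_⟩
      rw [abs_le] at hn
      exact ⟨by linarith [hn.1], by linarith [hn.2]⟩
    have hmono : Monotone fun n : ℕ => Icc (t₀ - (n : ℝ)) (t₀ + n) := by
      intro m n hmn
      have : (m : ℝ) ≤ n := by exact_mod_cast hmn
      exact Icc_subset_Icc (by linarith) (by linarith)
    have := tendsto_measure_iUnion_atTop (μ := μ) hmono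
    rw [hU] at this
    exact (ENNReal.tendsto_toReal (measure_ne_top μ univ)).comp this
  obtain ⟨n, hn⟩ := (hlim.eventually (lt_mem_nhds hc')).exists
  have h0 : μ.real (Icc (t₀ - 0) (t₀ + 0)) = 0 := by simp [measureReal_def]
  have hivt := intermediate_value_Icc (Nat.cast_nonneg n : (0 : ℝ) ≤ n)
    ((continuous_measureReal_Icc μ t₀).mono Icc_subset_Ici_self)
  obtain ⟨R, hR, hRc⟩ := hivt ⟨h0.le.trans hc, hn.le⟩
  exact ⟨R, hR.1, hRc⟩

/-- Solutions of the perturbed equation on two consecutive time shells combine. -/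
theorem PerturbationSolvable.combine {t₀ R : ℝ} {E : Set ℝ} (hE : MeasurableSet E)
    {u ω w₁ w₂ : StrichartzSpace} {B : Set ℝ} (hB : B = Icc (t₀ - R) (t₀ + R))
    (h₁ : w₁ = cut (E ∩ B) (ω + duhamel t₀ (force K lam (cut B u + w₁) - force K lam (cut B u))))
    (h₂ : w₂ = cut (E ∩ Bᶜ) (ω + duhamel t₀ (force K lam (cut B u + w₁) - force K lam (cut B u)) +
      duhamel t₀ (force K lam (cut Bᶜ u + w₂) - force K lam (cut Bᶜ u)))) :
    w₁ + w₂ = cut E (ω + duhamel t₀ (force K lam (u + (w₁ + w₂)) - force K lam u)) := by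
  have hBm : MeasurableSet B := hB ▸ measurableSet_Icc
  have hc1 : cut B w₁ = w₁ := by
    rw [h₁, cut_cut hBm (hE.inter hBm)]
    congr 1
    ext x; simp
  have hc1' : cut Bᶜ w₁ = 0 := by
    rw [h₁, cut_cut hBm.compl (hE.inter hBm)]
    have : Bᶜ ∩ (E ∩ B) = ∅ := by ext x; simp; tauto
    rw [this, cut_empty]
  have hc2 : cut Bᶜ w₂ = w₂ := by
    rw [h₂, cut_cut hBm.compl (hE.inter hBm.compl)]
    congr 1
    ext x; simp
  have hc2' : cut B w₂ = 0 := by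
    rw [h₂, cut_cut hBm (hE.inter hBm.compl)]
    have : B ∩ (E ∩ Bᶜ) = ∅ := by ext x; simp; tauto
    rw [this, cut_empty]
  set f₁ := force K lam (cut B u + w₁) - force K lam (cut B u) with hf₁
  set f₂ := force K lam (cut Bᶜ u + w₂) - force K lam (cut Bᶜ u) with hf₂
  have hf : force K lam (u + (w₁ + w₂)) - force K lam u = f₁ + f₂ := by
    rw [force_split K lam hBm (u + (w₁ + w₂)), force_split K lam hBm u, cut_add, cut_add, cut_add,
      cut_add, hc1, hc2, hc1', hc2', add_zero, zero_add, hf₁, hf₂]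
    abel
  have hf2B : cut Bᶜ f₂ = f₂ := by
    rw [hf₂, cut_sub, ← force_cut K lam hBm.compl, ← force_cut K lam hBm.compl, cut_add, hc2,
      cut_cut hBm.compl hBm.compl, inter_self]
  -- A force outside the centred interval B has no effect inside it, in either time direction. The
  -- inner problem is therefore closed and can be solved first.
  have hD2 : cut B (duhamel t₀ f₂) = 0 := by
    subst hB
    exact cut_duhamel_eq_zero f₂ hf2B
  have hsplit : ∀ x : StrichartzSpace, cut E x = cut (E ∩ B) x + cut (E ∩ Bᶜ) x := by
    intro x
    rw [← cut_union (hE.inter hBm) (hE.inter hBm.compl), ← inter_union_distrib_left,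
      union_compl_self, inter_univ]
    exact disjoint_compl_right.mono inter_subset_right inter_subset_right
  have hD2' : cut (E ∩ B) (duhamel t₀ f₂) = 0 := by
    rw [← cut_cut hE hBm, hD2, cut_zero]
  rw [hf, duhamel_add, ← add_assoc, hsplit, cut_add (E ∩ B) (ω + duhamel t₀ f₁), hD2', add_zero,
    ← h₁, ← h₂]

/-- Induction on the number of quanta η in ‖u‖⁴: solve on a centred interval carrying n quanta, then
treat the Duhamel term it produces as extra inhomogeneity on the outside, where at most one quantum
remains. The choice of δ involves only A, ε, K and lam. -/
theorem exists_perturbation (A : ℝ) : ∀ ε > (0 : ℝ), ∃ δ > (0 : ℝ),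
    ∀ (t₀ : ℝ) (E : Set ℝ) (u ω : StrichartzSpace), MeasurableSet E → ‖u‖ ^ 4 ≤ A →
      ‖cut E ω‖ ≤ δ → PerturbationSolvable K lam t₀ E u ω ε := by
  obtain ⟨η, hη, hsmall⟩ := exists_perturbation_of_small K lam
  have key : ∀ n : ℕ, ∀ ε > (0 : ℝ), ∃ δ > (0 : ℝ),
      ∀ (t₀ : ℝ) (E : Set ℝ) (u ω : StrichartzSpace), MeasurableSet E → ‖u‖ ^ 4 ≤ n * η →
        ‖cut E ω‖ ≤ δ → PerturbationSolvable K lam t₀ E u ω ε := by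
    intro n
    induction n with
    | zero =>
      intro ε hε
      obtain ⟨δ, hδ, h⟩ := hsmall ε hε
      exact ⟨δ, hδ, fun t₀ E u ω _ hu hω => h t₀ E u ω (hu.trans (by simpa using hη.le)) hω⟩
    | succ n ih =>
      intro ε hε
      obtain ⟨δ₂, hδ₂, h₂⟩ := hsmall (ε / 2) (by positivity)
      -- The Duhamel constant times the Lipschitz constant of the force when ‖cut B u‖ ≤ (n+1)η + 1
      -- and ‖w₁‖ ≤ 1. Taking ε₁ small compared with δ₂/M makes the inner correction admissible
      -- outside.
      set M : ℝ := 28 * (4 * (|K| + |lam|) * (2 * ((n + 1) * η + 1) + 1) ^ 2) with hM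
      have hM0 : 0 ≤ M := by positivity
      set ε₁ : ℝ := min 1 (min (ε / 2) (δ₂ / (2 * (M + 1)))) with hε₁
      have hε₁0 : 0 < ε₁ := by positivity
      have hε₁1 : ε₁ ≤ 1 := min_le_left _ _
      have hε₁2 : ε₁ ≤ ε / 2 := (min_le_right _ _).trans (min_le_left _ _)
      have hε₁3 : ε₁ ≤ δ₂ / (2 * (M + 1)) := (min_le_right _ _).trans (min_le_right _ _)
      have hMε : M * ε₁ ≤ δ₂ / 2 := by
        have h1 : (M + 1) * ε₁ ≤ δ₂ / 2 := by
          calc (M + 1) * ε₁ ≤ (M + 1) * (δ₂ / (2 * (M + 1))) := by gcongr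
            _ = δ₂ / 2 := by field_simp
        linarith
      obtain ⟨δ₁, hδ₁, h₁⟩ := ih ε₁ hε₁0
      obtain ⟨δ₀, hδ₀, h₀⟩ := ih ε hε
      refine ⟨min δ₀ (min δ₁ (δ₂ / 2)), by positivity, fun t₀ E u ω hE hu hω => ?_⟩
      -- If the mass is at most nη, the inductive hypothesis applies directly; otherwise some
      -- centred interval carries exactly nη.
      by_cases hcase : ‖u‖ ^ 4 ≤ n * η
      · exact h₀ t₀ E u ω hE hcase (hω.trans (min_le_left _ _))
      rw [not_le, pow_four_norm_strichartz] at hcase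
      obtain ⟨R, hR, hRc⟩ := exists_measureReal_Icc_eq (timeMeasure u) t₀ (by positivity) hcase
      set B := Icc (t₀ - R) (t₀ + R) with hB
      have hBm : MeasurableSet B := measurableSet_Icc
      have hω1 : ∀ F, MeasurableSet F → ‖cut (E ∩ F) ω‖ ≤ min δ₁ (δ₂ / 2) := by
        intro F hF
        rw [inter_comm, ← cut_cut hF hE]
        exact (norm_cut_le (by simp) _ _).trans (hω.trans (min_le_right _ _))
      have hu1 : ‖cut B u‖ ^ 4 ≤ n * η := by rw [pow_four_norm_cut_strichartz u hBm, hRc]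
      have hu2 : ‖cut Bᶜ u‖ ^ 4 ≤ η := by
        rw [pow_four_norm_strichartz] at hu
        rw [pow_four_norm_cut_strichartz u hBm.compl, measureReal_compl hBm, hRc]
        push_cast at hu
        linarith
      obtain ⟨w₁, hw₁, hw₁ε⟩ := h₁ t₀ (E ∩ B) (cut B u) ω (hE.inter hBm) hu1
        ((hω1 B hBm).trans (min_le_left _ _))
      set f₁ := force K lam (cut B u + w₁) - force K lam (cut B u) with hf₁
      have hnu : ‖cut B u‖ ≤ (n + 1) * η + 1 := by
        by_contra hcon
        rw [not_le] at hcon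
        have h1 : (1 : ℝ) ≤ ‖cut B u‖ := by
          have : 0 ≤ (n + 1) * η := by positivity
          linarith
        have h2 : ‖cut B u‖ ≤ ‖cut B u‖ ^ 4 := le_self_pow₀ h1 (by norm_num)
        linarith
      have hf₁n : ‖duhamel t₀ f₁‖ ≤ M * ε₁ := by
        have h1 := norm_force_add_sub_force_add_le K lam (cut B u) w₁ 0
        rw [add_zero, norm_zero, add_zero, sub_zero] at h1
        refine (norm_duhamel_le _ _).trans ?_
        calc 28 * ‖f₁‖ ≤ 28 * (4 * (|K| + |lam|) * (2 * ((n + 1) * η + 1) + 1) ^ 2 * ε₁) := by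
              gcongr
              refine h1.trans ?_
              gcongr
              exact hw₁ε.trans hε₁1
          _ = M * ε₁ := by rw [hM]; ring
      have hω2 : ‖cut (E ∩ Bᶜ) (ω + duhamel t₀ f₁)‖ ≤ δ₂ := by
        rw [cut_add]
        have h1 := (hω1 Bᶜ hBm.compl).trans (min_le_right _ _)
        have h2 : ‖cut (E ∩ Bᶜ) (duhamel t₀ f₁)‖ ≤ ‖duhamel t₀ f₁‖ :=
          norm_cut_le (by simp) _ _
        refine (norm_add_le _ _).trans ?_
        linarith
      obtain ⟨w₂, hw₂, hw₂ε⟩ := h₂ t₀ (E ∩ Bᶜ) (cut Bᶜ u) (ω + duhamel t₀ f₁) hu2 hω2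
      refine ⟨w₁ + w₂, PerturbationSolvable.combine K lam hE hB hw₁ hw₂, ?_⟩
      refine (norm_add_le _ _).trans ?_
      linarith
  intro ε hε
  obtain ⟨n, hn⟩ := exists_nat_ge (A / η)
  obtain ⟨δ, hδ, h⟩ := key n ε hε
  rw [div_le_iff₀ hη] at hn
  exact ⟨δ, hδ, fun t₀ E u ω hE hu hω => h t₀ E u ω hE (hu.trans hn) hω⟩

/-! ### The Duhamel formula in the interaction picture -/

theorem ae_memLp_slice (f : DualSpace) :
    ∀ᵐ s : ℝ, MemLp (fun r => f (s, r)) (4 / 3) radialMeasure := by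
  have hm := (Lp.stronglyMeasurable f).measurable.enorm.pow_const (4 / 3 : ℝ)
  have h := lintegral_rpow_enorm_Lp four_thirds_ne_zero four_thirds_ne_top f
  rw [toReal_four_thirds, lintegral_prod _ hm.aemeasurable] at h
  have hfin : ∫⁻ s, ∫⁻ r, ‖f (s, r)‖ₑ ^ (4 / 3 : ℝ) ∂radialMeasure ≠ ∞ := by
    rw [← h]
    exact ENNReal.rpow_ne_top_of_nonneg (by norm_num) enorm_ne_top
  filter_upwards [ae_lt_top hm.lintegral_prod_right' hfin] with s hs
  refine ⟨((Lp.stronglyMeasurable f).comp_measurable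
    measurable_prodMk_left).aestronglyMeasurable, ?_⟩
  rw [eLpNorm_lt_top_iff_lintegral_rpow_enorm_lt_top four_thirds_ne_zero four_thirds_ne_top,
    toReal_four_thirds]
  exact hs

theorem vortex_const_mul (c : ℂ) (q : ℝ → ℂ) (x : ℂ) :
    vortex (fun r => c * q r) x = c * vortex q x := by
  rw [vortex, vortex]; ring

/-- At each s the pairing is with the inverse evolution of `sharp φ` by t − s, that is, with the
free wave through flow (−t) (sharp φ) at time s. Integrating in s gives the pairing that defines
`evolveDual`. -/
theorem setIntegral_vortex_eq_inner {f : DualSpace} {G : ℝ → ℝ → ℂ} {a b : ℝ}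
    (h : ∀ᵐ s : ℝ, s ∈ Ioc a b →
      (fun r => f (s, r)) =ᵐ[radialMeasure] fun r => -Complex.I * G s r)
    (t : ℝ) (φ : 𝓢(ℂ, ℂ)) :
    -Complex.I * ∫ s in Ioc a b, ∫ x : ℂ, vortex (G s) x * freeSchwartz (t - s) φ x =
      inner ℂ (flow (-t) (sharp φ)) (evolveDual (cut (Ioc a b) f)) := by
  rw [inner_evolveDual_complex, integral_prod _ (integrable_conj_mul _ _),
    ← integral_const_mul, ← integral_indicator measurableSet_Ioc]
  apply integral_congr_ae
  filter_upwards [h, ae_memLp_slice f, isVersion_evolve (flow (-t) (sharp φ)),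
    ae_slices (coeFn_cut measurableSet_Ioc f)] with s h1 h2 h3 h4
  by_cases hs : s ∈ Ioc a b
  · rw [indicator_of_mem hs, ← integral_const_mul]
    have h5 : ∫ x : ℂ, -Complex.I * (vortex (G s) x * freeSchwartz (t - s) φ x) =
        ∫ x : ℂ, vortex (fun r => f (s, r)) x * freeSchwartz (t - s) φ x := by
      apply integral_congr_ae
      filter_upwards [vortex_congr (h1 hs)] with x hx
      rw [hx, vortex_const_mul, mul_assoc]
    rw [h5, integral_vortex_mul_eq_sharp (q := 4) h2, sharp_freeSchwartz]
    apply integral_congr_ae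
    filter_upwards [h3, h4] with r h6 h7
    have hmem : (s, r) ∈ Prod.fst ⁻¹' Ioc a b := by simpa using hs
    rw [h6, h7, indicator_of_mem hmem, flow_flow, neg_sub, sub_eq_add_neg]
  · rw [indicator_of_notMem hs]
    symm
    apply integral_eq_zero_of_ae
    filter_upwards [h4] with r h7
    have hmem : (s, r) ∉ Prod.fst ⁻¹' Ioc a b := by simpa using hs
    rw [h7, indicator_of_notMem hmem, mul_zero]
    rfl

theorem intervalIntegral_vortex_eq_inner {f : DualSpace} {G : ℝ → ℝ → ℂ} {t₀ t₁ : ℝ}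
    (h : ∀ᵐ s : ℝ, s ∈ uIoc t₀ t₁ →
      (fun r => f (s, r)) =ᵐ[radialMeasure] fun r => -Complex.I * G s r)
    (t : ℝ) (φ : 𝓢(ℂ, ℂ)) :
    -Complex.I * ∫ s in t₀..t₁, ∫ x : ℂ, vortex (G s) x * freeSchwartz (t - s) φ x =
      inner ℂ (flow (-t) (sharp φ)) (partialDual t₁ f - partialDual t₀ f) := by
  rcases le_total t₀ t₁ with hle | hle
  · rw [uIoc_of_le hle] at h
    rw [intervalIntegral.integral_of_le hle, setIntegral_vortex_eq_inner h,
      partialDual_sub_partialDual hle]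
  · rw [uIoc_of_ge hle] at h
    rw [intervalIntegral.integral_of_ge hle, mul_neg, setIntegral_vortex_eq_inner h,
      ← partialDual_sub_partialDual hle, ← inner_neg_right, neg_sub]

/-- The weak Duhamel formula between two times, in the interaction picture. -/
theorem duhamel_iff_profile {f : DualSpace} {G : ℝ → ℝ → ℂ} {t₀ t₁ : ℝ} {q : ℝ → RadialL2}
    (h : ∀ᵐ s : ℝ, s ∈ uIoc t₀ t₁ →
      (fun r => f (s, r)) =ᵐ[radialMeasure] fun r => -Complex.I * G s r) :
    (∀ φ : 𝓢(ℂ, ℂ), ∫ x : ℂ, vortex (q t₁) x * φ x =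
      (∫ x : ℂ, vortex (q t₀) x * freeSchwartz (t₁ - t₀) φ x) -
        Complex.I * ∫ s in t₀..t₁, ∫ x : ℂ, vortex (G s) x * freeSchwartz (t₁ - s) φ x) ↔
    flow (-t₁) (q t₁) = flow (-t₀) (q t₀) + (partialDual t₁ f - partialDual t₀ f) := by
  have key : ∀ φ : 𝓢(ℂ, ℂ), (∫ x : ℂ, vortex (q t₀) x * freeSchwartz (t₁ - t₀) φ x) -
        Complex.I * ∫ s in t₀..t₁, ∫ x : ℂ, vortex (G s) x * freeSchwartz (t₁ - s) φ x =
      inner ℂ (sharp φ)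
        (flow t₁ (flow (-t₀) (q t₀) + (partialDual t₁ f - partialDual t₀ f))) := by
    intro φ
    rw [sub_eq_add_neg, ← neg_mul, intervalIntegral_vortex_eq_inner h, ← inner_sharp,
      sharp_freeSchwartz, map_add, inner_add_right, flow_flow, inner_flow_right t₁,
      inner_flow_right (t₁ + -t₀)]
    congr 4
  constructor
  · intro hw
    have h1 : q t₁ = flow t₁ (flow (-t₀) (q t₀) + (partialDual t₁ f - partialDual t₀ f)) := by
      apply eq_of_inner_sharp
      intro φ
      rw [inner_sharp, hw φ, key φ]
    rw [h1, flow_flow, neg_add_cancel, flow_zero]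
  · intro hs φ
    rw [key φ, ← hs, flow_flow, add_neg_cancel, flow_zero, inner_sharp]

variable {K lam}

theorem IsForcedSolution.measurableSet {I : Set ℝ} {q : ℝ → RadialL2} {e : ℝ → ℝ → ℂ}
    (h : IsForcedSolution K lam I q e) : MeasurableSet I := h.ordConnected.measurableSet

theorem stronglyMeasurable_indicator_of_continuousOn {I : Set ℝ} (hI : MeasurableSet I)
    {q : ℝ → RadialL2} (hq : ContinuousOn q I) : StronglyMeasurable (I.indicator q) := by
  classical
  borelize RadialL2
  have : Measurable (I.indicator q) := by
    have h := hq.measurable_piecewise (g := fun _ => (0 : RadialL2)) continuousOn_const hI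
    rw [← piecewise_eq_indicator]
    exact h
  exact this.stronglyMeasurable

theorem IsForcedSolution.exists_isVersion {I : Set ℝ} {q : ℝ → RadialL2} {e : ℝ → ℝ → ℂ}
    (h : IsForcedSolution K lam I q e) (hfin : scatteringSize I q < ∞) :
    ∃ x : StrichartzSpace, IsVersion x (I.indicator q) :=
  RadialNLS.exists_isVersion
    (stronglyMeasurable_indicator_of_continuousOn h.measurableSet h.continuousOn)
    (by rwa [scatteringSize_indicator h.measurableSet])

theorem IsVersion.enorm_pow_four_eq {I : Set ℝ} (hI : MeasurableSet I) {q : ℝ → RadialL2}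
    {x : StrichartzSpace} (h : IsVersion x (I.indicator q)) : ‖x‖ₑ ^ 4 = scatteringSize I q := by
  rw [h.enorm_pow_four, scatteringSize_indicator hI]

theorem IsVersion.force_add {I : Set ℝ} {q : ℝ → RadialL2} {e : ℝ → ℝ → ℂ} {x : StrichartzSpace}
    {g : DualSpace} (hx : IsVersion x (I.indicator q))
    (hg : ∀ᵐ s : ℝ, s ∈ I →
      (fun r => g (s, r)) =ᵐ[radialMeasure] fun r => -Complex.I * e s r) :
    ∀ᵐ s : ℝ, s ∈ I → (fun r => (force K lam x + g : DualSpace) (s, r)) =ᵐ[radialMeasure]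
      fun r => -Complex.I * (nonlinearity K lam (q s) r + e s r) := by
  filter_upwards [hx.force_slice K lam, hg, ae_slices (Lp.coeFn_add (force K lam x) g)]
    with s h1 h2 h3 hs
  filter_upwards [h1, h2 hs, h3] with r h4 h5 h6
  rw [indicator_of_mem hs] at h4
  rw [h6, Pi.add_apply, h4, h5, mul_add]

theorem IsForcedSolution.profile {I : Set ℝ} {q : ℝ → RadialL2} {e : ℝ → ℝ → ℂ}
    {x : StrichartzSpace} {g : DualSpace} (h : IsForcedSolution K lam I q e)
    (hx : IsVersion x (I.indicator q))
    (hg : ∀ᵐ s : ℝ, s ∈ I →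
      (fun r => g (s, r)) =ᵐ[radialMeasure] fun r => -Complex.I * e s r)
    {t₀ t₁ : ℝ} (h₀ : t₀ ∈ I) (h₁ : t₁ ∈ I) :
    flow (-t₁) (q t₁) = flow (-t₀) (q t₀) +
      (partialDual t₁ (force K lam x + g) - partialDual t₀ (force K lam x + g)) := by
  refine (duhamel_iff_profile ?_).1 (h.duhamel t₀ h₀ t₁ h₁)
  filter_upwards [hx.force_add hg] with s hs hmem
  exact hs (h.ordConnected.uIcc_subset h₀ h₁ (uIoc_subset_uIcc hmem))

theorem ae_zero_force (I : Set ℝ) : ∀ᵐ s : ℝ, s ∈ I →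
    (fun r => (0 : DualSpace) (s, r)) =ᵐ[radialMeasure] fun _ => -Complex.I * 0 := by
  filter_upwards [ae_slices (Lp.coeFn_zero ℂ (4 / 3) spacetime)] with s hs _
  filter_upwards [hs] with r hr
  rw [hr, mul_zero]
  rfl

theorem IsSolution.profile {I : Set ℝ} {q : ℝ → RadialL2} {x : StrichartzSpace}
    (h : IsSolution K lam I q) (hx : IsVersion x (I.indicator q))
    {t₀ t₁ : ℝ} (h₀ : t₀ ∈ I) (h₁ : t₁ ∈ I) :
    flow (-t₁) (q t₁) = flow (-t₀) (q t₀) +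
      (partialDual t₁ (force K lam x) - partialDual t₀ (force K lam x)) := by
  have := IsForcedSolution.profile h hx (g := 0) (ae_zero_force I) h₀ h₁
  rwa [add_zero] at this

theorem eq_flow_of_profile {q : ℝ → RadialL2} {t : ℝ} {p : RadialL2}
    (h : flow (-t) (q t) = p) : q t = flow t p := by
  rw [← h, flow_flow, add_neg_cancel, flow_zero]

/-- The Duhamel equation in the Strichartz space. -/
theorem IsVersion.eq_cut {I : Set ℝ} (hI : MeasurableSet I) {q : ℝ → RadialL2}
    {x : StrichartzSpace} {f : DualSpace} {t₀ : ℝ} {p : RadialL2}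
    (hx : IsVersion x (I.indicator q))
    (h : ∀ t ∈ I, flow (-t) (q t) = p + (partialDual t f - partialDual t₀ f)) :
    x = cut I (evolve p + RadialNLS.duhamel t₀ f) := by
  apply Lp.ext
  refine ae_eq_of_slices (Lp.aestronglyMeasurable _) (Lp.aestronglyMeasurable _) ?_
  filter_upwards [hx, ae_slices (coeFn_cut hI (evolve p + RadialNLS.duhamel t₀ f)),
    (isVersion_evolve p).add (isVersion_duhamel t₀ f)] with t h1 h2 h3
  filter_upwards [h1, h2, h3, Lp.coeFn_zero ℂ 2 radialMeasure] with r h4 h5 h6 h7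
  rw [h4, h5]
  by_cases ht : t ∈ I
  · have hmem : (t, r) ∈ Prod.fst ⁻¹' I := by simpa using ht
    rw [indicator_of_mem hmem, indicator_of_mem ht, h6, eq_flow_of_profile (h t ht), map_add]
  · have hmem : (t, r) ∉ Prod.fst ⁻¹' I := by simpa using ht
    rw [indicator_of_notMem hmem, indicator_of_notMem ht, h7]
    rfl

/-- The profile formula already contains every clause: continuity comes from `partialDual` and the
flow, local L⁴ finiteness from x, and the formula between two times by subtraction. -/
theorem isSolution_of_profile {I : Set ℝ} (hI : I.OrdConnected) {q : ℝ → RadialL2}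
    {x : StrichartzSpace} (hx : IsVersion x (I.indicator q)) {t₀ : ℝ} {p : RadialL2}
    (h : ∀ t ∈ I, flow (-t) (q t) =
      p + (partialDual t (force K lam x) - partialDual t₀ (force K lam x))) :
    IsSolution K lam I q where
  ordConnected := hI
  continuousOn := by
    have hc : Continuous fun t => flow t
        (p + (partialDual t (force K lam x) - partialDual t₀ (force K lam x))) :=
      continuous_flow_comp (continuous_const.add
        ((continuous_partialDual _).sub continuous_const))
    exact hc.continuousOn.congr fun t ht => eq_flow_of_profile (h t ht)
  locallyL4 := by
    intro a ha b hb
    have h1 : scatteringSize (Icc a b) q ≤ scatteringSize I q :=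
      lintegral_mono' (Measure.restrict_mono (hI.out ha hb) le_rfl) le_rfl
    refine h1.trans_lt ?_
    rw [← hx.enorm_pow_four_eq hI.measurableSet]
    exact ENNReal.pow_lt_top enorm_lt_top
  duhamel := by
    intro a ha b hb
    refine (duhamel_iff_profile (f := force K lam x) ?_).2 ?_
    · have h2 := IsVersion.force_add (K := K) (lam := lam) (g := 0) hx (ae_zero_force I)
      rw [add_zero] at h2
      filter_upwards [h2] with s hs hmem
      exact hs (hI.uIcc_subset ha hb (uIoc_subset_uIcc hmem))
    · rw [h a ha, h b hb]
      abel

/-- A solution of the Duhamel equation in the Strichartz space is a solution of the equation. -/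
theorem exists_isSolution_of_eq_cut {I : Set ℝ} (hI : I.OrdConnected) {t₀ : ℝ} (p : RadialL2)
    {x : StrichartzSpace}
    (hx : x = cut I (evolve (flow (-t₀) p) + RadialNLS.duhamel t₀ (force K lam x))) :
    ∃ q : ℝ → RadialL2, IsSolution K lam I q ∧ q t₀ = p ∧ IsVersion x (I.indicator q) := by
  set f := force K lam x with hf
  set q : ℝ → RadialL2 := fun t =>
    flow t (flow (-t₀) p + (partialDual t f - partialDual t₀ f)) with hq
  have hprof : ∀ t, flow (-t) (q t) = flow (-t₀) p + (partialDual t f - partialDual t₀ f) := by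
    intro t
    rw [hq, flow_flow, neg_add_cancel, flow_zero]
  have hv : IsVersion x (I.indicator q) := by
    rw [hx]
    filter_upwards [ae_slices (coeFn_cut hI.measurableSet
      (evolve (flow (-t₀) p) + RadialNLS.duhamel t₀ f)),
      (isVersion_evolve (flow (-t₀) p)).add (isVersion_duhamel t₀ f)] with t h2 h3
    filter_upwards [h2, h3, Lp.coeFn_zero ℂ 2 radialMeasure] with r h5 h6 h7
    rw [h5]
    by_cases ht : t ∈ I
    · have hmem : (t, r) ∈ Prod.fst ⁻¹' I := by simpa using ht
      rw [indicator_of_mem hmem, indicator_of_mem ht, h6, ← map_add]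
    · have hmem : (t, r) ∉ Prod.fst ⁻¹' I := by simpa using ht
      rw [indicator_of_notMem hmem, indicator_of_notMem ht, h7]
      rfl
  refine ⟨q, isSolution_of_profile hI hv fun t _ => hprof t, ?_, hv⟩
  rw [hq]
  simp only [sub_self, add_zero]
  rw [flow_flow, add_neg_cancel, flow_zero]

/-! ### Uniqueness, gluing and local existence -/

/-- Uniqueness for the Duhamel equation in the Strichartz space. -/
theorem eq_of_sub_eq_cut {t₀ : ℝ} {E : Set ℝ} (hE : MeasurableSet E) {u v : StrichartzSpace}
    (h : v - u = cut E (duhamel t₀ (force K lam v - force K lam u))) : u = v := by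
  set C := 4 * (|K| + |lam|) with hC
  have hC0 : 0 ≤ C := by positivity
  -- Chosen so that 28·C·(2κ)² ≤ 1/2.
  set κ := (1 / (56 * 4 * (C + 1))) ^ (1 / 2 : ℝ) with hκ
  have hκ0 : 0 < κ := by positivity
  have hκ2 : κ ^ 2 = 1 / (56 * 4 * (C + 1)) := by
    rw [hκ, ← Real.rpow_natCast, ← Real.rpow_mul (by positivity)]
    norm_num
  have hκC : 28 * (C * (4 * κ ^ 2)) ≤ 1 / 2 := by
    rw [hκ2]
    have : 28 * (C * (4 * (1 / (56 * 4 * (C + 1))))) = (C / (C + 1)) * (1 / 2) := by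
      field_simp
      ring
    rw [this]
    have : C / (C + 1) ≤ 1 := (div_le_one (by linarith)).2 (by linarith)
    linarith
  -- The joint mass of u and v is finite, so it is counted in units κ⁴. Inside a centred interval
  -- the two agree by induction, the force difference there vanishes, and the remaining unit makes
  -- the outer equation strictly contractive.
  have key : ∀ n : ℕ, ∀ (E : Set ℝ) (u v : StrichartzSpace), MeasurableSet E →
      ‖u‖ ^ 4 + ‖v‖ ^ 4 ≤ n * κ ^ 4 →
      v - u = cut E (duhamel t₀ (force K lam v - force K lam u)) → u = v := by
    intro n
    induction n with
    | zero =>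
      intro E u v _ hn _
      rw [Nat.cast_zero, zero_mul] at hn
      have hu0 : ‖u‖ ^ 4 = 0 := le_antisymm (by linarith [pow_nonneg (norm_nonneg v) 4])
        (by positivity)
      have hv0 : ‖v‖ ^ 4 = 0 := le_antisymm (by linarith [pow_nonneg (norm_nonneg u) 4])
        (by positivity)
      rw [norm_eq_zero.1 (pow_eq_zero_iff (by norm_num) |>.1 hu0),
        norm_eq_zero.1 (pow_eq_zero_iff (by norm_num) |>.1 hv0)]
    | succ n ih =>
      intro E u v hE hn huv
      by_cases hcase : ‖u‖ ^ 4 + ‖v‖ ^ 4 ≤ n * κ ^ 4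
      · exact ih E u v hE hcase huv
      set μ := timeMeasure u + timeMeasure v with hμ
      have hna : NullSingletonClass μ := ⟨fun t => by simp [hμ]⟩
      have hmass : ∀ F, MeasurableSet F → μ.real F = ‖cut F u‖ ^ 4 + ‖cut F v‖ ^ 4 := by
        intro F hF
        rw [pow_four_norm_cut_strichartz u hF, pow_four_norm_cut_strichartz v hF, hμ,
          measureReal_add_apply]
      have huniv := hmass univ MeasurableSet.univ
      rw [cut_univ, cut_univ] at huniv
      rw [not_le, ← huniv] at hcase
      obtain ⟨R, hR, hRc⟩ := exists_measureReal_Icc_eq μ t₀ (by positivity) hcase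
      set B := Icc (t₀ - R) (t₀ + R) with hB
      have hBm : MeasurableSet B := measurableSet_Icc
      set f₁ := force K lam (cut B v) - force K lam (cut B u) with hf₁
      set f₂ := force K lam (cut Bᶜ v) - force K lam (cut Bᶜ u) with hf₂
      have hf : force K lam v - force K lam u = f₁ + f₂ := by
        rw [force_split K lam hBm v, force_split K lam hBm u, hf₁, hf₂]
        abel
      have hf2B : cut Bᶜ f₂ = f₂ := by
        rw [hf₂, cut_sub, ← force_cut K lam hBm.compl, ← force_cut K lam hBm.compl,
          cut_cut hBm.compl hBm.compl, cut_cut hBm.compl hBm.compl, inter_self]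
      have hD2 : cut B (duhamel t₀ f₂) = 0 := cut_duhamel_eq_zero f₂ hf2B
      have h1 : cut B u = cut B v := by
        refine ih (E ∩ B) (cut B u) (cut B v) (hE.inter hBm) ?_ ?_
        · rw [← hmass B hBm, hRc]
        · rw [← cut_sub, huv, hf, duhamel_add, cut_cut hBm hE, inter_comm B E, cut_add,
            ← cut_cut hE hBm (duhamel t₀ f₂), hD2, cut_zero, add_zero]
      have hf10 : f₁ = 0 := by rw [hf₁, h1, sub_self]
      have h2 : ‖cut Bᶜ v - cut Bᶜ u‖ ≤ ‖v - u‖ := by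
        rw [← cut_sub]
        exact norm_cut_le (by simp) _ _
      have hBc : ‖cut Bᶜ u‖ ^ 4 + ‖cut Bᶜ v‖ ^ 4 ≤ κ ^ 4 := by
        rw [← hmass Bᶜ hBm.compl, measureReal_compl hBm, hRc, huniv]
        push_cast at hn
        linarith
      have hBu : ‖cut Bᶜ u‖ ≤ κ := le_of_pow_le_pow_left₀ (n := 4) (by norm_num) hκ0.le
        (by linarith [pow_nonneg (norm_nonneg (cut Bᶜ v)) 4])
      have hBv : ‖cut Bᶜ v‖ ≤ κ := le_of_pow_le_pow_left₀ (n := 4) (by norm_num) hκ0.le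
        (by linarith [pow_nonneg (norm_nonneg (cut Bᶜ u)) 4])
      have h3 : ‖v - u‖ ≤ 1 / 2 * ‖v - u‖ := by
        calc ‖v - u‖ = ‖cut E (duhamel t₀ f₂)‖ := by rw [huv, hf, hf10, zero_add]
          _ ≤ 28 * (C * (‖cut Bᶜ v‖ + ‖cut Bᶜ u‖) ^ 2 * ‖cut Bᶜ v - cut Bᶜ u‖) :=
            (norm_cut_le (by simp) _ _).trans ((norm_duhamel_le _ _).trans
              (mul_le_mul_of_nonneg_left (norm_force_sub_le K lam _ _) (by norm_num)))
          _ ≤ 28 * (C * (κ + κ) ^ 2 * ‖v - u‖) := by gcongr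
          _ = 28 * (C * (4 * κ ^ 2)) * ‖v - u‖ := by ring
          _ ≤ _ := by gcongr
      have h4 : ‖v - u‖ = 0 := by linarith [norm_nonneg (v - u)]
      exact (sub_eq_zero.1 (norm_eq_zero.1 h4)).symm
  obtain ⟨n, hn⟩ := exists_nat_ge ((‖u‖ ^ 4 + ‖v‖ ^ 4) / κ ^ 4)
  rw [div_le_iff₀ (by positivity)] at hn
  exact key n E u v hE hn h

/-! ### Restricting and gluing solutions -/

theorem IsForcedSolution.mono {I J : Set ℝ} {q : ℝ → RadialL2} {e : ℝ → ℝ → ℂ}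
    (h : IsForcedSolution K lam I q e) (hJ : J.OrdConnected) (hJI : J ⊆ I) :
    IsForcedSolution K lam J q e where
  ordConnected := hJ
  continuousOn := h.continuousOn.mono hJI
  locallyL4 a ha b hb := h.locallyL4 a (hJI ha) b (hJI hb)
  duhamel a ha b hb := h.duhamel a (hJI ha) b (hJI hb)

theorem scatteringSize_congr {I : Set ℝ} (hI : MeasurableSet I) {p q : ℝ → RadialL2}
    (h : EqOn p q I) : scatteringSize I p = scatteringSize I q :=
  setLIntegral_congr_fun hI fun t ht => by rw [h ht]

theorem IsSolution.congr {I : Set ℝ} {p q : ℝ → RadialL2} (h : IsSolution K lam I q)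
    (hpq : EqOn p q I) : IsSolution K lam I p where
  ordConnected := h.ordConnected
  continuousOn := h.continuousOn.congr hpq
  locallyL4 a ha b hb := by
    rw [scatteringSize_congr measurableSet_Icc (hpq.mono (h.ordConnected.out ha hb))]
    exact h.locallyL4 a ha b hb
  duhamel a ha b hb φ := by
    rw [hpq ha, hpq hb, h.duhamel a ha b hb φ]
    congr 2
    refine intervalIntegral.integral_congr_ae (Eventually.of_forall fun s hs => ?_)
    rw [hpq (h.ordConnected.uIcc_subset ha hb (uIoc_subset_uIcc hs))]

/-- A point of I may be an end point of I, so the two sides are treated separately; a side on which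
I has no further points is trivial. -/
theorem continuousOn_of_forall_Icc {I : Set ℝ} {q : ℝ → RadialL2}
    (h : ∀ a ∈ I, ∀ b ∈ I, a ≤ b → ContinuousOn q (Icc a b)) : ContinuousOn q I := by
  intro t ht
  have hsplit : I ⊆ (I ∩ Iic t) ∪ (I ∩ Ici t) := by
    intro s hs
    rcases le_total s t with h1 | h1
    · exact Or.inl ⟨hs, h1⟩
    · exact Or.inr ⟨hs, h1⟩
  refine ContinuousWithinAt.mono (ContinuousWithinAt.union ?_ ?_) hsplit
  · by_cases hex : ∃ a ∈ I, a < t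
    · obtain ⟨a, ha, hat⟩ := hex
      refine (h a ha t ht hat.le t (right_mem_Icc.2 hat.le)).mono_of_mem_nhdsWithin ?_
      exact nhdsWithin_mono t inter_subset_right (Icc_mem_nhdsLE hat)
    · have : I ∩ Iic t ⊆ {t} := by
        rintro s ⟨hs, hst⟩
        by_contra hne
        exact hex ⟨s, hs, lt_of_le_of_ne hst hne⟩
      exact (continuousWithinAt_singleton).mono this
  · by_cases hex : ∃ b ∈ I, t < b
    · obtain ⟨b, hb, htb⟩ := hex
      refine (h t ht b hb htb.le t (left_mem_Icc.2 htb.le)).mono_of_mem_nhdsWithin ?_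
      exact nhdsWithin_mono t inter_subset_right (Icc_mem_nhdsGE htb)
    · have : I ∩ Ici t ⊆ {t} := by
        rintro s ⟨hs, hst⟩
        by_contra hne
        exact hex ⟨s, hs, lt_of_le_of_ne hst (Ne.symm hne)⟩
      exact (continuousWithinAt_singleton).mono this

/-- Being a solution is a property of the compact subintervals. -/
theorem isSolution_of_forall_Icc {I : Set ℝ} (hI : I.OrdConnected) {q : ℝ → RadialL2}
    (h : ∀ a ∈ I, ∀ b ∈ I, a ≤ b → IsSolution K lam (Icc a b) q) : IsSolution K lam I q where
  ordConnected := hI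
  continuousOn := continuousOn_of_forall_Icc fun a ha b hb hab => (h a ha b hb hab).continuousOn
  locallyL4 a ha b hb := by
    rcases le_or_gt a b with hab | hab
    · exact (h a ha b hb hab).locallyL4 a (left_mem_Icc.2 hab) b (right_mem_Icc.2 hab)
    · simp [scatteringSize, Icc_eq_empty_of_lt hab]
  duhamel a ha b hb := by
    rcases le_total a b with hab | hab
    · exact (h a ha b hb hab).duhamel a (left_mem_Icc.2 hab) b (right_mem_Icc.2 hab)
    · exact (h b hb a ha hab).duhamel a (right_mem_Icc.2 hab) b (left_mem_Icc.2 hab)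

theorem IsSolution.exists_isVersion_Icc {I : Set ℝ} {q : ℝ → RadialL2} (h : IsSolution K lam I q)
    {a b : ℝ} (ha : a ∈ I) (hb : b ∈ I) :
    ∃ x : StrichartzSpace, IsVersion x ((Icc a b).indicator q) :=
  (IsForcedSolution.mono h ordConnected_Icc (h.ordConnected.out ha hb)).exists_isVersion
    (h.locallyL4 a ha b hb)

/-- Two solutions which agree at one time agree on their common interval. -/
theorem IsSolution.eqOn {I J : Set ℝ} {p q : ℝ → RadialL2} (hp : IsSolution K lam I p)
    (hq : IsSolution K lam J q) {t₀ : ℝ} (h₀ : t₀ ∈ I ∩ J) (h : p t₀ = q t₀) :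
    EqOn p q (I ∩ J) := by
  intro t ht
  set E := uIcc t₀ t with hE
  have hEI : E ⊆ I := hp.ordConnected.uIcc_subset h₀.1 ht.1
  have hEJ : E ⊆ J := hq.ordConnected.uIcc_subset h₀.2 ht.2
  have hp' : IsSolution K lam E p := IsForcedSolution.mono hp ordConnected_uIcc hEI
  have hq' : IsSolution K lam E q := IsForcedSolution.mono hq ordConnected_uIcc hEJ
  have hmin : t₀ ⊓ t ∈ E := left_mem_Icc.2 inf_le_sup
  have hmax : t₀ ⊔ t ∈ E := right_mem_Icc.2 inf_le_sup
  obtain ⟨x, hx⟩ := hp'.exists_isVersion_Icc hmin hmax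
  obtain ⟨y, hy⟩ := hq'.exists_isVersion_Icc hmin hmax
  have hEm : MeasurableSet E := measurableSet_uIcc
  have hx1 := IsVersion.eq_cut hEm hx fun s hs => hp'.profile hx left_mem_uIcc hs
  have hy1 := IsVersion.eq_cut hEm hy fun s hs => hq'.profile hy left_mem_uIcc hs
  have hxy : x = y := by
    refine eq_of_sub_eq_cut (K := K) (lam := lam) (t₀ := t₀) hEm ?_
    conv_lhs => rw [hx1, hy1]
    rw [← cut_sub, h, add_sub_add_left_eq_sub, ← duhamel_sub]
  have h1 := hp'.profile hx left_mem_uIcc right_mem_uIcc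
  have h2 := hq'.profile hy left_mem_uIcc right_mem_uIcc
  rw [h, hxy, ← h2] at h1
  exact (flow (-t)).injective h1

theorem IsVersion.cut {I F : Set ℝ} (hF : MeasurableSet F) (hFI : F ⊆ I) {q : ℝ → RadialL2}
    {x : StrichartzSpace} (hx : IsVersion x (I.indicator q)) :
    IsVersion (RadialNLS.cut F x) (F.indicator q) := by
  filter_upwards [ae_slices (coeFn_cut hF x), hx] with t h1 h2
  filter_upwards [h1, h2, Lp.coeFn_zero ℂ 2 radialMeasure] with r h4 h5 h7
  rw [h4]
  by_cases ht : t ∈ F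
  · have hmem : (t, r) ∈ Prod.fst ⁻¹' F := by simpa using ht
    rw [indicator_of_mem hmem, h5, indicator_of_mem ht, indicator_of_mem (hFI ht)]
  · have hmem : (t, r) ∉ Prod.fst ⁻¹' F := by simpa using ht
    rw [indicator_of_notMem hmem, indicator_of_notMem ht, h7]
    rfl

/-- The space-time versions on the two halves add, the common time c being negligible. Anchoring the
profile at c reduces each half to its own formula. -/
theorem isSolution_Icc_of_Icc {a b c : ℝ} (hac : a ≤ c) (hcb : c ≤ b) {q : ℝ → RadialL2}
    (h₁ : IsSolution K lam (Icc a c) q) (h₂ : IsSolution K lam (Icc c b) q) :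
    IsSolution K lam (Icc a b) q := by
  obtain ⟨x, hx⟩ := h₁.exists_isVersion_Icc (left_mem_Icc.2 hac) (right_mem_Icc.2 hac)
  obtain ⟨y, hy⟩ := h₂.exists_isVersion_Icc (left_mem_Icc.2 hcb) (right_mem_Icc.2 hcb)
  have hcne : ∀ᵐ t : ℝ, t ≠ c := by simp [ae_iff]
  have hxy : IsVersion (x + y : StrichartzSpace) ((Icc a b).indicator q) := by
    filter_upwards [hx.add hy, hcne] with t ht htc
    refine ht.trans ?_
    have : (Icc a c).indicator q t + (Icc c b).indicator q t = (Icc a b).indicator q t := by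
      rcases lt_or_gt_of_ne htc with h | h
      · have h1 : t ∉ Icc c b := fun hh => absurd hh.1 (not_le.2 h)
        rw [indicator_of_notMem h1, add_zero]
        by_cases hm : a ≤ t
        · rw [indicator_of_mem (mem_Icc.2 ⟨hm, h.le⟩),
            indicator_of_mem (mem_Icc.2 ⟨hm, h.le.trans hcb⟩)]
        · rw [indicator_of_notMem (fun hh => hm hh.1), indicator_of_notMem (fun hh => hm hh.1)]
      · have h1 : t ∉ Icc a c := fun hh => absurd hh.2 (not_le.2 h)
        rw [indicator_of_notMem h1, zero_add]
        by_cases hm : t ≤ b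
        · rw [indicator_of_mem (mem_Icc.2 ⟨h.le, hm⟩),
            indicator_of_mem (mem_Icc.2 ⟨hac.trans h.le, hm⟩)]
        · rw [indicator_of_notMem (fun hh => hm hh.2), indicator_of_notMem (fun hh => hm hh.2)]
    rw [this]
  have hcx : cut (Icc a c) (x + y) = x ∧ cut (Icc c b) (x + y) = y :=
    ⟨(hxy.cut measurableSet_Icc (Icc_subset_Icc_right hcb)).unique hx,
      (hxy.cut measurableSet_Icc (Icc_subset_Icc_left hac)).unique hy⟩
  have hIoc : ∀ {s t α β : ℝ} (z : StrichartzSpace), s ≤ t → α ≤ s → t ≤ β →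
      cut (Icc α β) (x + y) = z →
      partialDual t (force K lam (x + y)) - partialDual s (force K lam (x + y)) =
        partialDual t (force K lam z) - partialDual s (force K lam z) := by
    intro s t α β z hst hα hβ hz
    rw [partialDual_sub_partialDual hst, partialDual_sub_partialDual hst, ← hz,
      force_cut K lam measurableSet_Icc, cut_cut measurableSet_Ioc measurableSet_Icc]
    congr 2
    ext τ
    simp only [mem_Ioc, mem_inter_iff, mem_Icc]
    constructor
    · rintro ⟨h1, h2⟩; exact ⟨⟨h1, h2⟩, by linarith, by linarith⟩
    · rintro ⟨h1, _⟩; exact h1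
  refine isSolution_of_profile ordConnected_Icc hxy (t₀ := c) (p := flow (-c) (q c)) ?_
  intro t ht
  rcases le_total t c with htc | hct
  · have h3 := h₁.profile hx (right_mem_Icc.2 hac) (⟨ht.1, htc⟩ : t ∈ Icc a c)
    have h4 := hIoc x htc ht.1 le_rfl hcx.1
    rw [h3, ← neg_sub (partialDual c _) (partialDual t (force K lam x)), ← h4, neg_sub]
  · have h3 := h₂.profile hy (left_mem_Icc.2 hcb) (⟨hct, ht.2⟩ : t ∈ Icc c b)
    have h4 := hIoc y hct le_rfl ht.2 hcx.2
    rw [h3, ← h4]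

/-- Two solutions which agree at one time have a common extension. -/
theorem IsSolution.exists_union {I J : Set ℝ} {p q : ℝ → RadialL2} (hp : IsSolution K lam I p)
    (hq : IsSolution K lam J q) {t₀ : ℝ} (h₀ : t₀ ∈ I ∩ J) (h : p t₀ = q t₀) :
    ∃ z : ℝ → RadialL2, IsSolution K lam (I ∪ J) z ∧ EqOn z p I ∧ EqOn z q J := by
  classical
  have hpq := hp.eqOn hq h₀ h
  set z : ℝ → RadialL2 := fun t => if t ∈ I then p t else q t with hz
  have hzp : EqOn z p I := fun t ht => if_pos ht
  have hzq : EqOn z q J := by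
    intro t ht
    by_cases hI : t ∈ I
    · rw [hzp hI, hpq ⟨hI, ht⟩]
    · exact if_neg hI
  have hzI : IsSolution K lam I z := hp.congr hzp
  have hzJ : IsSolution K lam J z := hq.congr hzq
  have hIo := hp.ordConnected
  have hJo := hq.ordConnected
  have hsub : ∀ {F : Set ℝ} {a b : ℝ}, F.OrdConnected → IsSolution K lam F z → a ∈ F → b ∈ F →
      IsSolution K lam (Icc a b) z := fun hF hs ha hb =>
    IsForcedSolution.mono hs ordConnected_Icc (hF.out ha hb)
  have hmix : ∀ {F G : Set ℝ} {a b : ℝ}, F.OrdConnected → G.OrdConnected →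
      IsSolution K lam F z → IsSolution K lam G z → t₀ ∈ F → t₀ ∈ G → a ∈ F → b ∈ G → a ≤ b →
      IsSolution K lam (Icc a b) z := by
    intro F G a b hF hG hsF hsG h0F h0G ha hb hab
    rcases le_total t₀ a with h1 | h1
    · exact hsub hG hsG (hG.out h0G hb ⟨h1, hab⟩) hb
    rcases le_total b t₀ with h2 | h2
    · exact hsub hF hsF ha (hF.out ha h0F ⟨hab, h2⟩)
    exact isSolution_Icc_of_Icc h1 h2 (hsub hF hsF ha h0F) (hsub hG hsG h0G hb)
  have hall : ∀ a ∈ I ∪ J, ∀ b ∈ I ∪ J, a ≤ b → IsSolution K lam (Icc a b) z := by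
    rintro a (ha | ha) b (hb | hb) hab
    · exact hsub hIo hzI ha hb
    · exact hmix hIo hJo hzI hzJ h₀.1 h₀.2 ha hb hab
    · exact hmix hJo hIo hzJ hzI h₀.2 h₀.1 ha hb hab
    · exact hsub hJo hzJ ha hb
  refine ⟨z, isSolution_of_forall_Icc ?_ hall, hzp, hzq⟩
  exact (IsPreconnected.union t₀ h₀.1 h₀.2 hIo.isPreconnected hJo.isPreconnected).ordConnected

/-- This is the perturbation theorem around u = 0, with A = 0 and the free wave as inhomogeneity. -/
theorem exists_isSolution_of_small (K lam : ℝ) : ∃ δ > (0 : ℝ),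
    ∀ (I : Set ℝ) (t₀ : ℝ) (p : RadialL2), I.OrdConnected →
      ‖cut I (evolve (flow (-t₀) p))‖ ≤ δ →
      ∃ (q : ℝ → RadialL2) (x : StrichartzSpace), IsSolution K lam I q ∧ q t₀ = p ∧
        IsVersion x (I.indicator q) := by
  obtain ⟨δ, hδ, h⟩ := exists_perturbation K lam 0 1 one_pos
  refine ⟨δ, hδ, fun I t₀ p hI hp => ?_⟩
  obtain ⟨w, hw, -⟩ := h t₀ I 0 _ hI.measurableSet (by simp) hp
  rw [zero_add, force_zero, sub_zero] at hw
  obtain ⟨q, hq, hq0, hv⟩ := exists_isSolution_of_eq_cut hI p hw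
  exact ⟨q, w, hq, hq0, hv⟩

/-- The free wave has finite L⁴ size on all of space-time, so its size on a short interval around t₀
is as small as desired, although the length of that interval depends on the data and not only on its
norm. -/
theorem exists_local_isSolution (K lam : ℝ) (t₀ : ℝ) (p : RadialL2) :
    ∃ τ > (0 : ℝ), ∃ q : ℝ → RadialL2,
      IsSolution K lam (Icc (t₀ - τ) (t₀ + τ)) q ∧ q t₀ = p := by
  obtain ⟨δ, hδ, h⟩ := exists_isSolution_of_small K lam
  set x := evolve (flow (-t₀) p) with hx
  have hc := continuous_measureReal_Icc (timeMeasure x) t₀ 0 self_mem_Ici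
  have h0 : (timeMeasure x).real (Icc (t₀ - 0) (t₀ + 0)) = 0 := by simp [measureReal_def]
  rw [ContinuousWithinAt, h0] at hc
  have hev := (hc.mono_left (nhdsWithin_mono 0 Ioi_subset_Ici_self)).eventually
    (gt_mem_nhds (by positivity : (0 : ℝ) < δ ^ 4))
  obtain ⟨τ, hτ, hτ0⟩ := (hev.and self_mem_nhdsWithin).exists
  obtain ⟨q, -, hq, hq0, -⟩ := h (Icc (t₀ - τ) (t₀ + τ)) t₀ p ordConnected_Icc (by
    rw [← pow_four_norm_cut_strichartz x measurableSet_Icc] at hτ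
    exact le_of_pow_le_pow_left₀ (by norm_num) hδ.le hτ.le)
  exact ⟨τ, hτ0, q, hq, hq0⟩

/-! ### Conservation of mass -/

theorem dualPairing_cut {E : Set ℝ} (hE : MeasurableSet E) (x : StrichartzSpace) (f : DualSpace) :
    dualPairing (cut E x) f = dualPairing x (cut E f) := by
  rw [dualPairing_apply, dualPairing_apply]
  apply integral_congr_ae
  filter_upwards [coeFn_cut hE x, coeFn_cut hE f] with z h1 h2
  rw [h1, h2]
  by_cases hz : z ∈ Prod.fst ⁻¹' E <;> simp [hz]

/-- F(x) is a real multiple of x at each point, so −iF(x) is orthogonal to x there. -/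
theorem dualPairing_force (K lam : ℝ) (x : StrichartzSpace) : dualPairing x (force K lam x) = 0 := by
  have h : ∀ (c : ℝ) (w : ℂ), inner ℝ w (-Complex.I * ((c : ℂ) * w)) = 0 := by
    intro c w
    rw [Complex.inner]
    simp
    ring
  rw [dualPairing_apply]
  apply integral_eq_zero_of_ae
  filter_upwards [coeFn_force K lam x] with z hz
  rw [hz]
  exact h _ _

/-- A function whose increments are bounded by the power `3/2` of those of a continuous function is
constant. -/
theorem eq_of_abs_sub_le_rpow {M G : ℝ → ℝ} {a b C : ℝ} (hab : a ≤ b) (hG : Continuous G)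
    (hmono : Monotone G) (h : ∀ s t, a ≤ s → s ≤ t → t ≤ b →
      |M t - M s| ≤ C * (G t - G s) ^ (3 / 2 : ℝ)) : M a = M b := by
  -- Halving the increment of G splits the estimate into two parts, each smaller by (1/2)^{3/2}.
  -- Since the exponent exceeds one, θ < 1, and iterating drives the bound to 0.
  set θ : ℝ := 2 * (1 / 2) ^ (3 / 2 : ℝ) with hθ
  have hθ1 : θ < 1 := by
    have h1 : (1 / 2 : ℝ) ^ (3 / 2 : ℝ) = 1 / 2 * (1 / 2) ^ (1 / 2 : ℝ) := by
      rw [← Real.rpow_one_add' (by norm_num) (by norm_num)]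
      norm_num
    have h2 : (1 / 2 : ℝ) ^ (1 / 2 : ℝ) < 1 :=
      Real.rpow_lt_one (by norm_num) (by norm_num) (by norm_num)
    rw [hθ, h1]
    linarith
  have hθ0 : 0 ≤ θ := by positivity
  have key : ∀ k : ℕ, ∀ s t, a ≤ s → s ≤ t → t ≤ b →
      |M t - M s| ≤ C * (G t - G s) ^ (3 / 2 : ℝ) * θ ^ k := by
    intro k
    induction k with
    | zero => simpa using h
    | succ k ih =>
      intro s t hs hst ht
      obtain ⟨c, hc, hcm⟩ := intermediate_value_Icc hst hG.continuousOn
        (⟨by linarith [hmono hst], by linarith [hmono hst]⟩ :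
          (G s + G t) / 2 ∈ Icc (G s) (G t))
      have h1 := ih s c hs hc.1 (hc.2.trans ht)
      have h2 := ih c t (hs.trans hc.1) hc.2 ht
      have hD : 0 ≤ G t - G s := sub_nonneg.2 (hmono hst)
      have e1 : G c - G s = 1 / 2 * (G t - G s) := by rw [hcm]; ring
      have e2 : G t - G c = 1 / 2 * (G t - G s) := by rw [hcm]; ring
      rw [e1, Real.mul_rpow (by norm_num) hD] at h1
      rw [e2, Real.mul_rpow (by norm_num) hD] at h2
      have h3 : |M t - M s| ≤ |M t - M c| + |M c - M s| := by
        have := abs_add_le (M t - M c) (M c - M s)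
        rwa [sub_add_sub_cancel] at this
      calc |M t - M s| ≤ _ := h3
        _ ≤ _ := add_le_add h2 h1
        _ = C * (G t - G s) ^ (3 / 2 : ℝ) * θ ^ (k + 1) := by rw [hθ]; ring
  have hlim : Tendsto (fun k : ℕ => C * (G b - G a) ^ (3 / 2 : ℝ) * θ ^ k) atTop (𝓝 0) := by
    have := (tendsto_pow_atTop_nhds_zero_of_lt_one hθ0 hθ1).const_mul
      (C * (G b - G a) ^ (3 / 2 : ℝ))
    rwa [mul_zero] at this
  have h0 : |M b - M a| ≤ 0 := ge_of_tendsto' hlim fun k => key k a b le_rfl hab le_rfl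
  exact (sub_eq_zero.1 (abs_nonpos_iff.1 h0)).symm

/-- With profile p at time s and force g on (s, t], the increment is 2⟨p, evolveDual g⟩ +
‖evolveDual g‖². The cross term is the pairing of the free wave with g; as the full solution is
orthogonal to g, it equals minus the pairing of the Duhamel term with g, which is quadratic. Hence
60 = 2·28 + 4. -/
theorem abs_mass_sub_le {a b s t : ℝ} (has : a ≤ s) (hst : s ≤ t) (htb : t ≤ b)
    {q : ℝ → RadialL2} (h : IsSolution K lam (Icc a b) q) {x : StrichartzSpace}
    (hx : IsVersion x ((Icc a b).indicator q)) :
    |‖q t‖ ^ 2 - ‖q s‖ ^ 2| ≤ 60 * ‖cut (Ioc s t) (force K lam x)‖ ^ 2 := by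
  have hm : MeasurableSet (Ioc s t) := measurableSet_Ioc
  set f := force K lam x with hf
  set p := flow (-s) (q s) with hp
  have hsm : s ∈ Icc a b := ⟨has, hst.trans htb⟩
  have hprof : ∀ τ ∈ Icc s t, flow (-τ) (q τ) = p + evolveDual (cut (Ioc s τ) f) := by
    intro τ hτ
    rw [h.profile hx hsm (⟨has.trans hτ.1, hτ.2.trans htb⟩ : τ ∈ Icc a b),
      partialDual_sub_partialDual hτ.1]
  set g := cut (Ioc s t) f with hg
  have hgc : ∀ τ ≤ t, cut (Ioc s τ) g = cut (Ioc s τ) f := by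
    intro τ hτ
    rw [hg, cut_cut measurableSet_Ioc measurableSet_Ioc,
      inter_eq_left.2 (Ioc_subset_Ioc_right hτ)]
  set y := cut (Ioc s t) x with hy
  have hyf : force K lam y = g := force_cut K lam hm x
  have hsub : Ioc s t ⊆ Icc a b := fun τ hτ => ⟨has.trans hτ.1.le, hτ.2.trans htb⟩
  have hyeq : y = cut (Ioc s t) (evolve p + duhamel s g) := by
    refine IsVersion.eq_cut hm (hx.cut hm hsub) fun τ hτ => ?_
    rw [hprof τ ⟨hτ.1.le, hτ.2⟩, partialDual_sub_partialDual hτ.1.le, hgc τ hτ.2]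
  have hgg : cut (Ioc s t) g = g := hgc t le_rfl
  have h0 : dualPairing (evolve p) g = -dualPairing (duhamel s g) g := by
    have h1 := dualPairing_force K lam y
    rw [hyf, hyeq, dualPairing_cut hm, hgg, map_add] at h1
    exact eq_neg_of_add_eq_zero_left h1
  have h2 : |dualPairing (evolve p) g| ≤ 28 * ‖g‖ ^ 2 := by
    rw [h0, abs_neg]
    refine (abs_dualPairing_le _ _).trans ?_
    rw [sq, ← mul_assoc]
    gcongr
    exact norm_duhamel_le _ _
  have hQt : ‖q t‖ = ‖p + evolveDual g‖ := by
    rw [← norm_flow (-t) (q t), hprof t (right_mem_Icc.2 hst)]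
  have hQs : ‖q s‖ = ‖p‖ := by rw [hp, norm_flow]
  have h3 := norm_evolveDual_le g
  have h4 : ‖evolveDual g‖ ^ 2 ≤ 4 * ‖g‖ ^ 2 := by
    calc ‖evolveDual g‖ ^ 2 ≤ (2 * ‖g‖) ^ 2 := by gcongr
      _ = _ := by ring
  rw [hQt, hQs, norm_add_sq_real, real_inner_comm, inner_evolveDual, abs_le]
  rw [abs_le] at h2
  constructor <;> nlinarith [sq_nonneg ‖evolveDual g‖]

theorem IsSolution.norm_eq_of_le {I : Set ℝ} {q : ℝ → RadialL2} (h : IsSolution K lam I q) {a b : ℝ}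
    (ha : a ∈ I) (hb : b ∈ I) (hab : a ≤ b) : ‖q a‖ = ‖q b‖ := by
  obtain ⟨x, hx⟩ := h.exists_isVersion_Icc ha hb
  have h' : IsSolution K lam (Icc a b) q :=
    IsForcedSolution.mono h ordConnected_Icc (h.ordConnected.out ha hb)
  set μ := timeMeasure (force K lam x) with hμ
  have hsq : ‖q a‖ ^ 2 = ‖q b‖ ^ 2 := by
    refine eq_of_abs_sub_le_rpow (M := fun t => ‖q t‖ ^ 2) (G := fun t => μ.real (Iic t)) (C := 60)
      hab (continuous_measureReal_Iic μ) (fun s t hst => measureReal_mono (Iic_subset_Iic.2 hst))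
      fun s t hs hst ht => ?_
    refine (abs_mass_sub_le hs hst ht h' hx).trans_eq ?_
    rw [← measureReal_Ioc_eq μ hst, norm_cut_eq _ measurableSet_Ioc, ← Real.rpow_natCast,
      ← Real.rpow_mul measureReal_nonneg]
    norm_num
    rfl
  exact (pow_left_inj₀ (norm_nonneg _) (norm_nonneg _) two_ne_zero).1 hsq

theorem IsSolution.norm_eq {I : Set ℝ} {q : ℝ → RadialL2} (h : IsSolution K lam I q) {a b : ℝ}
    (ha : a ∈ I) (hb : b ∈ I) : ‖q a‖ = ‖q b‖ := by
  rcases le_total a b with hab | hab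
  · exact h.norm_eq_of_le ha hb hab
  · exact (h.norm_eq_of_le hb ha hab).symm

/-! ### Maximal solutions -/

/-- The end points are the infimum and supremum in the extended reals; openness makes the
inequalities strict. -/
theorem exists_lifespan_eq {U : Set ℝ} (hU : IsOpen U) (hc : U.OrdConnected) (h0 : (0 : ℝ) ∈ U) :
    ∃ Tmin Tmax : EReal, Tmin < 0 ∧ 0 < Tmax ∧ lifespan Tmin Tmax = U := by
  have hmem : ∀ t ∈ U, sInf (((↑) : ℝ → EReal) '' U) < (t : EReal) ∧
      (t : EReal) < sSup (((↑) : ℝ → EReal) '' U) := by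
    intro t ht
    obtain ⟨ε, hε, hball⟩ := Metric.isOpen_iff.1 hU t ht
    have h1 : t - ε / 2 ∈ U := hball (by
      rw [Metric.mem_ball, Real.dist_eq, abs_lt]; constructor <;> linarith)
    have h2 : t + ε / 2 ∈ U := hball (by
      rw [Metric.mem_ball, Real.dist_eq, abs_lt]; constructor <;> linarith)
    exact ⟨(sInf_le (mem_image_of_mem _ h1)).trans_lt (EReal.coe_lt_coe_iff.2 (by linarith)),
      (EReal.coe_lt_coe_iff.2 (by linarith)).trans_le (le_sSup (mem_image_of_mem _ h2))⟩
  refine ⟨_, _, (hmem 0 h0).1, (hmem 0 h0).2, Subset.antisymm ?_ hmem⟩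
  rintro t ⟨h1, h2⟩
  obtain ⟨_, ⟨a, ha, rfl⟩, hat⟩ := sInf_lt_iff.1 h1
  obtain ⟨_, ⟨b, hb, rfl⟩, htb⟩ := lt_sSup_iff.1 h2
  exact hc.out ha hb ⟨(EReal.coe_lt_coe_iff.1 hat).le, (EReal.coe_lt_coe_iff.1 htb).le⟩

theorem IsMaximalSolution.zero_mem {q₀ : RadialL2} {Tmin Tmax : EReal} {q : ℝ → RadialL2}
    (h : IsMaximalSolution K lam q₀ Tmin Tmax q) : (0 : ℝ) ∈ lifespan Tmin Tmax :=
  ⟨h.Tmin_neg, h.Tmax_pos⟩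

/-- Gluing p to q gives an extension of q, which maximality forces to live on the same interval. -/
theorem IsMaximalSolution.subset_and_eqOn {q₀ : RadialL2} {Tmin Tmax : EReal} {q : ℝ → RadialL2}
    (h : IsMaximalSolution K lam q₀ Tmin Tmax q) {J : Set ℝ} {p : ℝ → RadialL2} (hJ : 0 ∈ J)
    (hp : IsSolution K lam J p) (hp0 : p 0 = q₀) :
    J ⊆ lifespan Tmin Tmax ∧ EqOn p q J := by
  obtain ⟨z, hz, hzq, hzp⟩ := h.isSolution.exists_union hp ⟨h.zero_mem, hJ⟩ (h.initial.trans hp0.symm)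
  have hJL : J ⊆ lifespan Tmin Tmax := by
    rw [← h.maximal _ z subset_union_left hz hzq]
    exact subset_union_right
  exact ⟨hJL, fun t ht => (hzp ht).symm.trans (hzq (hJL ht))⟩

/-- Take the union of the intervals of all solutions through q₀. Uniqueness makes them agree, gluing
pairs makes the union an interval carrying a solution, and local existence at each of its times
makes it open. -/
theorem exists_isMaximalSolution (K lam : ℝ) (q₀ : RadialL2) :
    ∃ (Tmin Tmax : EReal) (q : ℝ → RadialL2), IsMaximalSolution K lam q₀ Tmin Tmax q := by
  classical
  set S : Set ℝ → (ℝ → RadialL2) → Prop := fun J p => IsSolution K lam J p ∧ 0 ∈ J ∧ p 0 = q₀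
  have hunion : ∀ {J J' p p'}, S J p → S J' p' →
      ∃ z, S (J ∪ J') z ∧ EqOn z p J ∧ EqOn z p' J' := by
    intro J J' p p' h h'
    obtain ⟨z, hz, hz1, hz2⟩ := h.1.exists_union h'.1 ⟨h.2.1, h'.2.1⟩ (h.2.2.trans h'.2.2.symm)
    exact ⟨z, ⟨hz, Or.inl h.2.1, (hz1 h.2.1).trans h.2.2⟩, hz1, hz2⟩
  set U : Set ℝ := {t | ∃ J p, S J p ∧ t ∈ J} with hU
  choose! J p hS hJ using fun t (ht : t ∈ U) => ht
  set q : ℝ → RadialL2 := fun t => p t t with hq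
  have hSU : ∀ {J p}, S J p → J ⊆ U := fun h t ht => ⟨_, _, h, ht⟩
  have heq : ∀ {J' p'}, S J' p' → EqOn q p' J' := by
    intro J' p' h t ht
    have htU : t ∈ U := hSU h ht
    exact (hS t htU).1.eqOn h.1 ⟨(hS t htU).2.1, h.2.1⟩ ((hS t htU).2.2.trans h.2.2.symm)
      ⟨hJ t htU, ht⟩
  obtain ⟨τ, hτ, p₀, hp₀, hp₀0⟩ := exists_local_isSolution K lam 0 q₀
  have hS0 : S (Icc (0 - τ) (0 + τ)) p₀ := ⟨hp₀, ⟨by linarith, by linarith⟩, hp₀0⟩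
  have h0 : (0 : ℝ) ∈ U := hSU hS0 hS0.2.1
  have hpair : ∀ a ∈ U, ∀ b ∈ U, ∃ J z, S J z ∧ a ∈ J ∧ b ∈ J := by
    intro a ha b hb
    obtain ⟨z, hz, -⟩ := hunion (hS a ha) (hS b hb)
    exact ⟨_, z, hz, Or.inl (hJ a ha), Or.inr (hJ b hb)⟩
  have hUo : U.OrdConnected := by
    refine ⟨fun a ha b hb => ?_⟩
    obtain ⟨J', z, hz, haJ, hbJ⟩ := hpair a ha b hb
    exact (hz.1.ordConnected.out haJ hbJ).trans (hSU hz)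
  have hUsol : IsSolution K lam U q := by
    refine isSolution_of_forall_Icc hUo fun a ha b hb _ => ?_
    obtain ⟨J', z, hz, haJ, hbJ⟩ := hpair a ha b hb
    have hsub := hz.1.ordConnected.out haJ hbJ
    exact IsSolution.congr (IsForcedSolution.mono hz.1 ordConnected_Icc hsub)
      ((heq hz).mono hsub)
  have hUopen : IsOpen U := by
    rw [Metric.isOpen_iff]
    intro t ht
    obtain ⟨τ, hτ, r, hr, hrt⟩ := exists_local_isSolution K lam t (q t)
    have htI : t ∈ Icc (t - τ) (t + τ) := ⟨by linarith, by linarith⟩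
    obtain ⟨z, hz, hzq, -⟩ := hUsol.exists_union hr ⟨ht, htI⟩ hrt.symm
    have hzS : S (U ∪ Icc (t - τ) (t + τ)) z :=
      ⟨hz, Or.inl h0, (hzq h0).trans ((heq hS0 hS0.2.1).trans hS0.2.2)⟩
    refine ⟨τ, hτ, fun s hs => hSU hzS (Or.inr ?_)⟩
    rw [Metric.mem_ball, Real.dist_eq, abs_lt] at hs
    exact ⟨by linarith [hs.1], by linarith [hs.2]⟩
  obtain ⟨Tmin, Tmax, hmin, hmax, hL⟩ := exists_lifespan_eq hUopen hUo h0
  have hq0 : q 0 = q₀ := (heq hS0 hS0.2.1).trans hS0.2.2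
  refine ⟨Tmin, Tmax, q, hmin, hmax, hL ▸ hUsol, hq0, fun J' p' hsub hp' hpq => ?_⟩
  rw [hL] at hsub hpq ⊢
  exact Subset.antisymm (hSU ⟨hp', hsub h0, (hpq h0).trans hq0⟩) hsub

/-! ### Blow-up criterion and scattering -/

/-- A solution of finite scattering size extends to the end points of its interval. -/
theorem IsSolution.exists_extension {I J : Set ℝ} {q : ℝ → RadialL2} (h : IsSolution K lam I q)
    (h0 : (0 : ℝ) ∈ I) (hfin : scatteringSize I q < ∞) (hIJ : I ⊆ J) (hJ : J.OrdConnected)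
    (hnull : volume (J \ I) = 0) :
    ∃ p : ℝ → RadialL2, IsSolution K lam J p ∧ p 0 = q 0 := by
  obtain ⟨x, hx⟩ := IsForcedSolution.exists_isVersion h hfin
  have hxI : x = cut I (evolve (flow (-0) (q 0)) + duhamel 0 (force K lam x)) :=
    IsVersion.eq_cut h.measurableSet hx fun t ht => h.profile hx h0 ht
  -- J exceeds I by a null set, so the Duhamel equation on I is already the equation on J.
  have hcut : ∀ z : StrichartzSpace, cut J z = cut I z := by
    intro z
    apply Lp.ext
    refine ae_eq_of_slices (Lp.aestronglyMeasurable _) (Lp.aestronglyMeasurable _) ?_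
    filter_upwards [ae_slices (coeFn_cut h.measurableSet z),
      ae_slices (coeFn_cut hJ.measurableSet z), compl_mem_ae_iff.2 hnull] with t h1 h2 h3
    filter_upwards [h1, h2] with r h4 h5
    rw [h4, h5]
    have hiff : (t, r) ∈ Prod.fst ⁻¹' J ↔ (t, r) ∈ Prod.fst ⁻¹' I :=
      ⟨fun ht => by by_contra hI; exact h3 ⟨ht, hI⟩, fun ht => hIJ ht⟩
    by_cases hm : (t, r) ∈ Prod.fst ⁻¹' I
    · rw [indicator_of_mem hm, indicator_of_mem (hiff.2 hm)]
    · rw [indicator_of_notMem hm, indicator_of_notMem (fun h => hm (hiff.1 h))]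
  rw [← hcut] at hxI
  obtain ⟨p, hp, hp0, -⟩ := exists_isSolution_of_eq_cut hJ (q 0) hxI
  exact ⟨p, hp, hp0⟩

/-! ### Limits of the profile at infinite times -/

theorem tendsto_partialDual_atTop (f : DualSpace) :
    Tendsto (fun t => partialDual t f) atTop (𝓝 (evolveDual f)) := by
  set μ := timeMeasure f with hμ
  have h1 : Tendsto (fun t => μ.real (Ioi t)) atTop (𝓝 0) := by
    have h2 : Tendsto (fun t => μ.real (Iic t)) atTop (𝓝 (μ.real univ)) :=
      (ENNReal.tendsto_toReal (measure_ne_top μ univ)).comp (tendsto_measure_Iic_atTop μ)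
    have h3 := (tendsto_const_nhds (x := μ.real univ)).sub h2
    rw [sub_self] at h3
    refine h3.congr fun t => ?_
    rw [← measureReal_compl measurableSet_Iic, compl_Iic]
  have h4 : Tendsto (fun t => 2 * μ.real (Ioi t) ^ (3 / 4 : ℝ)) atTop (𝓝 0) := by
    have h5 := (h1.rpow_const (p := 3 / 4) (Or.inr (by norm_num))).const_mul 2
    rwa [Real.zero_rpow (by norm_num), mul_zero] at h5
  rw [tendsto_iff_norm_sub_tendsto_zero]
  refine squeeze_zero (fun _ => norm_nonneg _) (fun t => ?_) h4
  rw [norm_sub_rev, partialDual, ← map_sub]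
  nth_rewrite 1 [← cut_univ f]
  rw [cut_sub_cut measurableSet_Iic MeasurableSet.univ (subset_univ _), ← compl_eq_univ_sdiff,
    compl_Iic, ← norm_cut_eq f measurableSet_Ioi]
  exact norm_evolveDual_le _

theorem tendsto_partialDual_atBot (f : DualSpace) :
    Tendsto (fun t => partialDual t f) atBot (𝓝 0) := by
  set μ := timeMeasure f with hμ
  have h1 : Tendsto (fun t => μ.real (Iic t)) atBot (𝓝 0) := by
    have h2 : Tendsto (fun t => μ.real (Ici t)) atBot (𝓝 (μ.real univ)) :=
      (ENNReal.tendsto_toReal (measure_ne_top μ univ)).comp (tendsto_measure_Ici_atBot μ)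
    have h3 := (tendsto_const_nhds (x := μ.real univ)).sub h2
    rw [sub_self] at h3
    refine h3.congr fun t => ?_
    rw [← measureReal_congr (Ioi_ae_eq_Ici (μ := μ) (a := t)), ← measureReal_compl measurableSet_Ioi,
      compl_Ioi]
  have h4 : Tendsto (fun t => 2 * μ.real (Iic t) ^ (3 / 4 : ℝ)) atBot (𝓝 0) := by
    have h5 := (h1.rpow_const (p := 3 / 4) (Or.inr (by norm_num))).const_mul 2
    rwa [Real.zero_rpow (by norm_num), mul_zero] at h5
  refine squeeze_zero_norm (fun t => ?_) h4
  rw [partialDual, ← norm_cut_eq f measurableSet_Iic]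
  exact norm_evolveDual_le _

theorem scatters_of_tendsto {q : ℝ → RadialL2} {l : Filter ℝ} {p : RadialL2}
    (h : Tendsto (fun t => flow (-t) (q t)) l (𝓝 p)) : Scatters q l := by
  refine ⟨p, ?_⟩
  have h1 := (tendsto_iff_norm_sub_tendsto_zero.1 h).const_mul √(2 * Real.pi)
  rw [mul_zero] at h1
  refine h1.congr fun t => ?_
  rw [← vortexL2_flow, ← vortexL2_sub, norm_vortexL2, ← norm_flow (-t) (q t - flow t p), map_sub,
    flow_flow, neg_add_cancel, flow_zero]

theorem IsSolution.scatters {I : Set ℝ} {q : ℝ → RadialL2} (h : IsSolution K lam I q)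
    (h0 : (0 : ℝ) ∈ I) (hfin : scatteringSize I q < ∞) {l : Filter ℝ} (hl : I ∈ l)
    (hlim : ∀ f : DualSpace, ∃ g, Tendsto (fun t => partialDual t f) l (𝓝 g)) :
    Scatters q l := by
  obtain ⟨x, hx⟩ := IsForcedSolution.exists_isVersion h hfin
  obtain ⟨g, hg⟩ := hlim (force K lam x)
  refine scatters_of_tendsto (Tendsto.congr' ?_
    ((hg.sub_const (partialDual 0 (force K lam x))).const_add (flow (-0) (q 0))))
  filter_upwards [hl] with t ht
  exact (h.profile hx h0 ht).symm

/-! ### Stability -/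

theorem enorm_pow_four_le_ofReal_iff {x : StrichartzSpace} {a : ℝ} (ha : 0 ≤ a) :
    ‖x‖ₑ ^ 4 ≤ ENNReal.ofReal a ↔ ‖x‖ ^ 4 ≤ a := by
  rw [← ofReal_norm, ← ENNReal.ofReal_pow (norm_nonneg _), ENNReal.ofReal_le_ofReal_iff ha]

/-- The difference w = v − u solves the perturbed Duhamel equation whose inhomogeneity is minus the
free wave of u(t₀) − v₀ minus the Duhamel term of the forcing; both are small by hypothesis. -/
theorem exists_stability (K lam A : ℝ) : ∀ ε > (0 : ℝ), ∃ δ > (0 : ℝ),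
    ∀ (I : Set ℝ) (u : ℝ → RadialL2) (e : ℝ → ℝ → ℂ) (t₀ : ℝ) (v₀ : RadialL2)
      (x : StrichartzSpace) (g : DualSpace), t₀ ∈ I → IsForcedSolution K lam I u e →
      IsVersion x (I.indicator u) →
      (∀ᵐ s : ℝ, s ∈ I →
        (fun r => g (s, r)) =ᵐ[radialMeasure] fun r => -Complex.I * e s r) →
      ‖x‖ ^ 4 ≤ A → ‖g‖ ≤ δ → ‖cut I (evolve (flow (-t₀) (u t₀ - v₀)))‖ ≤ δ →
      ∃ (v : ℝ → RadialL2) (y : StrichartzSpace), IsSolution K lam I v ∧ v t₀ = v₀ ∧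
        IsVersion y (I.indicator v) ∧ ‖y - x‖ ≤ ε := by
  intro ε hε
  obtain ⟨δ, hδ, h⟩ := exists_perturbation K lam A ε hε
  -- 29 = 1 + 28: the free wave contributes once, the forcing through the Duhamel bound.
  refine ⟨δ / 29, by positivity, fun I u e t₀ v₀ x g h₀ hu hx hg hA hgn hev => ?_⟩
  have hI := hu.measurableSet
  have hxeq : x = cut I (evolve (flow (-t₀) (u t₀)) + duhamel t₀ (force K lam x + g)) :=
    IsVersion.eq_cut hI hx fun t ht => hu.profile hx hg h₀ ht
  set ω : StrichartzSpace := -evolve (flow (-t₀) (u t₀ - v₀)) - duhamel t₀ g with hω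
  have hωn : ‖cut I ω‖ ≤ δ := by
    rw [hω, cut_sub, cut_neg]
    refine (norm_sub_le _ _).trans ?_
    rw [norm_neg]
    have h1 : ‖cut I (duhamel t₀ g)‖ ≤ ‖duhamel t₀ g‖ := norm_cut_le (by simp) _ _
    have h2 := norm_duhamel_le t₀ g
    linarith
  obtain ⟨w, hw, hwε⟩ := h t₀ I x ω hI hA hωn
  have hy : x + w = cut I (evolve (flow (-t₀) v₀) + duhamel t₀ (force K lam (x + w))) := by
    conv_lhs => rw [hxeq, hw]
    rw [← cut_add, hω, duhamel_add, duhamel_sub, map_sub (flow (-t₀)), map_sub evolve]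
    congr 1
    abel
  obtain ⟨v, hv, hv0, hver⟩ := exists_isSolution_of_eq_cut hu.ordConnected v₀ hy
  exact ⟨v, x + w, hv, hv0, hver, by rwa [add_sub_cancel_left]⟩

/-! ### Passing between norms on I and the space-time Lebesgue spaces -/

theorem exists_isVersion_force {I : Set ℝ} (hI : MeasurableSet I) {e : ℝ → ℝ → ℂ} {δ : ℝ}
    (hδ : 0 ≤ δ)
    (hm : AEStronglyMeasurable (Function.uncurry e) ((volume.restrict I).prod radialMeasure))
    (hn : eLpNorm (Function.uncurry e) (4 / 3) ((volume.restrict I).prod radialMeasure) ≤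
      ENNReal.ofReal δ) :
    ∃ g : DualSpace, ‖g‖ ≤ δ ∧ ∀ᵐ s : ℝ, s ∈ I →
      (fun r => g (s, r)) =ᵐ[radialMeasure] fun r => -Complex.I * e s r := by
  have hrestr : (volume.restrict I).prod radialMeasure = spacetime.restrict (I ×ˢ univ) := by
    rw [← Measure.prod_restrict, Measure.restrict_univ]
  have hIu : MeasurableSet (I ×ˢ (univ : Set ℝ)) := hI.prod MeasurableSet.univ
  rw [hrestr] at hm hn
  set G : ℝ × ℝ → ℂ := (I ×ˢ (univ : Set ℝ)).indicator
    (fun z => -Complex.I * Function.uncurry e z) with hG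
  have hGn : eLpNorm G (4 / 3) spacetime ≤ ENNReal.ofReal δ := by
    rw [hG, eLpNorm_indicator_eq_eLpNorm_restrict hIu]
    refine le_trans (le_of_eq ?_) hn
    refine eLpNorm_congr_enorm_ae (Eventually.of_forall fun z => ?_)
    rw [enorm_mul]
    simp [← ofReal_norm]
  have hGm : MemLp G (4 / 3) spacetime := by
    refine ⟨?_, hGn.trans_lt ENNReal.ofReal_lt_top⟩
    rw [hG, aestronglyMeasurable_indicator_iff hIu]
    exact hm.const_mul _
  refine ⟨hGm.toLp, ?_, ?_⟩
  · rw [← ENNReal.ofReal_le_ofReal_iff hδ, ofReal_norm, Lp.enorm_def,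
      eLpNorm_congr_ae hGm.coeFn_toLp]
    exact hGn
  · filter_upwards [ae_slices hGm.coeFn_toLp] with s hs hsI
    filter_upwards [hs] with r hr
    rw [hr, hG, indicator_of_mem (by simpa using hsI)]
    rfl

theorem pow_four_norm_cut_evolve_le {I : Set ℝ} (hI : MeasurableSet I) {t₀ δ : ℝ} (hδ : 0 ≤ δ)
    {p : RadialL2}
    (h : (∫⁻ t in I, ∫⁻ x : ℂ, ‖freeL2 (t - t₀) (vortexL2 p) x‖ₑ ^ 4) ≤ ENNReal.ofReal δ) :
    ‖cut I (evolve (flow (-t₀) p))‖ ^ 4 ≤ δ := by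
  have hv : IsVersion (cut I (evolve (flow (-t₀) p)))
      (I.indicator fun t => flow t (flow (-t₀) p)) :=
    IsVersion.cut (I := univ) hI (subset_univ I) (by
      rw [indicator_univ]; exact isVersion_evolve (flow (-t₀) p))
  rw [← enorm_pow_four_le_ofReal_iff hδ, hv.enorm_pow_four_eq hI]
  refine le_trans ?_ h
  refine lintegral_mono fun t => ?_
  dsimp only
  rw [lintegral_freeL2_vortexL2, flow_flow, ← sub_eq_add_neg]
  refine le_mul_of_one_le_left zero_le ?_
  rw [ENNReal.one_le_ofReal]
  linarith [Real.pi_gt_three]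

theorem scatteringSize_sub_eq {I : Set ℝ} (hI : MeasurableSet I) {u v : ℝ → RadialL2}
    {x y : StrichartzSpace} (hx : IsVersion x (I.indicator u)) (hy : IsVersion y (I.indicator v)) :
    scatteringSize I (fun t => u t - v t) = ‖y - x‖ₑ ^ 4 := by
  have h : IsVersion (x - y : StrichartzSpace) (I.indicator fun t => u t - v t) := by
    rw [show (I.indicator fun t => u t - v t) = I.indicator u - I.indicator v from
      indicator_sub' I u v]
    exact hx.sub hy
  rw [← h.enorm_pow_four_eq hI, enorm_sub_rev]

/-- Continuous dependence on the data. -/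
theorem IsMaximalSolution.continuous_dependence {q₀ : RadialL2} {Tmin Tmax : EReal}
    {q : ℝ → RadialL2} (h : IsMaximalSolution K lam q₀ Tmin Tmax q) {t : ℝ}
    (ht : t ∈ lifespan Tmin Tmax) {ε : ℝ} (hε : 0 < ε) :
    ∃ δ > 0, ∀ (p₀ : RadialL2) (Smin Smax : EReal) (p : ℝ → RadialL2),
      IsMaximalSolution K lam p₀ Smin Smax p → ‖p₀ - q₀‖ < δ →
      t ∈ lifespan Smin Smax ∧ ‖p t - q t‖ < ε := by
  set I := uIcc 0 t with hI
  have hsol : IsSolution K lam I q := IsForcedSolution.mono h.isSolution ordConnected_uIcc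
    (h.isSolution.ordConnected.uIcc_subset h.zero_mem ht)
  have h0I : (0 : ℝ) ∈ I := left_mem_uIcc
  have htI : t ∈ I := right_mem_uIcc
  have hmin : 0 ⊓ t ∈ I := left_mem_Icc.2 inf_le_sup
  have hmax : 0 ⊔ t ∈ I := right_mem_Icc.2 inf_le_sup
  obtain ⟨x, hx⟩ : ∃ x : StrichartzSpace, IsVersion x (I.indicator q) :=
    hsol.exists_isVersion_Icc hmin hmax
  -- The leading 4 = 2 + 2 bounds the two `partialDual` terms; the rest is the Lipschitz constant of
  -- the force when ‖y‖ ≤ ‖x‖ + 1.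
  set M : ℝ := 4 * (4 * (|K| + |lam|) * (2 * ‖x‖ + 1) ^ 2) with hM
  have hM0 : 0 ≤ M := by positivity
  set ε₁ : ℝ := min 1 (ε / (2 * (M + 1))) with hε₁
  have hε₁0 : 0 < ε₁ := by positivity
  have hMε : M * ε₁ ≤ ε / 2 := by
    have h1 : (M + 1) * ε₁ ≤ ε / 2 := by
      calc (M + 1) * ε₁ ≤ (M + 1) * (ε / (2 * (M + 1))) := by gcongr; exact min_le_right _ _
        _ = ε / 2 := by field_simp
    linarith
  obtain ⟨δ, hδ, hstab⟩ := exists_stability K lam (‖x‖ ^ 4) ε₁ hε₁0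
  refine ⟨min (δ / 2) (ε / 2), by positivity, fun p₀ Smin Smax p hp hpq => ?_⟩
  have hpq1 : ‖p₀ - q₀‖ < δ / 2 := hpq.trans_le (min_le_left _ _)
  have hpq2 : ‖p₀ - q₀‖ < ε / 2 := hpq.trans_le (min_le_right _ _)
  obtain ⟨v, y, hv, hv0, hy, hyx⟩ := hstab I q (fun _ _ => 0) 0 p₀ x 0 h0I hsol hx
    (ae_zero_force I) le_rfl (by rw [norm_zero]; exact hδ.le) (by
      have h1 : ‖cut I (evolve (flow (-0) (q 0 - p₀)))‖ ≤ ‖evolve (flow (-0) (q 0 - p₀))‖ :=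
        norm_cut_le (by simp) _ _
      have h2 := norm_evolve_le (flow (-0) (q 0 - p₀))
      rw [norm_flow, h.initial, norm_sub_rev] at h2
      rw [h.initial] at h1 ⊢
      linarith)
  obtain ⟨hIS, hvp⟩ := hp.subset_and_eqOn h0I hv hv0
  refine ⟨hIS htI, ?_⟩
  have e1 := hv.profile hy h0I htI
  have e2 := hsol.profile hx h0I htI
  have e3 : flow (-t) (v t) - flow (-t) (q t) = flow (-0) (p₀ - q₀) +
      (partialDual t (force K lam y - force K lam x) -
        partialDual 0 (force K lam y - force K lam x)) := by
    rw [e1, e2, hv0, h.initial, map_sub, partialDual_sub, partialDual_sub]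
    abel
  have hyn : ‖y‖ ≤ ‖x‖ + 1 := by
    have h1 : ‖y‖ ≤ ‖y - x‖ + ‖x‖ := by
      have := norm_add_le (y - x) x
      rwa [sub_add_cancel] at this
    have h2 : ε₁ ≤ 1 := min_le_left _ _
    linarith
  have hf : 4 * ‖force K lam y - force K lam x‖ ≤ M * ε₁ := by
    have h1 := norm_force_sub_le K lam y x
    have h2 : ‖y‖ + ‖x‖ ≤ 2 * ‖x‖ + 1 := by linarith
    calc 4 * ‖force K lam y - force K lam x‖
        ≤ 4 * (4 * (|K| + |lam|) * (2 * ‖x‖ + 1) ^ 2 * ε₁) := by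
          gcongr
          refine h1.trans ?_
          gcongr
      _ = M * ε₁ := by rw [hM]; ring
  rw [← hvp htI, ← norm_flow (-t) (v t - q t), map_sub, e3]
  have h1 := norm_partialDual_le t (force K lam y - force K lam x)
  have h2 := norm_partialDual_le 0 (force K lam y - force K lam x)
  refine (norm_add_le _ _).trans_lt ?_
  rw [norm_flow]
  have h3 := norm_sub_le (partialDual t (force K lam y - force K lam x))
    (partialDual 0 (force K lam y - force K lam x))
  linarith

/-- Global existence and finite scattering size for small data. -/
theorem exists_small_data (K lam : ℝ) : ∃ η > (0 : ℝ), ∀ (q₀ : RadialL2) (Tmin Tmax : EReal)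
    (q : ℝ → RadialL2), ‖q₀‖ < η → IsMaximalSolution K lam q₀ Tmin Tmax q →
    Tmin = ⊥ ∧ Tmax = ⊤ ∧ scatteringSize univ q < ∞ := by
  obtain ⟨δ, hδ, h⟩ := exists_isSolution_of_small K lam
  refine ⟨δ / 2, by positivity, fun q₀ Tmin Tmax q hq₀ hq => ?_⟩
  obtain ⟨p, x, hp, hp0, hx⟩ := h univ 0 q₀ ordConnected_univ (by
    rw [cut_univ]
    have := norm_evolve_le (flow (-0) q₀)
    rw [norm_flow] at this
    linarith)
  obtain ⟨hsub, hpq⟩ := hq.subset_and_eqOn (mem_univ 0) hp hp0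
  refine ⟨?_, ?_, ?_⟩
  · exact EReal.eq_bot_iff_forall_lt Tmin |>.2 fun t => (hsub (mem_univ t)).1
  · exact EReal.eq_top_iff_forall_lt Tmax |>.2 fun t => (hsub (mem_univ t)).2
  · rw [← scatteringSize_congr MeasurableSet.univ hpq, ← hx.enorm_pow_four_eq MeasurableSet.univ]
    exact ENNReal.pow_lt_top enorm_lt_top

/-! ### Blow-up and scattering for maximal solutions -/

theorem ordConnected_lifespan (Tmin Tmax : EReal) : (lifespan Tmin Tmax).OrdConnected :=
  ⟨fun _ ha _ hb _ ht => ⟨ha.1.trans_le (EReal.coe_le_coe_iff.2 ht.1),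
    (EReal.coe_le_coe_iff.2 ht.2).trans_lt hb.2⟩⟩

/-- With finite size the solution on [0, T) would extend to [0, T], and maximality would put T
inside its own lifespan. -/
theorem IsMaximalSolution.scatteringSize_forward_eq_top {q₀ : RadialL2} {Tmin Tmax : EReal}
    {q : ℝ → RadialL2} (h : IsMaximalSolution K lam q₀ Tmin Tmax q) (hT : Tmax ≠ ⊤) :
    scatteringSize (lifespan Tmin Tmax ∩ Ici 0) q = ∞ := by
  by_contra hne
  have hbot : Tmax ≠ ⊥ := (bot_lt_of_lt h.Tmax_pos).ne'
  obtain ⟨T, rfl⟩ : ∃ T : ℝ, (T : EReal) = Tmax := ⟨Tmax.toReal, EReal.coe_toReal hT hbot⟩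
  have hT0 : 0 < T := EReal.coe_pos.1 h.Tmax_pos
  set I := lifespan Tmin T ∩ Ici 0 with hI
  have hsol : IsSolution K lam I q := IsForcedSolution.mono h.isSolution
    ((ordConnected_lifespan _ _).inter ordConnected_Ici) inter_subset_left
  obtain ⟨p, hp, hp0⟩ := hsol.exists_extension (J := Icc 0 T) ⟨h.zero_mem, self_mem_Ici⟩
    (lt_top_iff_ne_top.2 hne) (fun t ht => ⟨ht.2, (EReal.coe_lt_coe_iff.1 ht.1.2).le⟩)
    ordConnected_Icc (measure_mono_null (t := {T}) (fun t ht => by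
      by_contra hne
      have htT : t < T := lt_of_le_of_ne ht.1.2 hne
      exact ht.2 ⟨⟨h.Tmin_neg.trans_le (EReal.coe_nonneg.2 ht.1.1),
        EReal.coe_lt_coe_iff.2 htT⟩, ht.1.1⟩) (measure_singleton T))
  have := (h.subset_and_eqOn (left_mem_Icc.2 hT0.le) hp (hp0.trans h.initial)).1
    (right_mem_Icc.2 hT0.le)
  exact lt_irrefl _ this.2

theorem IsMaximalSolution.scatteringSize_backward_eq_top {q₀ : RadialL2} {Tmin Tmax : EReal}
    {q : ℝ → RadialL2} (h : IsMaximalSolution K lam q₀ Tmin Tmax q) (hT : Tmin ≠ ⊥) :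
    scatteringSize (lifespan Tmin Tmax ∩ Iic 0) q = ∞ := by
  by_contra hne
  have htop : Tmin ≠ ⊤ := (lt_top_of_lt h.Tmin_neg).ne
  obtain ⟨T, rfl⟩ : ∃ T : ℝ, (T : EReal) = Tmin := ⟨Tmin.toReal, EReal.coe_toReal htop hT⟩
  have hT0 : T < 0 := EReal.coe_neg'.1 h.Tmin_neg
  set I := lifespan T Tmax ∩ Iic 0 with hI
  have hsol : IsSolution K lam I q := IsForcedSolution.mono h.isSolution
    ((ordConnected_lifespan _ _).inter ordConnected_Iic) inter_subset_left
  obtain ⟨p, hp, hp0⟩ := hsol.exists_extension (J := Icc T 0) ⟨h.zero_mem, self_mem_Iic⟩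
    (lt_top_iff_ne_top.2 hne) (fun t ht => ⟨(EReal.coe_lt_coe_iff.1 ht.1.1).le, ht.2⟩)
    ordConnected_Icc (measure_mono_null (t := {T}) (fun t ht => by
      by_contra hne
      have htT : T < t := lt_of_le_of_ne ht.1.1 (Ne.symm hne)
      exact ht.2 ⟨⟨EReal.coe_lt_coe_iff.2 htT,
        lt_of_le_of_lt (EReal.coe_nonpos.2 ht.1.2) h.Tmax_pos⟩, ht.1.2⟩) (measure_singleton T))
  have := (h.subset_and_eqOn (right_mem_Icc.2 hT0.le) hp (hp0.trans h.initial)).1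
    (left_mem_Icc.2 hT0.le)
  exact lt_irrefl _ this.1

theorem IsMaximalSolution.scatters_atTop {q₀ : RadialL2} {Tmin Tmax : EReal}
    {q : ℝ → RadialL2} (h : IsMaximalSolution K lam q₀ Tmin Tmax q) (hT : Tmax = ⊤)
    (hfin : scatteringSize (Ici 0) q < ∞) : Scatters q atTop := by
  have hsub : Ici (0 : ℝ) ⊆ lifespan Tmin Tmax := fun t ht =>
    ⟨h.Tmin_neg.trans_le (EReal.coe_nonneg.2 ht), hT ▸ EReal.coe_lt_top t⟩
  have hsol : IsSolution K lam (Ici 0) q :=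
    IsForcedSolution.mono h.isSolution ordConnected_Ici hsub
  exact hsol.scatters self_mem_Ici hfin (Ici_mem_atTop 0) fun f => ⟨_, tendsto_partialDual_atTop f⟩

theorem IsMaximalSolution.scatters_atBot {q₀ : RadialL2} {Tmin Tmax : EReal}
    {q : ℝ → RadialL2} (h : IsMaximalSolution K lam q₀ Tmin Tmax q) (hT : Tmin = ⊥)
    (hfin : scatteringSize (Iic 0) q < ∞) : Scatters q atBot := by
  have hsub : Iic (0 : ℝ) ⊆ lifespan Tmin Tmax := fun t ht =>
    ⟨hT ▸ EReal.bot_lt_coe t, lt_of_le_of_lt (EReal.coe_nonpos.2 ht) h.Tmax_pos⟩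
  have hsol : IsSolution K lam (Iic 0) q :=
    IsForcedSolution.mono h.isSolution ordConnected_Iic hsub
  exact hsol.scatters self_mem_Iic hfin (Iic_mem_atBot 0) fun f => ⟨_, tendsto_partialDual_atBot f⟩

end RadialNLS

end

theorem mainTheorem4 (K lam : ℝ) (hlam : lam = 0 ∨ lam = 1 ∨ lam = -1) :
    -- (1) existence and uniqueness of the maximal solution, and mass conservation
    (∀ q₀ : RadialNLS.RadialL2, ∃ (Tmin Tmax : EReal) (q : ℝ → RadialNLS.RadialL2),
      RadialNLS.IsMaximalSolution K lam q₀ Tmin Tmax q ∧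
      (∀ (J : Set ℝ) (p : ℝ → RadialNLS.RadialL2), 0 ∈ J → RadialNLS.IsSolution K lam J p →
        p 0 = q₀ → J ⊆ RadialNLS.lifespan Tmin Tmax ∧ EqOn p q J) ∧
      (∀ t ∈ RadialNLS.lifespan Tmin Tmax, ‖q t‖ = ‖q₀‖)) ∧
    -- (2) blow-up criterion
    (∀ (q₀ : RadialNLS.RadialL2) (Tmin Tmax : EReal) (q : ℝ → RadialNLS.RadialL2),
      RadialNLS.IsMaximalSolution K lam q₀ Tmin Tmax q →
      (Tmax ≠ ⊤ →
        RadialNLS.scatteringSize (RadialNLS.lifespan Tmin Tmax ∩ Ici 0) q = ∞) ∧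
      (Tmin ≠ ⊥ →
        RadialNLS.scatteringSize (RadialNLS.lifespan Tmin Tmax ∩ Iic 0) q = ∞)) ∧
    -- (3) scattering
    (∀ (q₀ : RadialNLS.RadialL2) (Tmin Tmax : EReal) (q : ℝ → RadialNLS.RadialL2),
      RadialNLS.IsMaximalSolution K lam q₀ Tmin Tmax q →
      (Tmax = ⊤ → RadialNLS.scatteringSize (Ici 0) q < ∞ → RadialNLS.Scatters q atTop) ∧
      (Tmin = ⊥ → RadialNLS.scatteringSize (Iic 0) q < ∞ → RadialNLS.Scatters q atBot)) ∧
    -- (4) continuous dependence on the data at each time of the lifespan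
    (∀ (q₀ : RadialNLS.RadialL2) (Tmin Tmax : EReal) (q : ℝ → RadialNLS.RadialL2),
      RadialNLS.IsMaximalSolution K lam q₀ Tmin Tmax q →
      ∀ t ∈ RadialNLS.lifespan Tmin Tmax, ∀ ε > 0, ∃ δ > 0,
        ∀ (p₀ : RadialNLS.RadialL2) (Smin Smax : EReal) (p : ℝ → RadialNLS.RadialL2),
          RadialNLS.IsMaximalSolution K lam p₀ Smin Smax p → ‖p₀ - q₀‖ < δ →
          t ∈ RadialNLS.lifespan Smin Smax ∧ ‖p t - q t‖ < ε) ∧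
    -- (4) stability
    (∀ A > (0 : ℝ), ∀ ε > (0 : ℝ), ∃ δ > (0 : ℝ),
      ∀ (I : Set ℝ) (u : ℝ → RadialNLS.RadialL2) (e : ℝ → ℝ → ℂ) (t₀ : ℝ)
        (v₀ : RadialNLS.RadialL2),
        t₀ ∈ I → RadialNLS.IsForcedSolution K lam I u e →
        RadialNLS.scatteringSize I u ≤ ENNReal.ofReal A →
        AEStronglyMeasurable (Function.uncurry e)
          ((volume.restrict I).prod RadialNLS.radialMeasure) →
        eLpNorm (Function.uncurry e) (4 / 3)
          ((volume.restrict I).prod RadialNLS.radialMeasure) ≤ ENNReal.ofReal δ →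
        (∫⁻ t in I, ∫⁻ x : ℂ,
          ‖RadialNLS.freeL2 (t - t₀) (RadialNLS.vortexL2 (u t₀ - v₀)) x‖ₑ ^ 4)
            ≤ ENNReal.ofReal δ →
        ∃ v : ℝ → RadialNLS.RadialL2, RadialNLS.IsSolution K lam I v ∧ v t₀ = v₀ ∧
          RadialNLS.scatteringSize I (fun t => u t - v t) ≤ ENNReal.ofReal ε) ∧
    -- (5) small data
    (∃ η > (0 : ℝ), ∀ (q₀ : RadialNLS.RadialL2) (Tmin Tmax : EReal)
      (q : ℝ → RadialNLS.RadialL2), ‖q₀‖ < η →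
      RadialNLS.IsMaximalSolution K lam q₀ Tmin Tmax q →
      Tmin = ⊥ ∧ Tmax = ⊤ ∧ RadialNLS.scatteringSize univ q < ∞) := by
  refine ⟨fun q₀ => ?_, fun q₀ Tmin Tmax q h => ?_, fun q₀ Tmin Tmax q h => ?_,
    fun q₀ Tmin Tmax q h t ht ε hε => h.continuous_dependence ht hε, fun A hA ε hε => ?_,
    RadialNLS.exists_small_data K lam⟩
  · obtain ⟨Tmin, Tmax, q, h⟩ := RadialNLS.exists_isMaximalSolution K lam q₀
    refine ⟨Tmin, Tmax, q, h, fun J p hJ hp hp0 => h.subset_and_eqOn hJ hp hp0, fun t ht => ?_⟩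
    rw [← h.initial]
    exact h.isSolution.norm_eq ht h.zero_mem
  · exact ⟨h.scatteringSize_forward_eq_top, h.scatteringSize_backward_eq_top⟩
  · exact ⟨h.scatters_atTop, h.scatters_atBot⟩
  -- The conclusion concerns a fourth power, so the norm is made at most min 1 ε, whose fourth power
  -- is at most ε.
  · obtain ⟨δ, hδ, hstab⟩ := RadialNLS.exists_stability K lam A (min 1 ε) (by positivity)
    -- The forcing is measured by its norm and needs δ; the free evolution is measured by the fourth
    -- power of its norm and needs δ⁴.
    refine ⟨min δ (δ ^ 4), by positivity, fun I u e t₀ v₀ h₀ hu hS hem hen hfree => ?_⟩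
    have hI := hu.measurableSet
    have hδ' : 0 ≤ min δ (δ ^ 4) := by positivity
    obtain ⟨x, hx⟩ := hu.exists_isVersion (hS.trans_lt ENNReal.ofReal_lt_top)
    obtain ⟨g, hgn, hg⟩ := RadialNLS.exists_isVersion_force hI hδ' hem hen
    rw [← hx.enorm_pow_four_eq hI, RadialNLS.enorm_pow_four_le_ofReal_iff hA.le] at hS
    have hcut := (RadialNLS.pow_four_norm_cut_evolve_le hI hδ' hfree).trans (min_le_right _ _)
    obtain ⟨v, y, hv, hv0, hy, hyx⟩ := hstab I u e t₀ v₀ x g h₀ hu hx hg hS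
      (hgn.trans (min_le_left _ _)) (le_of_pow_le_pow_left₀ (by norm_num) hδ.le hcut)
    refine ⟨v, hv, hv0, ?_⟩
    rw [RadialNLS.scatteringSize_sub_eq hI hx hy, RadialNLS.enorm_pow_four_le_ofReal_iff hε.le]
    calc ‖y - x‖ ^ 4 ≤ (min 1 ε) ^ 4 := by gcongr
      _ ≤ min 1 ε := pow_le_of_le_one (by positivity) (min_le_left _ _) (by norm_num)
      _ ≤ ε := min_le_right _ _
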